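/- **Setting.** The kissing number in $\mathbb{R}^n$ is the maximal number of non-overlapping unit spheres externally tangent to the unit sphere. Let $\Lambda_{24}\subset\mathbb{R}^{24}$ be the Leech lattice, $\mathcal{C}$ its set of minimal vectors (so $|\mathcal{C}|=196560$, each of length $2$), and $\mathrm{Co}_0$ the group of linear isometries of $\mathbb{R}^{24}$ preserving $\Lambda_{24}$. Call $S\subseteq\mathcal{C}$ *admissible* if $\langle x,y\rangle\le 1$ for all distinct $x,y\in S$, and *antipodal* if $-S=S$. Write $\lfloor x\rfloor_2$ (resp. $\lceil x\rceil_2$) for the greatest even integer $\le x$ (resp. the smallest even integer $\ge x$). For numbers $b_1,b_2,\dots$ put $$\begin{aligned} B_{25}&=196560+b_1, & B_{26}&=196560+2b_1+2b_2, & B_{27}&=B_{26}+\textstyle\sum_{i=3}^{5}b_i,\\ B_{28}&=196560+2\textstyle\sum_{i=1}^{8}b_i, & B_{29}&=B_{28}+\textstyle\sum_{i=9}^{16}b_i, & B_{30}&=196560+2\textstyle\sum_{i=1}^{24}b_i,\qquad B_{31}=B_{30}+\textstyle\sum_{i=25}^{51}b_i . \end{aligned}$$ *Basic recursion from $m$*: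 $b_1=m$ and $b_{k+1}=\lceil m(1-\sum_{j\le k}b_j/196560)\rceil_2$. *Improved recursion from $m$*: $b_1=m$, $b_2=\lceil m(1-m/196560)\rceil_2$; given $b_1,\dots,b_k$ with $2\le k\le 50$, let $E_k=m\sum_{j\le k}b_j/196560$. If $\lfloor E_k\rfloor$ is even, put $b_{k+1}=b_{k+2}=m-\lfloor E_k\rfloor_2$; if it is odd, put $b_{k+1}=\lceil m(1-\sum_{j\le k}b_j/196560)\rceil_2$. Stop when $k>50$. *Improved recursion on sets from $S$*: a run consists of mutually disjoint antipodal admissible sets $S_1,\dots,S_K$, $K>50$, each contained in $gS$ for some $g\in\mathrm{Co}_0$, with $S_1=S$, $|S_2|=\lceil |S|(1-|S|/|\mathcal{C}|)\rceil_2$, built in rounds as follows, each round starting from some $k\le 50$. Let $E_k$ be the mean of $|gS\cap(S_1\cup\dots\cup S_k)|$ over $g\in\mathrm{Co}_0$. If $\lfloor E_k\rfloor$ is even, two sets are added with $|S_{k+1}|+|S_{k+2}|\ge 2(|S|-\lfloor E_k\rfloor_2)$, $2|S_{k+1}|+|S_{k+2}|\ge 3(|S|-\lfloor E_k\rfloor_2)$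 and $E_{k+2}=|S|\bigl(\sum_{j\le k}|S_j|+2(|S|-\lfloor E_k\rfloor_2)\bigr)/|\mathcal{C}|$; if it is odd, one set is added with $|S_{k+1}|=\lceil |S|(1-\sum_{j\le k}|S_j|/|\mathcal{C}|)\rceil_2$. **Theorem.** 1. There are antipodal admissible sets $S$ with $|S|=480$ and with $|S|=488$. 2. Let $S$ be any antipodal admissible set with $|S|=m\in\{480,488\}$. Then a run of the improved recursion on sets from $S$ exists. For every such run and every $25\le n\le 31$, the value of $B_n$ at $b_i=|S_i|$ is a lower bound for the kissing number in $\mathbb{R}^n$, and it is at least the value of $B_n$ produced by the improved recursion from $m$. 3. Consequently, for $m\in\{480,488\}$ and $25\le n\le 31$, the value of $B_n$ produced by the improved recursion from $m$ is a lower bound for the kissing number in $\mathbb{R}^n$. For $n=28,29,30,31$ these values are $204188,\ 207930,\ 219012,\ 230880$ if $m=480$, and $204316,\ 208120,\ 219380,\ 231428$ if $m=488$. 4. The basic recursion gives, for $n=28,29,30,31$, the values $204188,\ 207930,\ 219008,\ 230872$ if $m=480$, and $204312,\ 208114,\ 219368,\ 231412$ if $m=488$. Thus the improved recursion is strictly better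 in dimensions $28$ to $31$ for $m=488$, and in dimensions $30$ and $31$ for $m=480$ (for $m=480$ the two agree in dimensions $28$ and $29$). -/

import Mathlib

open Set

noncomputable section

namespace Kissing

/-! ### Kissing numbers -/

/-- `X` is the set of centres of a family of non-overlapping unit spheres in `ℝⁿ`, each externally
tangent to the unit sphere centred at the origin. -/
def IsKissingConfiguration {n : ℕ} (X : Set (EuclideanSpace ℝ (Fin n))) : Prop :=
  (∀ x ∈ X, dist x 0 = 2) ∧ X.PairwiseDisjoint (fun x => Metric.ball x 1)

/-- The kissing number in `ℝⁿ`, as a supremum in `ℕ∞` (so there is no default value). -/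
def kissingNumber (n : ℕ) : ℕ∞ :=
  ⨆ (X : Set (EuclideanSpace ℝ (Fin n))) (_ : IsKissingConfiguration X), X.encard

/-! ### The Golay code, the Leech lattice and its automorphism group -/

/-- The coefficient vectors of `X ^ i * (1 + X² + X⁴ + X⁵ + X⁶ + X¹⁰ + X¹¹)`, `i < 12`, in the
coordinates `0, …, 22`, extended by a parity bit in coordinate `23` (which is `1`, since the
generator polynomial has seven terms). -/
def golayRow (i : Fin 12) (j : Fin 24) : ZMod 2 :=
  if j.val = 23 ∨ ∃ a ∈ ({0, 2, 4, 5, 6, 10, 11} : Finset ℕ), j.val = i.val + a then 1 else 0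

/-- The extended binary Golay code. -/
def golayCode : Submodule (ZMod 2) (Fin 24 → ZMod 2) :=
  Submodule.span (ZMod 2) (Set.range golayRow)

/-- The vectors of `√8 Λ₂₄`: integer vectors whose coordinates are all congruent to one integer `m`
modulo `2`, whose coordinate sum is `4 m` modulo `8`, and such that for each `k` the places where
the coordinate is `k` modulo `4` form a Golay codeword. -/
def IsScaledLeechVector (x : Fin 24 → ℤ) : Prop :=
  ∃ m : ℤ, (∀ i, x i ≡ m [ZMOD 2]) ∧ (∑ i, x i) ≡ 4 * m [ZMOD 8] ∧
    ∀ k : ℤ, (fun i => if x i ≡ k [ZMOD 4] then (1 : ZMod 2) else 0) ∈ golayCode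

/-- The Leech lattice `Λ₂₄`. -/
def leechLattice : Set (EuclideanSpace ℝ (Fin 24)) :=
  {v | ∃ x : Fin 24 → ℤ, IsScaledLeechVector x ∧ ∀ i, v i = (x i : ℝ) / √8}

/-- The minimal vectors of `Λ₂₄`: the nonzero vectors of least length. -/
def minimalVectors : Set (EuclideanSpace ℝ (Fin 24)) :=
  {v | v ∈ leechLattice ∧ v ≠ 0 ∧ ∀ w ∈ leechLattice, w ≠ 0 → ‖v‖ ≤ ‖w‖}

/-- The Conway group `Co₀`: the linear isometries of `ℝ²⁴` that map `Λ₂₄` onto itself. -/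
def conwayGroup :
    Subgroup (EuclideanSpace ℝ (Fin 24) ≃ₗᵢ[ℝ] EuclideanSpace ℝ (Fin 24)) where
  carrier := {g | g '' leechLattice = leechLattice}
  one_mem' := by simp
  mul_mem' := by
    intro a b ha hb
    change a '' leechLattice = leechLattice at ha
    change b '' leechLattice = leechLattice at hb
    change ⇑(a * b) '' leechLattice = leechLattice
    rw [LinearIsometryEquiv.coe_mul, Set.image_comp, hb, ha]
  inv_mem' := by
    intro a ha
    change a '' leechLattice = leechLattice at ha
    change ⇑a⁻¹ '' leechLattice = leechLattice
    conv_lhs => rw [← ha]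
    rw [← Set.image_comp, ← LinearIsometryEquiv.coe_mul, inv_mul_cancel]
    simp

/-- A set of minimal vectors in which distinct elements have inner product at most `1`. -/
def IsAdmissible (S : Set (EuclideanSpace ℝ (Fin 24))) : Prop :=
  S ⊆ minimalVectors ∧ ∀ x ∈ S, ∀ y ∈ S, x ≠ y → inner ℝ x y ≤ 1

def IsAntipodal (S : Set (EuclideanSpace ℝ (Fin 24))) : Prop :=
  ∀ x ∈ S, -x ∈ S

/-! ### Rounding to even integers, and the sums that bound the kissing numbers -/

/-- The greatest even integer at most `x`. -/
def floorEven {K : Type*} [Field K] [LinearOrder K] [FloorRing K] (x : K) : ℤ := 2 * ⌊x / 2⌋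

/-- The smallest even integer at least `x`. -/
def ceilEven {K : Type*} [Field K] [LinearOrder K] [FloorRing K] (x : K) : ℤ := 2 * ⌈x / 2⌉

/-- The lower bound for the kissing number in `ℝⁿ`, `25 ≤ n ≤ 31`, that comes from disjoint
admissible sets of sizes `b 1, b 2, …`. -/
def tableSum (n : ℕ) (b : ℕ → ℕ) : ℕ :=
  match n with
  | 25 => 196560 + b 1
  | 26 => 196560 + 2 * b 1 + 2 * b 2
  | 27 => 196560 + 2 * b 1 + 2 * b 2 + ∑ i ∈ Finset.Icc 3 5, b i
  | 28 => 196560 + 2 * ∑ i ∈ Finset.Icc 1 8, b i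
  | 29 => 196560 + 2 * (∑ i ∈ Finset.Icc 1 8, b i) + ∑ i ∈ Finset.Icc 9 16, b i
  | 30 => 196560 + 2 * ∑ i ∈ Finset.Icc 1 24, b i
  | 31 => 196560 + 2 * (∑ i ∈ Finset.Icc 1 24, b i) + ∑ i ∈ Finset.Icc 25 51, b i
  | _ => 0

/-! ### The recursions on sizes -/

/-- The expected overlap `E_k = |S| (∑_{j ≤ k} |S_j|) / 196560`, from `m = |S|` and the list
`l = [|S_1|, …, |S_k|]`. -/
def listOverlap (m : ℕ) (l : List ℕ) : ℚ := m * (l.sum : ℚ) / 196560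

/-- The bound `|S| (1 - (∑_{j ≤ k} |S_j|) / 196560)` for `|S_{k+1}|`, rounded up to an even integer
(the sets are antipodal). -/
def listBasicBound (m : ℕ) (l : List ℕ) : ℕ :=
  (ceilEven ((m : ℚ) * (1 - (l.sum : ℚ) / 196560))).toNat

/-- The sizes of `51` sets in the basic recursion. -/
def basicList (m : ℕ) : List ℕ := (fun l => l ++ [listBasicBound m l])^[50] [m]

/-- One round of the improved recursion on a list of bounds for `|S_1|, …, |S_k|`; nothing happens
once `k > 50`. -/
def improvedStep (m : ℕ) (l : List ℕ) : List ℕ :=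
  if 50 < l.length then l
  else if Even ⌊listOverlap m l⌋ then
    l ++ [((m : ℤ) - floorEven (listOverlap m l)).toNat,
      ((m : ℤ) - floorEven (listOverlap m l)).toNat]
  else l ++ [listBasicBound m l]

/-- The sizes in the improved recursion. It starts with two sets and each round adds at least one,
so that `50` rounds reach `k > 50`. -/
def improvedList (m : ℕ) : List ℕ := (improvedStep m)^[50] [m, listBasicBound m [m]]

/-- The sizes `b 1, b 2, …` recorded in a list. -/
def sizes (l : List ℕ) (i : ℕ) : ℕ := l.getD (i - 1) 0

/-! ### The recursion on sets -/

/-- `E_k`: the mean of `|gS ∩ (S_1 ∪ ⋯ ∪ S_k)|` over the elements `g` of `Co₀`. -/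
def expectedOverlap (S : Set (EuclideanSpace ℝ (Fin 24)))
    (T : ℕ → Set (EuclideanSpace ℝ (Fin 24))) (k : ℕ) : ℝ :=
  (∑ᶠ g : conwayGroup, (((g.1 '' S) ∩ ⋃ j ∈ Finset.Icc 1 k, T j).ncard : ℝ)) /
    Nat.card conwayGroup

/-- The lower bound `|S| (1 - (∑_{j ≤ k} |S_j|) / |𝒞|)` for `|S_{k+1}|`. -/
def basicBound (S : Set (EuclideanSpace ℝ (Fin 24)))
    (T : ℕ → Set (EuclideanSpace ℝ (Fin 24))) (k : ℕ) : ℝ :=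
  (S.ncard : ℝ) * (1 - (∑ j ∈ Finset.Icc 1 k, ((T j).ncard : ℝ)) / (minimalVectors.ncard : ℝ))

/-- The size conditions of the improved recursion on sets `T 1, …, T k`. Where the recursion
guarantees only a lower bound for the size of a set, surplus antipodal pairs are deleted, so that
the next rounds can use the bound as the size. In a round with `⌊E_k⌋` even, the two new sizes
are constrained jointly and not determined. -/
inductive ImprovedRounds (S : Set (EuclideanSpace ℝ (Fin 24)))
    (T : ℕ → Set (EuclideanSpace ℝ (Fin 24))) : ℕ → Prop
  | start : T 1 = S → ((T 2).ncard : ℤ) = ceilEven (basicBound S T 1) → ImprovedRounds S T 2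
  | even (k : ℕ) : ImprovedRounds S T k → k ≤ 50 → Even ⌊expectedOverlap S T k⌋ →
      expectedOverlap S T (k + 2) =
        (S.ncard : ℝ) * ((∑ j ∈ Finset.Icc 1 k, ((T j).ncard : ℝ)) +
          2 * ((S.ncard : ℝ) - (floorEven (expectedOverlap S T k) : ℝ))) /
            (minimalVectors.ncard : ℝ) →
      2 * ((S.ncard : ℤ) - floorEven (expectedOverlap S T k)) ≤
        ((T (k + 1)).ncard : ℤ) + ((T (k + 2)).ncard : ℤ) →
      3 * ((S.ncard : ℤ) - floorEven (expectedOverlap S T k)) ≤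
        2 * ((T (k + 1)).ncard : ℤ) + ((T (k + 2)).ncard : ℤ) →
      ImprovedRounds S T (k + 2)
  | odd (k : ℕ) : ImprovedRounds S T k → k ≤ 50 → Odd ⌊expectedOverlap S T k⌋ →
      ((T (k + 1)).ncard : ℤ) = ceilEven (basicBound S T k) →
      ImprovedRounds S T (k + 1)

/-- `T 1, …, T K` is a complete run of the improved recursion from `S`: mutually disjoint antipodal
admissible sets, each inside a translate of `S` under `Co₀`, with the sizes that the recursion
prescribes, stopped as soon as `K > 50`. -/
structure IsImprovedRun (S : Set (EuclideanSpace ℝ (Fin 24)))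
    (T : ℕ → Set (EuclideanSpace ℝ (Fin 24))) (K : ℕ) : Prop where
  admissible : ∀ j ∈ Finset.Icc 1 K, IsAdmissible (T j)
  antipodal : ∀ j ∈ Finset.Icc 1 K, IsAntipodal (T j)
  translate : ∀ j ∈ Finset.Icc 1 K, ∃ g ∈ conwayGroup, T j ⊆ g '' S
  disjoint : ∀ i ∈ Finset.Icc 1 K, ∀ j ∈ Finset.Icc 1 K, i ≠ j → Disjoint (T i) (T j)
  rounds : ImprovedRounds S T K
  length_gt : 50 < K

end Kissing

end

noncomputable section

namespace Kissing

/-! ### Binary words as bit masks and as finite sets -/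

/-! Kissing configurations. Let S_1, S_2, … be disjoint admissible sets. In ℝ²⁴ × ℝᵈ each x in S_j
is replaced by the vectors (α x, β y), where y runs over three unit vectors at mutual angles 2π/3 (a
triangle) or over an antipodal pair of unit vectors. Take α² = 2/3, β² = 4/3 for a triangle and α² =
3/4, β = 1 for a pair. Then norms remain 2 and inner products remain at most 2, as long as
directions from different triangles or pairs are at angles at least π/3. The roots of A₁, A₂, A₃,
D₄, D₅, E₆, E₇ split into such triangles and pairs. A triangle gains 2|S_j| spheres and a pair gains
|S_j|; adding up gives `tableSum` (`card_add_sum_le_kissingNumber`, `tableSum_le_kissingNumber`).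

Disjoint sets. `conwayGroup` is finite and transitive on the minimal vectors
(`exists_conway_apply_eq`), so for a set U of minimal vectors the mean of |gS ∩ U| is E =
|S||U|/196560 (`mean_overlap`). Some g does no worse than the mean, and overlaps of antipodal sets
are even. So gS \ U has at least |S| - ⌊E⌋₂ elements, which is the basic recursion
(`exists_translatePart`).

The improvement. Since |S|² < 2 · 196560, the same argument with U = S gives t with tS disjoint from
S. The mean of |gS ∩ U| + |gtS ∩ U| is 2E, so some g has this even sum at most 2E. If e = ⌊E⌋ is
even, then 2E < 2e + 2 and the sum is at most 2e. The two disjoint sets gS \ U and gtS \ U thus have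
at least 2(|S| - e) elements together (`exists_translatePart_pair`). Two successive basic steps may
lose two elements, because the mean grows between them.

Comparison. In such a round the two sizes are not determined, but their sum is, and the first set
can be taken to be the larger. Hence partial sums of the sizes dominate those of the recursion on
sizes (`ImprovedRounds.exists_iterate`). Each `tableSum n` is a nonnegative combination of partial
sums, plus a constant (`tableSum_mono`).

Facts about the Leech lattice are proved from the Golay code, whose 4096 words are enumerated. The
minimal vectors are classified and counted, and transitivity comes from sign changes on codewords
and from the maps `sextetMap`. The starting sets are initial parts of an explicit table. -/

/-- The set of places below `24` where the binary expansion of `n` has a `1`. -/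
def maskSet (n : ℕ) : Finset (Fin 24) := Finset.univ.filter fun i => n.testBit i

/-- The indicator word of a set of places. -/
def indicatorWord (A : Finset (Fin 24)) (i : Fin 24) : ZMod 2 := if i ∈ A then 1 else 0

/-- All the sums modulo `2` of the masks in a list. -/
def xorSpan : List ℕ → List ℕ
  | [] => [0]
  | r :: l => xorSpan l ++ (xorSpan l).map (r ^^^ ·)

/-- The number of ones among the last `k` binary digits of `n`. -/
def bitCount (n : ℕ) : ℕ → ℕ
  | 0 => 0
  | k + 1 => bitCount n k + n / 2 ^ k % 2

/-- The masks of the rows `golayRow`. -/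
def golayMasks : List ℕ := (List.range 12).map fun i => 2 ^ 23 + 3189 * 2 ^ i

theorem indicatorWord_symmDiff (A B : Finset (Fin 24)) :
    indicatorWord (symmDiff A B) = indicatorWord A + indicatorWord B := by
  funext i
  simp only [indicatorWord, Pi.add_apply, Finset.mem_symmDiff]
  by_cases hA : i ∈ A <;> by_cases hB : i ∈ B <;> simp [hA, hB]
  decide

theorem indicatorWord_injective : Function.Injective indicatorWord := by
  intro A B h
  ext i
  have := congrFun h i
  by_cases hA : i ∈ A <;> by_cases hB : i ∈ B <;> simp_all [indicatorWord]

theorem indicatorWord_support (c : Fin 24 → ZMod 2) :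
    indicatorWord (Finset.univ.filter fun i => c i ≠ 0) = c := by
  have key : ∀ a : ZMod 2, (if a ≠ 0 then (1 : ZMod 2) else 0) = a := by decide
  funext i
  simpa [indicatorWord] using key (c i)

theorem maskSet_xor (a b : ℕ) : maskSet (a ^^^ b) = symmDiff (maskSet a) (maskSet b) := by
  ext i
  simp only [maskSet, Finset.mem_filter, Finset.mem_univ, true_and, Finset.mem_symmDiff,
    Nat.testBit_xor]
  cases a.testBit i <;> cases b.testBit i <;> simp

theorem bitCount_eq_sum (n k : ℕ) : bitCount n k = ∑ i ∈ Finset.range k, n / 2 ^ i % 2 := by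
  induction k with
  | zero => rfl
  | succ k ih => rw [bitCount, ih, Finset.sum_range_succ]

theorem card_maskSet (n : ℕ) : (maskSet n).card = bitCount n 24 := by
  rw [bitCount_eq_sum, maskSet, Finset.card_filter,
    ← Fin.sum_univ_eq_sum_range (fun i => n / 2 ^ i % 2)]
  refine Finset.sum_congr rfl fun i _ => ?_
  rw [Nat.testBit_eq_decide_div_mod_eq]
  rcases Nat.mod_two_eq_zero_or_one (n / 2 ^ (i : ℕ)) with h | h <;> simp [h]

/-- The only scalars are 0 and 1, so a new generator adds to the list exactly the translate of the
old list by that generator. -/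
theorem mem_span_iff_mem_xorSpan (l : List ℕ) (c : Fin 24 → ZMod 2) :
    c ∈ Submodule.span (ZMod 2) ((fun n => indicatorWord (maskSet n)) '' {n | n ∈ l}) ↔
      ∃ n ∈ xorSpan l, indicatorWord (maskSet n) = c := by
  induction l generalizing c with
  | nil =>
    have : indicatorWord (maskSet 0) = 0 := by
      funext i; simp [indicatorWord, maskSet]
    simp [xorSpan, this, eq_comm]
  | cons r l ih =>
    have hset : {n | n ∈ r :: l} = insert r {n | n ∈ l} := by ext; simp
    rw [hset, Set.image_insert_eq, Submodule.mem_span_insert]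
    constructor
    · rintro ⟨a, z, hz, rfl⟩
      obtain ⟨n, hn, rfl⟩ := (ih z).1 hz
      have ha : a = 0 ∨ a = 1 := by revert a; decide
      rcases ha with rfl | rfl
      · exact ⟨n, by simp [xorSpan, hn], by simp⟩
      · refine ⟨r ^^^ n, by simp only [xorSpan, List.mem_append, List.mem_map]; exact Or.inr ⟨n, hn, rfl⟩, ?_⟩
        rw [maskSet_xor, indicatorWord_symmDiff, one_smul]
    · rintro ⟨n, hn, rfl⟩
      rcases List.mem_append.1 hn with hn | hn
      · exact ⟨0, _, (ih _).2 ⟨n, hn, rfl⟩, by simp⟩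
      · obtain ⟨k, hk, rfl⟩ := List.mem_map.1 hn
        refine ⟨1, _, (ih _).2 ⟨k, hk, rfl⟩, ?_⟩
        rw [maskSet_xor, indicatorWord_symmDiff, one_smul]

/-! ### The Golay code: enumeration, weights and octads -/

theorem golayRow_eq (i : Fin 12) :
    golayRow i = indicatorWord (maskSet (2 ^ 23 + 3189 * 2 ^ (i : ℕ))) := by
  have : ∀ (i : Fin 12) (j : Fin 24), golayRow i j =
    indicatorWord (maskSet (2 ^ 23 + 3189 * 2 ^ (i : ℕ))) j := by decide +kernel
  exact funext (this i)

theorem golayCode_eq_span : golayCode =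
    Submodule.span (ZMod 2) ((fun n => indicatorWord (maskSet n)) '' {n | n ∈ golayMasks}) := by
  rw [golayCode]
  congr 1
  ext c
  simp only [golayMasks, List.mem_map, List.mem_range, Set.mem_range, Set.mem_image,
    Set.mem_ofPred_eq]
  constructor
  · rintro ⟨i, rfl⟩
    exact ⟨_, ⟨i, i.2, rfl⟩, (golayRow_eq i).symm⟩
  · rintro ⟨_, ⟨i, hi, rfl⟩, rfl⟩
    exact ⟨⟨i, hi⟩, golayRow_eq _⟩

theorem mem_golayCode_iff (c : Fin 24 → ZMod 2) :
    c ∈ golayCode ↔ ∃ n ∈ xorSpan golayMasks, indicatorWord (maskSet n) = c := by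
  rw [golayCode_eq_span, mem_span_iff_mem_xorSpan]

theorem xor_mem_xorSpan (l : List ℕ) {a b : ℕ} (ha : a ∈ xorSpan l) (hb : b ∈ xorSpan l) :
    a ^^^ b ∈ xorSpan l := by
  induction l generalizing a b with
  | nil => simp_all [xorSpan]
  | cons r l ih =>
    simp only [xorSpan, List.mem_append, List.mem_map] at ha hb ⊢
    rcases ha with ha | ⟨a, ha, rfl⟩ <;> rcases hb with hb | ⟨b, hb, rfl⟩
    · exact Or.inl (ih ha hb)
    · exact Or.inr ⟨_, ih ha hb, by rw [← Nat.xor_assoc, ← Nat.xor_assoc, Nat.xor_comm a r]⟩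
    · exact Or.inr ⟨_, ih ha hb, by rw [Nat.xor_assoc]⟩
    · refine Or.inl ?_
      have : r ^^^ a ^^^ (r ^^^ b) = a ^^^ b := by
        rw [Nat.xor_comm r a, Nat.xor_assoc, ← Nat.xor_assoc r r b, Nat.xor_self, Nat.zero_xor]
      rw [this]
      exact ih ha hb

/-- The two halves of the list are cosets of a subgroup. A common element would put `r` in the
subgroup. -/
theorem nodup_xorSpan_cons {r : ℕ} {l : List ℕ} (hl : (xorSpan l).Nodup) (hr : r ∉ xorSpan l) :
    (xorSpan (r :: l)).Nodup := by
  rw [xorSpan, List.nodup_append]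
  refine ⟨hl, hl.map (Nat.xor_right_injective), ?_⟩
  rintro a ha b hb rfl
  obtain ⟨c, hc, h⟩ := List.mem_map.1 hb
  apply hr
  have : r = a ^^^ c := by rw [← h, Nat.xor_assoc, Nat.xor_self, Nat.xor_zero]
  rw [this]
  exact xor_mem_xorSpan l ha hc

/-- Whether `p` holds for all the sums of `a` and an element of `xorSpan l`. -/
def xorAll (p : ℕ → Bool) : List ℕ → ℕ → Bool
  | [], a => p a
  | r :: l, a => xorAll p l a && xorAll p l (a ^^^ r)

/-- The number of the sums of `a` and an element of `xorSpan l` for which `p` holds. -/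
def xorCount (p : ℕ → Bool) : List ℕ → ℕ → ℕ
  | [], a => (p a).toNat
  | r :: l, a => xorCount p l a + xorCount p l (a ^^^ r)

/-- A property of all 4096 codewords is checked by recursion on the twelve generators with an
accumulator; the list itself is never formed. `countP_xorSpan` does the same for counting. -/
theorem of_xorAll {p : ℕ → Bool} {l : List ℕ} {a : ℕ} (h : xorAll p l a) :
    ∀ n ∈ xorSpan l, p (a ^^^ n) := by
  induction l generalizing a with
  | nil => simpa [xorSpan, xorAll] using h
  | cons r l ih =>
    simp only [xorAll, Bool.and_eq_true] at h
    intro n hn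
    rcases List.mem_append.1 hn with hn | hn
    · exact ih h.1 n hn
    · obtain ⟨k, hk, rfl⟩ := List.mem_map.1 hn
      rw [← Nat.xor_assoc]
      exact ih h.2 k hk

theorem countP_xorSpan (p : ℕ → Bool) (l : List ℕ) (a : ℕ) :
    (xorSpan l).countP (fun n => p (a ^^^ n)) = xorCount p l a := by
  induction l generalizing a with
  | nil => cases h : p a <;> simp [xorSpan, xorCount, h]
  | cons r l ih =>
    rw [xorSpan, List.countP_append, List.countP_map, ih, xorCount, ← ih (a ^^^ r)]
    simp only [Function.comp_def, Nat.xor_assoc]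

theorem length_xorSpan (l : List ℕ) : (xorSpan l).length = 2 ^ l.length := by
  induction l with
  | nil => rfl
  | cons r l ih => simp [xorSpan, ih, pow_succ, mul_two]

theorem nodup_xorSpan_golayMasks : (xorSpan golayMasks).Nodup := by
  -- Linear independence in triangular form: no row lies in the span of the rows after it.
  have h : ∀ l : List ℕ, l.tails.all (fun t => t.head?.all fun r =>
      xorAll (fun n => n != r) t.tail 0) → (xorSpan l).Nodup := by
    intro l
    induction l with
    | nil => intro _; simp [xorSpan]
    | cons r l ih =>
      intro hl
      simp only [List.tails, List.all_cons, Bool.and_eq_true] at hl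
      refine nodup_xorSpan_cons (ih hl.2) fun hr => ?_
      have := of_xorAll (show xorAll (fun n => n != r) l 0 from hl.1) r hr
      simp at this
  exact h _ (by decide +kernel)

theorem lt_of_mem_golay {n : ℕ} (hn : n ∈ xorSpan golayMasks) : n < 2 ^ 24 := by
  have : xorAll (fun n => n < 2 ^ 24) golayMasks 0 := by decide +kernel
  simpa using of_xorAll this n hn

/-- The code is doubly even and has minimum weight 8. -/
theorem golay_bitCount {n : ℕ} (hn : n ∈ xorSpan golayMasks) :
    bitCount n 24 % 4 = 0 ∧ (bitCount n 24 < 8 → n = 0) := by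
  have : xorAll (fun n => bitCount n 24 % 4 = 0 ∧ (bitCount n 24 < 8 → n = 0)) golayMasks 0 := by
    decide +kernel
  exact of_decide_eq_true (by simpa only [Nat.zero_xor] using of_xorAll this n hn)

theorem golay_countP_eight :
    (xorSpan golayMasks).countP (fun n => bitCount n 24 = 8) = 759 := by
  have h := countP_xorSpan (fun n => bitCount n 24 = 8) golayMasks 0
  simp only [Nat.zero_xor] at h
  rw [h]
  decide +kernel

theorem maskSet_injOn : Set.InjOn maskSet {n | n < 2 ^ 24} := by
  intro a ha b hb h
  apply Nat.eq_of_testBit_eq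
  intro i
  by_cases hi : i < 24
  · have := congrArg (fun s => (⟨i, hi⟩ : Fin 24) ∈ s) h
    simpa [maskSet] using this
  · rw [Nat.testBit_eq_false_of_lt (lt_of_lt_of_le ha (Nat.pow_le_pow_right two_pos (by omega))),
      Nat.testBit_eq_false_of_lt (lt_of_lt_of_le hb (Nat.pow_le_pow_right two_pos (by omega)))]

/-- The supports of the Golay codewords. -/
@[irreducible] def golaySets : Finset (Finset (Fin 24)) := ((xorSpan golayMasks).map maskSet).toFinset

/-- The supports of the Golay codewords of weight `8`. -/
def octads : Finset (Finset (Fin 24)) := golaySets.filter fun A => A.card = 8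

theorem mem_golaySets {A : Finset (Fin 24)} :
    A ∈ golaySets ↔ indicatorWord A ∈ golayCode := by
  rw [mem_golayCode_iff, golaySets]
  simp only [List.mem_toFinset, List.mem_map]
  exact exists_congr fun n => and_congr_right fun _ => (indicatorWord_injective.eq_iff).symm

theorem support_mem_golaySets {c : Fin 24 → ZMod 2} (hc : c ∈ golayCode) :
    (Finset.univ.filter fun i => c i ≠ 0) ∈ golaySets := by
  rw [mem_golaySets, indicatorWord_support]
  exact hc

theorem nodup_map_maskSet : ((xorSpan golayMasks).map maskSet).Nodup :=
  nodup_xorSpan_golayMasks.map_on fun _ ha _ hb h =>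
    maskSet_injOn (lt_of_mem_golay ha) (lt_of_mem_golay hb) h

theorem card_golaySets : golaySets.card = 4096 := by
  rw [golaySets, List.toFinset_card_of_nodup nodup_map_maskSet, List.length_map,
    length_xorSpan]
  rfl

theorem card_octads : octads.card = 759 := by
  have h : octads = (((xorSpan golayMasks).map maskSet).filter fun A => A.card = 8).toFinset := by
    ext A
    simp [octads, golaySets]
  rw [h, List.toFinset_card_of_nodup (nodup_map_maskSet.filter _),
    ← List.countP_eq_length_filter, List.countP_map, ← golay_countP_eight]
  congr 1
  funext n
  simp [card_maskSet]

theorem four_dvd_card {A : Finset (Fin 24)} (hA : A ∈ golaySets) : 4 ∣ A.card := by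
  simp only [golaySets, List.mem_toFinset, List.mem_map] at hA
  obtain ⟨n, hn, rfl⟩ := hA
  rw [card_maskSet]
  exact Nat.dvd_of_mod_eq_zero (golay_bitCount hn).1

theorem eq_empty_of_card_lt_eight {A : Finset (Fin 24)} (hA : A ∈ golaySets) (h : A.card < 8) :
    A = ∅ := by
  simp only [golaySets, List.mem_toFinset, List.mem_map] at hA
  obtain ⟨n, hn, rfl⟩ := hA
  rw [card_maskSet] at h
  rw [(golay_bitCount hn).2 h]
  simp [maskSet]

theorem univ_mem_golaySets : Finset.univ ∈ golaySets := by
  have h : 2 ^ 24 - 1 ∈ xorSpan golayMasks := by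
    by_contra hn
    -- Counting the occurrences of the all-ones word gives 1, while absence would give 0.
    have := countP_xorSpan (fun n => n = 2 ^ 24 - 1) golayMasks 0
    rw [show xorCount (fun n => n = 2 ^ 24 - 1) golayMasks 0 = 1 by decide +kernel,
      List.countP_eq_zero.2 fun a ha => by
        simp only [Nat.zero_xor, decide_eq_true_eq]; rintro rfl; exact hn ha] at this
    exact absurd this (by norm_num)
  have h' : maskSet (2 ^ 24 - 1) = Finset.univ := by decide +kernel
  rw [← h', golaySets, List.mem_toFinset]
  exact List.mem_map_of_mem h

theorem symmDiff_mem_golaySets {A B : Finset (Fin 24)} (hA : A ∈ golaySets)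
    (hB : B ∈ golaySets) : symmDiff A B ∈ golaySets := by
  rw [mem_golaySets] at *
  rw [indicatorWord_symmDiff]
  exact add_mem hA hB

theorem card_symmDiff_add {α : Type*} [DecidableEq α] (A B : Finset α) :
    (symmDiff A B).card + 2 * (A ∩ B).card = A.card + B.card := by
  have h1 := Finset.card_sdiff_add_card_inter A B
  have h2 := Finset.card_sdiff_add_card_inter B A
  rw [Finset.inter_comm B A] at h2
  have h3 : (symmDiff A B).card = (A \ B).card + (B \ A).card := by
    rw [symmDiff_def]
    exact Finset.card_union_of_disjoint (disjoint_sdiff_sdiff)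
  omega

/-- A doubly even code is self-orthogonal: 2|A ∩ B| = |A| + |B| - |A Δ B|, and all three terms are
multiples of 4. -/
theorem even_card_inter {A B : Finset (Fin 24)} (hA : A ∈ golaySets) (hB : B ∈ golaySets) :
    Even (A ∩ B).card := by
  have h1 := four_dvd_card hA
  have h2 := four_dvd_card hB
  have h3 := four_dvd_card (symmDiff_mem_golaySets hA hB)
  have h4 := card_symmDiff_add A B
  rw [Nat.even_iff]
  omega

theorem mem_octads {A : Finset (Fin 24)} : A ∈ octads ↔ A ∈ golaySets ∧ A.card = 8 := by
  rw [octads, Finset.mem_filter]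

/-- Otherwise the symmetric difference would be a nonzero codeword of weight at most 16 - 10 = 6. -/
theorem octad_eq_of_five_le {A B : Finset (Fin 24)} (hA : A ∈ octads) (hB : B ∈ octads)
    (h : 5 ≤ (A ∩ B).card) : A = B := by
  rw [mem_octads] at hA hB
  have h4 := card_symmDiff_add A B
  have := eq_empty_of_card_lt_eight (symmDiff_mem_golaySets hA.1 hB.1) (by omega)
  exact symmDiff_eq_bot.1 this

/-- Any five places lie in an octad. -/
theorem exists_octad {F : Finset (Fin 24)} (hF : F.card = 5) : ∃ A ∈ octads, F ⊆ A := by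
  have hsub : octads.biUnion (fun A => A.powersetCard 5) ⊆ Finset.univ.powersetCard 5 := by
    intro F hF
    simp only [Finset.mem_biUnion, Finset.mem_powersetCard] at hF ⊢
    obtain ⟨A, _, _, h⟩ := hF
    exact ⟨Finset.subset_univ _, h⟩
  -- No five places lie in two octads, so the octads cover 759 · 56 = 42504 five-sets, and this is
  -- the number of all of them, 24 choose 5.
  have hcard : (octads.biUnion (fun A => A.powersetCard 5)).card = 42504 := by
    rw [Finset.card_biUnion]
    · rw [Finset.sum_const_nat (m := 56), card_octads]
      intro A hA
      rw [Finset.card_powersetCard, (mem_octads.1 hA).2]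
      rfl
    · intro A hA B hB hAB
      rw [Function.onFun_apply, Finset.disjoint_left]
      intro F hFA hFB
      rw [Finset.mem_powersetCard] at hFA hFB
      apply hAB (octad_eq_of_five_le hA hB _)
      rw [← hFA.2]
      exact Finset.card_le_card (Finset.subset_inter hFA.1 hFB.1)
  have heq := Finset.eq_of_subset_of_card_le hsub (by
    rw [hcard, Finset.card_powersetCard, Finset.card_univ, Fintype.card_fin]
    norm_num [Nat.choose])
  have : F ∈ Finset.univ.powersetCard 5 := by simp [hF]
  rw [← heq] at this
  simp only [Finset.mem_biUnion, Finset.mem_powersetCard] at this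
  obtain ⟨A, hA, h, _⟩ := this
  exact ⟨A, hA, h⟩

/-! ### Scaled Leech vectors -/

theorem zmod_two_cases (a : ZMod 2) : a = 0 ∨ a = 1 := by revert a; decide

theorem golay_dot {c d : Fin 24 → ZMod 2} (hc : c ∈ golayCode) (hd : d ∈ golayCode) :
    ∑ i, c i * d i = 0 := by
  have h := even_card_inter (support_mem_golaySets hc) (support_mem_golaySets hd)
  rw [← Finset.filter_and] at h
  have h2 : ∑ i, c i * d i =
      ((Finset.univ.filter fun i => c i ≠ 0 ∧ d i ≠ 0).card : ZMod 2) := by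
    rw [Finset.card_filter, Nat.cast_sum]
    refine Finset.sum_congr rfl fun i _ => ?_
    rcases zmod_two_cases (c i) with h | h <;> rcases zmod_two_cases (d i) with h' | h' <;>
      simp [h, h']
  rw [h2]
  exact (ZMod.natCast_eq_zero_iff_even).2 h

theorem one_mem_golayCode : (fun _ => 1 : Fin 24 → ZMod 2) ∈ golayCode := by
  have := mem_golaySets.1 univ_mem_golaySets
  convert this using 1
  funext i
  simp [indicatorWord]

/-- Of the conditions for all `k`, one remains. With x = m + 2y, the places congruent to k modulo 4
form the word y mod 2 if k ≡ m + 2, its complement if k ≡ m, and the zero word if k - m is odd; the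
all-ones word is a codeword. -/
theorem isScaledLeechVector_iff (x : Fin 24 → ℤ) :
    IsScaledLeechVector x ↔ ∃ (m : ℤ) (y : Fin 24 → ℤ), (∀ i, x i = m + 2 * y i) ∧
      (fun i => (y i : ZMod 2)) ∈ golayCode ∧ (∑ i, x i) ≡ 4 * m [ZMOD 8] := by
  constructor
  · rintro ⟨m, h1, h2, h3⟩
    have hy : ∀ i, ∃ y, x i = m + 2 * y := fun i => by
      obtain ⟨y, hy⟩ := (h1 i).symm.dvd
      exact ⟨y, by linarith⟩
    choose y hy using hy
    refine ⟨m, y, hy, ?_, h2⟩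
    convert h3 (m + 2) using 2 with i
    rw [hy]
    rcases Int.even_or_odd (y i) with h | h
    · rw [(ZMod.intCast_eq_zero_iff_even).2 h, if_neg]
      obtain ⟨k, hk⟩ := h
      rw [Int.modEq_iff_dvd]
      omega
    · rw [(ZMod.intCast_eq_one_iff_odd).2 h, if_pos]
      obtain ⟨k, hk⟩ := h
      rw [Int.modEq_iff_dvd]
      omega
  · rintro ⟨m, y, hy, hc, hs⟩
    refine ⟨m, fun i => ?_, hs, fun k => ?_⟩
    · rw [hy, Int.modEq_iff_dvd]
      omega
    · by_cases hk : k ≡ m [ZMOD 2]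
      · obtain ⟨l, hl⟩ := hk.symm.dvd
        rcases Int.even_or_odd l with h | h
        · convert add_mem one_mem_golayCode hc using 1
          funext i
          simp only [Pi.add_apply]
          obtain ⟨l', hl'⟩ := h
          rcases Int.even_or_odd (y i) with h | h
          · rw [(ZMod.intCast_eq_zero_iff_even).2 h, if_pos, add_zero]
            obtain ⟨t, ht⟩ := h
            rw [hy, Int.modEq_iff_dvd]
            omega
          · rw [(ZMod.intCast_eq_one_iff_odd).2 h, if_neg]
            · rfl
            obtain ⟨t, ht⟩ := h
            rw [hy, Int.modEq_iff_dvd]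
            omega
        · convert hc using 1
          funext i
          obtain ⟨l', hl'⟩ := h
          rcases Int.even_or_odd (y i) with h | h
          · rw [(ZMod.intCast_eq_zero_iff_even).2 h, if_neg]
            obtain ⟨t, ht⟩ := h
            rw [hy, Int.modEq_iff_dvd]
            omega
          · rw [(ZMod.intCast_eq_one_iff_odd).2 h, if_pos]
            obtain ⟨t, ht⟩ := h
            rw [hy, Int.modEq_iff_dvd]
            omega
      · convert zero_mem golayCode using 1
        funext i
        rw [if_neg]
        · rfl
        intro h
        apply hk
        rw [Int.modEq_iff_dvd] at *
        have := hy i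
        omega

theorem IsScaledLeechVector.sub {x x' : Fin 24 → ℤ} (hx : IsScaledLeechVector x)
    (hx' : IsScaledLeechVector x') : IsScaledLeechVector (x - x') := by
  rw [isScaledLeechVector_iff] at *
  obtain ⟨m, y, h1, h2, h3⟩ := hx
  obtain ⟨m', y', h1', h2', h3'⟩ := hx'
  refine ⟨m - m', y - y', fun i => ?_, ?_, ?_⟩
  · simp only [Pi.sub_apply, h1, h1']; ring
  · convert sub_mem h2 h2' using 1
    funext i
    simp
  · simp only [Pi.sub_apply, Finset.sum_sub_distrib, mul_sub]
    exact h3.sub h3'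

theorem isScaledLeechVector_zero : IsScaledLeechVector 0 := by
  rw [isScaledLeechVector_iff]
  exact ⟨0, 0, by simp, by
    convert zero_mem golayCode using 1; funext i; simp, by simp [Int.ModEq.refl]⟩

theorem IsScaledLeechVector.neg {x : Fin 24 → ℤ} (hx : IsScaledLeechVector x) :
    IsScaledLeechVector (-x) := by
  simpa using isScaledLeechVector_zero.sub hx

/-- The representation `x = m + 2 y` of a scaled Leech vector, with its consequences. -/
theorem IsScaledLeechVector.exists_rep {x : Fin 24 → ℤ} (hx : IsScaledLeechVector x) :
    ∃ (m : ℤ) (y : Fin 24 → ℤ), (∀ i, x i = m + 2 * y i) ∧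
      (fun i => (y i : ZMod 2)) ∈ golayCode ∧ (∃ k, ∑ i, x i = 4 * m + 8 * k) ∧
      ∃ k, ∑ i, y i = 2 * m + 4 * k := by
  obtain ⟨m, y, h1, h2, h3⟩ := (isScaledLeechVector_iff x).1 hx
  obtain ⟨k, hk⟩ := h3.symm.dvd
  refine ⟨m, y, h1, h2, ⟨k, by linarith⟩, ⟨k - 3 * m, ?_⟩⟩
  have : ∑ i, x i = 24 * m + 2 * ∑ i, y i := by
    simp only [h1, Finset.sum_add_distrib, Finset.mul_sum]
    simp
  linarith

/-- The sum over A is |A| m + 2 ∑ y. Here |A| is a multiple of 4, and the sum of y over A is even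
because A is orthogonal to the codeword y mod 2. -/
theorem IsScaledLeechVector.four_dvd {x : Fin 24 → ℤ} (hx : IsScaledLeechVector x)
    {A : Finset (Fin 24)} (hA : A ∈ golaySets) : 4 ∣ ∑ i ∈ A, x i := by
  obtain ⟨m, y, h1, h2, -, -⟩ := hx.exists_rep
  obtain ⟨k, hk⟩ := four_dvd_card hA
  have h3 := golay_dot (mem_golaySets.1 hA) h2
  have h4 : ((∑ i ∈ A, y i : ℤ) : ZMod 2) = 0 := by
    rw [← h3]
    push_cast
    simp [indicatorWord, Finset.sum_ite_mem]
  obtain ⟨l, hl⟩ := (ZMod.intCast_eq_zero_iff_even).1 h4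
  have : ∑ i ∈ A, x i = A.card * m + 2 * ∑ i ∈ A, y i := by
    simp only [h1, Finset.sum_add_distrib, Finset.mul_sum]
    simp
  rw [this, hl, hk]
  exact ⟨k * m + l, by push_cast; ring⟩

theorem sum_sq_modEq_card (y : Fin 24 → ℤ) : ∃ k,
    ∑ i, y i ^ 2 = ((Finset.univ.filter fun i => (y i : ZMod 2) ≠ 0).card : ℤ) + 4 * k := by
  have : ∀ i, ∃ k, y i ^ 2 = (if (y i : ZMod 2) ≠ 0 then 1 else 0) + 4 * k := by
    intro i
    rcases Int.even_or_odd (y i) with h | h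
    · rw [(ZMod.intCast_eq_zero_iff_even).2 h]
      obtain ⟨t, ht⟩ := h
      exact ⟨t ^ 2, by simp; rw [ht]; ring⟩
    · rw [(ZMod.intCast_eq_one_iff_odd).2 h]
      obtain ⟨t, ht⟩ := h
      exact ⟨t ^ 2 + t, by simp; rw [ht]; ring⟩
  choose k hk using this
  refine ⟨∑ i, k i, ?_⟩
  rw [Finset.sum_congr rfl fun i _ => hk i, Finset.sum_add_distrib, Finset.card_filter,
    Finset.mul_sum]
  push_cast
  rfl

theorem card_support_le (y : Fin 24 → ℤ) :
    ((Finset.univ.filter fun i => (y i : ZMod 2) ≠ 0).card : ℤ) ≤ ∑ i, y i ^ 2 := by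
  rw [Finset.card_filter]
  push_cast
  refine Finset.sum_le_sum fun i _ => ?_
  split_ifs with h
  · have : y i ≠ 0 := by rintro h0; simp [h0] at h
    have := Int.one_le_abs this
    nlinarith [sq_abs (y i)]
  · positivity

/-- The norm is 24m² + 4m ∑ y + 4 ∑ y². The sum of y is 2m modulo 4, and the sum of y² is modulo 4
the weight of a codeword, hence 0. -/
theorem IsScaledLeechVector.sixteen_dvd {x : Fin 24 → ℤ} (hx : IsScaledLeechVector x) :
    16 ∣ ∑ i, x i ^ 2 := by
  obtain ⟨m, y, h1, h2, -, ⟨k, hk⟩⟩ := hx.exists_rep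
  obtain ⟨l, hl⟩ := sum_sq_modEq_card y
  obtain ⟨j, hj⟩ := four_dvd_card (support_mem_golaySets h2)
  have : ∑ i, x i ^ 2 = 24 * m ^ 2 + 4 * m * ∑ i, y i + 4 * ∑ i, y i ^ 2 := by
    have h24 : (24 : ℤ) * m ^ 2 = ∑ _i : Fin 24, m ^ 2 := by simp
    rw [h24]
    simp only [Finset.mul_sum, ← Finset.sum_add_distrib]
    refine Finset.sum_congr rfl fun i _ => ?_
    rw [h1]; ring
  rw [this, hk, hl, hj]
  exact ⟨2 * m ^ 2 + m * k + j + l, by push_cast; ring⟩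

/-- An even scaled Leech vector is `2 y`, where `y` is a Golay codeword modulo `2`. -/
theorem IsScaledLeechVector.exists_half {x : Fin 24 → ℤ} (hx : IsScaledLeechVector x) {i : Fin 24}
    (hi : Even (x i)) : ∃ y : Fin 24 → ℤ, (∀ i, x i = 2 * y i) ∧
      (fun i => (y i : ZMod 2)) ∈ golayCode ∧ 4 ∣ ∑ i, y i := by
  obtain ⟨m, y, h1, h2, -, ⟨k, hk⟩⟩ := hx.exists_rep
  have hm : Even m := by
    have := h1 i
    rw [this] at hi
    simpa [Int.even_add] using hi
  obtain ⟨l, hl⟩ := hm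
  refine ⟨fun i => l + y i, fun i => by rw [h1, hl]; ring, ?_, ?_⟩
  · rcases Int.even_or_odd l with h | h
    · convert h2 using 2 with i
      push_cast
      rw [(ZMod.intCast_eq_zero_iff_even).2 h, zero_add]
    · convert add_mem one_mem_golayCode h2 using 1
      funext i
      push_cast
      rw [(ZMod.intCast_eq_one_iff_odd).2 h]
      rfl
  · rw [Finset.sum_add_distrib, hk, hl]
    simp only [Finset.sum_const, Finset.card_univ, Fintype.card_fin, nsmul_eq_mul]
    exact ⟨7 * l + k, by push_cast; ring⟩

theorem isScaledLeechVector_of_half {y : Fin 24 → ℤ} (h : (fun i => (y i : ZMod 2)) ∈ golayCode)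
    (hs : 4 ∣ ∑ i, y i) : IsScaledLeechVector fun i => 2 * y i := by
  rw [isScaledLeechVector_iff]
  refine ⟨0, y, by simp, h, ?_⟩
  obtain ⟨k, hk⟩ := hs
  rw [← Finset.mul_sum, hk, Int.modEq_iff_dvd]
  exact ⟨-k, by ring⟩

theorem even_of_support_empty {y : Fin 24 → ℤ}
    (h : (Finset.univ.filter fun i => (y i : ZMod 2) ≠ 0) = ∅) : ∀ i, ∃ z, y i = 2 * z := by
  intro i
  have : (y i : ZMod 2) = 0 := by
    by_contra hne
    have : i ∈ (Finset.univ.filter fun i => (y i : ZMod 2) ≠ 0) := by simp [hne]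
    rw [h] at this
    simp at this
  obtain ⟨z, hz⟩ := (ZMod.intCast_eq_zero_iff_even).1 this
  exact ⟨z, by linarith⟩

theorem IsScaledLeechVector.odd_of_odd {x : Fin 24 → ℤ} (hx : IsScaledLeechVector x) {i : Fin 24}
    (hi : Odd (x i)) (j : Fin 24) : Odd (x j) := by
  obtain ⟨m, y, h1, -⟩ := hx.exists_rep
  rw [h1] at hi ⊢
  simpa [Int.odd_add] using hi

/-- Only norm 16 has to be excluded. Odd vectors have norm at least 24. For an even vector 2y the
norm of y is 4, too small for a nonzero codeword modulo 2, so y = 2z with z of norm 1. But the sum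
of z is even, and norm and sum have the same parity. -/
theorem IsScaledLeechVector.norm_ge {x : Fin 24 → ℤ} (hx : IsScaledLeechVector x) (h0 : x ≠ 0) :
    32 ≤ ∑ i, x i ^ 2 := by
  obtain ⟨k, hk⟩ := hx.sixteen_dvd
  have hpos : 0 < ∑ i, x i ^ 2 := by
    obtain ⟨i, hi⟩ := Function.ne_iff.1 h0
    exact Finset.sum_pos' (fun i _ => sq_nonneg _) ⟨i, Finset.mem_univ _, by
      have : x i ≠ 0 := hi
      positivity⟩
  by_contra hlt
  have h16 : ∑ i, x i ^ 2 = 16 := by omega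
  rcases Int.even_or_odd (x 0) with he | ho
  · obtain ⟨y, h1, h2, h3⟩ := hx.exists_half he
    have hy : ∑ i, y i ^ 2 = 4 := by
      simp only [h1, mul_pow, ← Finset.mul_sum] at h16
      linarith
    have hc := card_support_le y
    have hempty := eq_empty_of_card_lt_eight (support_mem_golaySets h2) (by omega)
    choose z hz using even_of_support_empty hempty
    have hz1 : ∑ i, z i ^ 2 = 1 := by
      simp only [hz, mul_pow, ← Finset.mul_sum] at hy
      linarith
    have hz2 : Even (∑ i, z i) := by
      obtain ⟨l, hl⟩ := h3
      simp only [hz, ← Finset.mul_sum] at hl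
      exact ⟨l, by linarith⟩
    have : Even (∑ i, z i ^ 2) := by
      have hh : ∑ i, z i ^ 2 = ∑ i, z i + ∑ i, (z i ^ 2 - z i) := by
        rw [← Finset.sum_add_distrib]; simp
      rw [hh]
      refine hz2.add (Finset.even_sum _ fun i _ => ?_)
      rw [show z i ^ 2 - z i = z i * (z i - 1) by ring]
      exact Int.even_mul_pred_self (z i)
    rw [hz1] at this
    exact absurd this (by decide)
  · have : ∀ i, 1 ≤ x i ^ 2 := fun i => by
      have := hx.odd_of_odd ho i
      have h0 : x i ≠ 0 := by rintro h; rw [h] at this; exact absurd this (by decide)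
      have := Int.one_le_abs h0
      nlinarith [sq_abs (x i)]
    have := Finset.sum_le_sum fun (i : Fin 24) (_ : i ∈ Finset.univ) => this i
    simp only [Finset.sum_const, Finset.card_univ, Fintype.card_fin] at this
    norm_num at this
    omega

/-! ### The scaled Leech vectors of norm `32` -/

/-- The vector with entry `-3` in place `i` and `1` elsewhere, with the signs in `A` changed. -/
def oddVector (i : Fin 24) (A : Finset (Fin 24)) (j : Fin 24) : ℤ :=
  (if j ∈ A then -1 else 1) * if j = i then -3 else 1

/-- The vector with entries `-a` in `D`, `a` in the rest of `P`, and `0` elsewhere. -/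
def signVector (a : ℤ) (P D : Finset (Fin 24)) (j : Fin 24) : ℤ :=
  if j ∈ D then -a else if j ∈ P then a else 0

theorem sum_sq_oddVector (i : Fin 24) (A : Finset (Fin 24)) : ∑ j, oddVector i A j ^ 2 = 32 := by
  have : ∀ j, oddVector i A j ^ 2 = 1 + if j = i then 8 else 0 := by
    intro j
    unfold oddVector
    split_ifs <;> norm_num
  simp [this, Finset.sum_add_distrib]

theorem sum_signVector (a : ℤ) {P D : Finset (Fin 24)} (h : D ⊆ P) :
    ∑ j, signVector a P D j = a * (P.card - 2 * D.card) := by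
  have : ∀ j, signVector a P D j = (if j ∈ P then a else 0) - if j ∈ D then 2 * a else 0 := by
    intro j
    unfold signVector
    by_cases hD : j ∈ D
    · simp [hD, h hD]; ring
    · simp [hD]
  simp only [this, Finset.sum_sub_distrib, Finset.sum_ite_mem, Finset.univ_inter,
    Finset.sum_const, nsmul_eq_mul]
  ring

theorem sum_sq_signVector (a : ℤ) {P D : Finset (Fin 24)} (h : D ⊆ P) :
    ∑ j, signVector a P D j ^ 2 = a ^ 2 * P.card := by
  have : ∀ j, signVector a P D j ^ 2 = if j ∈ P then a ^ 2 else 0 := by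
    intro j
    unfold signVector
    by_cases hD : j ∈ D
    · simp [hD, h hD]
    · simp [hD]
  simp only [this, Finset.sum_ite_mem, Finset.univ_inter, Finset.sum_const, nsmul_eq_mul]
  ring

theorem signVector_mul (a b : ℤ) (P D : Finset (Fin 24)) :
    (fun j => a * signVector b P D j) = signVector (a * b) P D := by
  funext j
  unfold signVector
  split_ifs <;> ring

theorem isScaledLeechVector_oddVector (i : Fin 24) {A : Finset (Fin 24)} (hA : A ∈ golaySets) :
    IsScaledLeechVector (oddVector i A) := by
  rw [isScaledLeechVector_iff]
  refine ⟨1, fun j => (if j ∈ A then -1 else 0) + if j = i then (if i ∈ A then 2 else -2) else 0,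
    fun j => ?_, ?_, ?_⟩
  · unfold oddVector
    by_cases hj : j = i
    · subst hj
      by_cases h : j ∈ A <;> simp [h]
    · by_cases h : j ∈ A <;> simp [h, hj]
  · convert mem_golaySets.1 hA using 1
    funext j
    have h2 : (2 : ZMod 2) = 0 := rfl
    have h3 : (-1 : ZMod 2) = 1 := rfl
    unfold indicatorWord
    split_ifs <;> push_cast <;> simp [*]
  · obtain ⟨k, hk⟩ := four_dvd_card hA
    have : ∀ j, oddVector i A j = 1 + ((if j ∈ A then -2 else 0) +
        if j = i then (if i ∈ A then 4 else -4) else 0) := by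
      intro j
      unfold oddVector
      by_cases hj : j = i
      · subst hj
        by_cases h : j ∈ A <;> simp [h]
      · by_cases h : j ∈ A <;> simp [h, hj]
    simp only [this, Finset.sum_add_distrib, Finset.sum_ite_mem, Finset.univ_inter,
      Finset.sum_const, nsmul_eq_mul, hk, Finset.sum_ite_eq', Finset.mem_univ, if_true,
      Finset.card_univ, Fintype.card_fin]
    rw [Int.modEq_iff_dvd]
    push_cast
    split_ifs <;> omega

theorem isScaledLeechVector_signVector_two {P D : Finset (Fin 24)} (hP : P ∈ octads) (h : D ⊆ P)
    (hD : Even D.card) : IsScaledLeechVector (signVector 2 P D) := by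
  rw [mem_octads] at hP
  have := isScaledLeechVector_of_half (y := signVector 1 P D) ?_ ?_
  · rw [signVector_mul] at this
    exact this
  · convert mem_golaySets.1 hP.1 using 1
    funext j
    unfold indicatorWord signVector
    by_cases h' : j ∈ D
    · simp [h', h h']
    · by_cases h'' : j ∈ P <;> simp [h', h'']
  · rw [sum_signVector _ h, hP.2]
    obtain ⟨k, hk⟩ := hD
    rw [hk]
    exact ⟨2 - k, by push_cast; ring⟩

theorem isScaledLeechVector_signVector_four {P D : Finset (Fin 24)} (hP : P.card = 2)
    (h : D ⊆ P) : IsScaledLeechVector (signVector 4 P D) := by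
  have := isScaledLeechVector_of_half (y := signVector 2 P D) ?_ ?_
  · rw [signVector_mul] at this
    exact this
  · convert zero_mem golayCode using 1
    funext j
    have h2 : (2 : ZMod 2) = 0 := rfl
    unfold signVector
    split_ifs <;> push_cast <;> simp [h2]
  · rw [sum_signVector _ h, hP]
    exact ⟨1 - D.card, by push_cast; ring⟩

/-- Squares of odd integers are 8t + 1, and 32 = 24 + 8, so exactly one entry is ±3 and the others
are ±1. The signs are read off from the residues modulo 4: both 3 and -1 are 3 modulo 4, which
explains the entry -3 in `oddVector`. -/
theorem eq_oddVector {x : Fin 24 → ℤ} (hx : IsScaledLeechVector x) (hn : ∑ i, x i ^ 2 = 32)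
    (ho : Odd (x 0)) : ∃ i, ∃ A ∈ golaySets, x = oddVector i A := by
  have hodd := hx.odd_of_odd ho
  have ht : ∀ j, ∃ t : ℕ, x j ^ 2 = 8 * t + 1 := by
    intro j
    have h8 := Int.sq_mod_four_eq_one_of_odd (hodd j)
    obtain ⟨k, hk⟩ := hodd j
    obtain ⟨l, hl⟩ := Int.even_mul_succ_self k
    have hl0 : 0 ≤ l := by
      have h1 : 0 ≤ k * (k + 1) := by
        rcases le_or_gt 0 k with h | h
        · positivity
        · nlinarith
      omega
    refine ⟨l.toNat, ?_⟩
    rw [Int.toNat_of_nonneg hl0, hk]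
    linarith [hl]
  choose t ht using ht
  have hsum : ∑ j, t j = 1 := by
    simp only [ht, Finset.sum_add_distrib, ← Finset.mul_sum] at hn
    simp only [Finset.sum_const, Finset.card_univ, Fintype.card_fin, nsmul_eq_mul] at hn
    have : (∑ j, (t j : ℤ)) = 1 := by push_cast at hn; linarith
    exact_mod_cast this
  obtain ⟨i, hi⟩ : ∃ i, t i ≠ 0 := by
    by_contra h
    push Not at h
    simp [h] at hsum
  have hsplit := Finset.add_sum_erase Finset.univ t (Finset.mem_univ i)
  have hi1 : t i = 1 := by omega
  have hrest : ∀ j, j ≠ i → t j = 0 := by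
    have h0 : ∑ j ∈ Finset.univ.erase i, t j = 0 := by omega
    intro j hj
    exact (Finset.sum_eq_zero_iff.1 h0) j (by simp [hj])
  obtain ⟨m, -, -, h3⟩ := hx
  refine ⟨i, Finset.univ.filter fun j => x j ≡ 3 [ZMOD 4], ?_, ?_⟩
  · rw [mem_golaySets]
    convert h3 3 using 1
    funext j
    simp [indicatorWord]
  · funext j
    unfold oddVector
    simp only [Finset.mem_filter, Finset.mem_univ, true_and]
    by_cases hj : j = i
    · subst hj
      have h9 := ht j
      rw [hi1] at h9
      have : (x j - 3) * (x j + 3) = 0 := by push_cast at h9; linarith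
      rcases mul_eq_zero.1 this with h | h
      · have : x j = 3 := by linarith
        simp [this]
      · have : x j = -3 := by linarith
        rw [this, if_pos rfl, if_neg (by decide)]
        rfl
    · have h1 := ht j
      rw [hrest j hj] at h1
      have : (x j - 1) * (x j + 1) = 0 := by push_cast at h1; linarith
      rcases mul_eq_zero.1 this with h | h
      · have : x j = 1 := by linarith
        rw [this, if_neg hj, if_neg (by decide)]
        rfl
      · have : x j = -1 := by linarith
        rw [this, if_neg hj, if_pos (by decide)]
        rfl

theorem eq_signVector_of_sq_le_one {z : Fin 24 → ℤ} (hz : ∀ i, z i ^ 2 ≤ 1) :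
    z = signVector 1 (Finset.univ.filter fun i => z i ≠ 0)
      (Finset.univ.filter fun i => z i = -1) := by
  funext i
  have h := hz i
  have h1 : -1 ≤ z i ∧ z i ≤ 1 := abs_le_one_iff_mul_self_le_one.2 (by linarith [sq (z i)]) |> abs_le.1
  unfold signVector
  simp only [Finset.mem_filter, Finset.mem_univ, true_and]
  split_ifs <;> omega

/-- Halve x to y, of norm 8. The codeword y mod 2 has weight 8 or 0. Weight 8 leaves entries ±1 on
an octad, with an even number of minus signs since 4 divides the sum. Weight 0 allows a second
halving, to a vector of norm 2. -/
theorem eq_signVector {x : Fin 24 → ℤ} (hx : IsScaledLeechVector x) (hn : ∑ i, x i ^ 2 = 32)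
    (he : Even (x 0)) : (∃ P ∈ octads, ∃ D ⊆ P, Even D.card ∧ x = signVector 2 P D) ∨
      ∃ P D, P.card = 2 ∧ D ⊆ P ∧ x = signVector 4 P D := by
  obtain ⟨y, h1, h2, h3⟩ := hx.exists_half he
  have hy : ∑ i, y i ^ 2 = 8 := by
    simp only [h1, mul_pow, ← Finset.mul_sum] at hn
    linarith
  have hP := support_mem_golaySets h2
  have hle := card_support_le y
  rw [hy] at hle
  rcases lt_or_ge (Finset.univ.filter fun i => (y i : ZMod 2) ≠ 0).card 8 with hlt | hge
  · right
    choose z hz using even_of_support_empty (eq_empty_of_card_lt_eight hP hlt)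
    have hz2 : ∑ i, z i ^ 2 = 2 := by
      simp only [hz, mul_pow, ← Finset.mul_sum] at hy
      linarith
    have hz1 : ∀ i, z i ^ 2 ≤ 1 := by
      intro i
      have : z i ^ 2 ≤ 2 := by
        rw [← hz2]
        exact Finset.single_le_sum (f := fun i => z i ^ 2) (fun j _ => sq_nonneg _)
          (Finset.mem_univ i)
      by_contra hgt
      have h2 : z i ^ 2 = 2 := by omega
      have : -2 < z i ∧ z i < 2 := ⟨by nlinarith, by nlinarith⟩
      obtain ⟨ha, hb⟩ := this
      interval_cases h : z i <;> omega
    have heq := eq_signVector_of_sq_le_one hz1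
    set P := Finset.univ.filter fun i => z i ≠ 0 with hPdef
    set D := Finset.univ.filter fun i => z i = -1 with hDdef
    have hDP : D ⊆ P := by
      intro i hi
      simp only [hDdef, hPdef, Finset.mem_filter, Finset.mem_univ, true_and] at hi ⊢
      omega
    refine ⟨P, D, ?_, hDP, ?_⟩
    · rw [heq, sum_sq_signVector _ hDP] at hz2
      have : (P.card : ℤ) = 2 := by linarith
      exact_mod_cast this
    · have : x = fun i => 4 * z i := by funext i; rw [h1, hz]; ring
      rw [this, heq, signVector_mul]
      rfl
  · left
    have hcard : (Finset.univ.filter fun i => (y i : ZMod 2) ≠ 0).card = 8 := by omega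
    have hterm : ∀ i, 0 ≤ y i ^ 2 - if (y i : ZMod 2) ≠ 0 then 1 else 0 := by
      intro i
      split_ifs with h
      · have : y i ≠ 0 := by rintro h0; simp [h0] at h
        have := Int.one_le_abs this
        nlinarith [sq_abs (y i)]
      · simpa using sq_nonneg (y i)
    have hzero : ∑ i, (y i ^ 2 - if (y i : ZMod 2) ≠ 0 then 1 else 0) = 0 := by
      rw [Finset.sum_sub_distrib, hy]
      have : ((Finset.univ.filter fun i => (y i : ZMod 2) ≠ 0).card : ℤ) = 8 := by
        rw [hcard]; rfl
      rw [Finset.card_filter] at this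
      push_cast at this
      linarith
    have hsq : ∀ i, y i ^ 2 = if (y i : ZMod 2) ≠ 0 then 1 else 0 := fun i => by
      have := (Finset.sum_eq_zero_iff_of_nonneg fun i _ => hterm i).1 hzero i (Finset.mem_univ i)
      linarith
    have hle1 : ∀ i, y i ^ 2 ≤ 1 := by
      intro i
      rw [hsq]
      split_ifs <;> norm_num
    have heq := eq_signVector_of_sq_le_one hle1
    have hsupp : (Finset.univ.filter fun i => y i ≠ 0) =
        Finset.univ.filter fun i => (y i : ZMod 2) ≠ 0 := by
      refine Finset.filter_congr fun i _ => ?_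
      constructor
      · intro h h'
        have := hsq i
        rw [if_neg (not_not.2 h')] at this
        exact h (by simpa using this)
      · rintro h h'
        simp [h'] at h
    rw [← hsupp] at hcard hP
    set P := Finset.univ.filter fun i => y i ≠ 0 with hPdef
    set D := Finset.univ.filter fun i => y i = -1 with hDdef
    have hDP : D ⊆ P := by
      intro i hi
      simp only [hDdef, hPdef, Finset.mem_filter, Finset.mem_univ, true_and] at hi ⊢
      omega
    refine ⟨P, mem_octads.2 ⟨hP, hcard⟩, D, hDP, ?_, ?_⟩
    · rw [heq, sum_signVector _ hDP, hcard] at h3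
      rw [Nat.even_iff]
      omega
    · have : x = fun i => 2 * y i := by funext i; rw [h1]
      rw [this, heq, signVector_mul]
      rfl

theorem oddVector_injective : Function.Injective fun p : Fin 24 × Finset (Fin 24) =>
    oddVector p.1 p.2 := by
  rintro ⟨i, A⟩ ⟨i', A'⟩ h
  have hi : i = i' := by
    by_contra hne
    have := congrFun h i
    simp only [oddVector, if_true, if_neg hne] at this
    split_ifs at this <;> omega
  subst hi
  refine Prod.ext rfl ?_
  ext j
  have := congrFun h j
  simp only [oddVector] at this
  by_cases h1 : j ∈ A <;> by_cases h2 : j ∈ A' <;> simp only [h1, h2, if_true, if_false] at this ⊢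
  all_goals split_ifs at this <;> omega

theorem signVector_injective {a : ℤ} (ha : a ≠ 0) {P D P' D' : Finset (Fin 24)} (h : D ⊆ P)
    (h' : D' ⊆ P') (heq : signVector a P D = signVector a P' D') : P = P' ∧ D = D' := by
  have key : ∀ j, (j ∈ P ↔ j ∈ P') ∧ (j ∈ D ↔ j ∈ D') := by
    intro j
    have := congrFun heq j
    simp only [signVector] at this
    have hj := @h j
    have hj' := @h' j
    by_cases h1 : j ∈ D <;> by_cases h2 : j ∈ D' <;> by_cases h3 : j ∈ P <;>
      by_cases h4 : j ∈ P' <;> simp only [h1, h2, h3, h4, if_true, if_false] at this hj hj' ⊢ <;>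
      first | trivial | (exfalso; omega)
  exact ⟨Finset.ext fun j => (key j).1, Finset.ext fun j => (key j).2⟩

/-- The scaled Leech vectors of norm `32`. -/
@[irreducible] def shortVectors : Finset (Fin 24 → ℤ) :=
  ((Finset.univ ×ˢ golaySets).image fun p => oddVector p.1 p.2) ∪
  (((octads.sigma fun P => P.powerset.filter fun D => Even D.card).image fun p =>
      signVector 2 p.1 p.2) ∪
    (((Finset.univ.powersetCard 2).sigma fun P => P.powerset).image fun p =>
      signVector 4 p.1 p.2))

theorem mem_shortVectors {x : Fin 24 → ℤ} :
    x ∈ shortVectors ↔ IsScaledLeechVector x ∧ ∑ i, x i ^ 2 = 32 := by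
  simp only [shortVectors, Finset.mem_union, Finset.mem_image, Finset.mem_product,
    Finset.mem_univ, true_and, Prod.exists, Sigma.exists, Finset.mem_sigma, Finset.mem_filter,
    Finset.mem_powerset, Finset.mem_powersetCard, Finset.subset_univ]
  constructor
  · rintro (⟨i, A, hA, rfl⟩ | ⟨P, D, ⟨hP, hD, he⟩, rfl⟩ | ⟨P, D, ⟨hP, hD⟩, rfl⟩)
    · exact ⟨isScaledLeechVector_oddVector i hA, sum_sq_oddVector i A⟩
    · refine ⟨isScaledLeechVector_signVector_two hP hD he, ?_⟩
      rw [sum_sq_signVector _ hD, (mem_octads.1 hP).2]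
      rfl
    · refine ⟨isScaledLeechVector_signVector_four hP hD, ?_⟩
      rw [sum_sq_signVector _ hD, hP]
      rfl
  · rintro ⟨hx, hn⟩
    rcases Int.even_or_odd (x 0) with he | ho
    · rcases eq_signVector hx hn he with ⟨P, hP, D, hD, hE, rfl⟩ | ⟨P, D, hP, hD, rfl⟩
      · exact Or.inr (Or.inl ⟨P, D, ⟨hP, hD, hE⟩, rfl⟩)
      · exact Or.inr (Or.inr ⟨P, D, ⟨hP, hD⟩, rfl⟩)
    · obtain ⟨i, A, hA, rfl⟩ := eq_oddVector hx hn ho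
      exact Or.inl ⟨i, A, hA, rfl⟩

theorem card_even_subsets {P : Finset (Fin 24)} (hP : P.card = 8) :
    (P.powerset.filter fun D => Even D.card).card = 128 := by
  have : (P.powerset.filter fun D => Even D.card) =
      ({0, 2, 4, 6, 8} : Finset ℕ).biUnion fun k => P.powersetCard k := by
    ext D
    simp only [Finset.mem_filter, Finset.mem_powerset, Finset.mem_biUnion,
      Finset.mem_powersetCard]
    constructor
    · rintro ⟨h, he⟩
      refine ⟨D.card, ?_, h, rfl⟩
      have := Finset.card_le_card h
      rw [hP] at this
      interval_cases D.card <;> first | decide | exact absurd he (by decide)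
    · rintro ⟨k, hk, h, rfl⟩
      refine ⟨h, ?_⟩
      simp only [Finset.mem_insert, Finset.mem_singleton] at hk
      rcases hk with h | h | h | h | h <;> rw [h] <;> decide
  rw [this, Finset.card_biUnion]
  · simp only [Finset.card_powersetCard, hP]
    decide
  · intro k _ l _ hkl
    rw [Function.onFun_apply, Finset.disjoint_left]
    intro D h1 h2
    rw [Finset.mem_powersetCard] at h1 h2
    exact hkl (h1.2.symm.trans h2.2)

-- 24 · 4096 + 759 · 128 + 276 · 4 = 98304 + 97152 + 1104.
set_option linter.constructorNameAsVariable false in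
theorem card_shortVectors : shortVectors.card = 196560 := by
  rw [shortVectors, Finset.card_union_of_disjoint, Finset.card_union_of_disjoint,
    Finset.card_image_of_injective _ oddVector_injective, Finset.card_image_of_injOn,
    Finset.card_image_of_injOn, Finset.card_product, card_golaySets, Finset.card_sigma,
    Finset.card_sigma]
  · rw [Finset.sum_const_nat (m := 128) fun P hP => card_even_subsets (mem_octads.1 hP).2,
      Finset.sum_const_nat (m := 4), card_octads, Finset.card_powersetCard]
    · simp [Nat.choose]
    · intro P hP
      rw [Finset.card_powerset, (Finset.mem_powersetCard.1 hP).2]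
      rfl
  · rintro ⟨P, D⟩ h ⟨P', D'⟩ h' heq
    simp only [Finset.coe_sigma, Set.mem_sigma_iff, Finset.mem_coe, Finset.mem_powerset] at h h'
    obtain ⟨rfl, rfl⟩ := signVector_injective (by norm_num) h.2 h'.2 heq
    rfl
  · rintro ⟨P, D⟩ h ⟨P', D'⟩ h' heq
    simp only [Finset.coe_sigma, Set.mem_sigma_iff, Finset.mem_coe, Finset.mem_powerset,
      Finset.mem_filter] at h h'
    obtain ⟨rfl, rfl⟩ := signVector_injective (by norm_num) h.2.1 h'.2.1 heq
    rfl
  · rw [Finset.disjoint_left]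
    intro x h h'
    simp only [Finset.mem_image, Sigma.exists, Finset.mem_sigma, Finset.mem_filter,
      Finset.mem_powerset, Finset.mem_powersetCard] at h h'
    obtain ⟨P, D, ⟨hP, hD, -⟩, rfl⟩ := h
    obtain ⟨P', D', ⟨hP', -⟩, h⟩ := h'
    obtain ⟨j, hj⟩ := Finset.card_pos.1 (by rw [hP'.2]; norm_num : 0 < P'.card)
    have := congrFun h j
    simp only [signVector, hj, if_true] at this
    split_ifs at this <;> omega
  · rw [Finset.disjoint_left]
    intro x h h'
    simp only [Finset.mem_image, Prod.exists, Finset.mem_union, Sigma.exists] at h h'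
    obtain ⟨i, A, -, rfl⟩ := h
    rcases h' with ⟨P, D, -, h⟩ | ⟨P, D, -, h⟩
    all_goals
      have := congrFun h 0
      simp only [signVector, oddVector] at this
      split_ifs at this <;> omega

/-! ### Sextets -/

/-- `τ i` is the block of `i` in a partition of the `24` places into blocks of size four, any two
of which form an octad. -/
structure IsSextet (τ : Fin 24 → Finset (Fin 24)) : Prop where
  mem_self : ∀ i, i ∈ τ i
  eq_of_mem : ∀ i j, j ∈ τ i → τ j = τ i
  card_eq : ∀ i, (τ i).card = 4
  symmDiff_mem : ∀ i j, symmDiff (τ i) (τ j) ∈ golaySets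

/-- Any four places form a block of a sextet. -/
theorem exists_sextet {A : Finset (Fin 24)} (hA : A.card = 4) :
    ∃ τ, IsSextet τ ∧ ∀ a ∈ A, τ a = A := by
  have h : ∀ i, ∃ B, i ∉ A → B ∈ octads ∧ insert i A ⊆ B := by
    intro i
    by_cases hi : i ∈ A
    · exact ⟨∅, fun h => absurd hi h⟩
    · obtain ⟨B, hB, h⟩ := exists_octad (F := insert i A) (by
        rw [Finset.card_insert_of_notMem hi, hA])
      exact ⟨B, fun _ => ⟨hB, h⟩⟩
  choose B hB using h
  have hAB : ∀ i, i ∉ A → A ⊆ B i := fun i hi =>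
    (Finset.subset_insert _ _).trans (hB i hi).2
  -- `B i` is the octad through `A` and `i`. Two such octads are equal or meet exactly in `A`, so
  -- the sets `B i \ A` partition the other places. Symmetric differences of blocks are octads or
  -- symmetric differences of octads.
  refine ⟨fun i => if i ∈ A then A else B i \ A, ⟨fun i => ?_, fun i j hj => ?_, fun i => ?_,
    fun i j => ?_⟩, fun a ha => if_pos ha⟩
  · split_ifs with hi
    · exact hi
    · exact Finset.mem_sdiff.2 ⟨(hB i hi).2 (Finset.mem_insert_self _ _), hi⟩
  · by_cases hi : i ∈ A
    · rw [if_pos hi] at hj ⊢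
      rw [if_pos hj]
    · rw [if_neg hi] at hj ⊢
      rw [Finset.mem_sdiff] at hj
      rw [if_neg hj.2]
      congr 1
      apply octad_eq_of_five_le (hB j hj.2).1 (hB i hi).1
      have hc : (insert j A).card = 5 := by rw [Finset.card_insert_of_notMem hj.2, hA]
      rw [← hc]
      exact Finset.card_le_card (Finset.subset_inter (hB j hj.2).2
        (Finset.insert_subset hj.1 (hAB i hi)))
  · split_ifs with hi
    · exact hA
    · rw [Finset.card_sdiff_of_subset (hAB i hi), hA, (mem_octads.1 (hB i hi).1).2]
  · have hempty : symmDiff A A ∈ golaySets := by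
      have := symmDiff_mem_golaySets univ_mem_golaySets univ_mem_golaySets
      simpa using this
    by_cases hi : i ∈ A <;> by_cases hj : j ∈ A
    · rw [if_pos hi, if_pos hj]
      exact hempty
    · rw [if_pos hi, if_neg hj]
      have : symmDiff A (B j \ A) = B j := by
        rw [symmDiff_sdiff_eq_sup]
        exact Finset.union_eq_right.2 (hAB j hj)
      rw [this]
      exact (mem_octads.1 (hB j hj).1).1
    · rw [if_neg hi, if_pos hj, symmDiff_comm]
      have : symmDiff A (B i \ A) = B i := by
        rw [symmDiff_sdiff_eq_sup]
        exact Finset.union_eq_right.2 (hAB i hi)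
      rw [this]
      exact (mem_octads.1 (hB i hi).1).1
    · rw [if_neg hi, if_neg hj]
      have : symmDiff (B i \ A) (B j \ A) = symmDiff (B i) (B j) := by
        ext k
        have h1 := @hAB i hi k
        have h2 := @hAB j hj k
        simp only [Finset.mem_symmDiff, Finset.mem_sdiff]
        tauto
      rw [this]
      exact symmDiff_mem_golaySets (mem_octads.1 (hB i hi).1).1 (mem_octads.1 (hB j hj).1).1

namespace IsSextet

variable {τ : Fin 24 → Finset (Fin 24)}

theorem mem_comm (hτ : IsSextet τ) (i j : Fin 24) : j ∈ τ i ↔ i ∈ τ j := by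
  constructor
  · intro h
    rw [hτ.eq_of_mem i j h]
    exact hτ.mem_self i
  · intro h
    rw [hτ.eq_of_mem j i h]
    exact hτ.mem_self j

theorem mem_iff (hτ : IsSextet τ) (i j : Fin 24) : j ∈ τ i ↔ τ j = τ i :=
  ⟨hτ.eq_of_mem i j, fun h => h ▸ hτ.mem_self j⟩

theorem sum_comm (hτ : IsSextet τ) {M : Type*} [AddCommMonoid M] (F : Fin 24 → Fin 24 → M) :
    ∑ i, ∑ j ∈ τ i, F i j = ∑ j, ∑ i ∈ τ j, F i j :=
  Finset.sum_comm' fun i j => by simp [hτ.mem_comm i j]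

theorem sum_blocks (hτ : IsSextet τ) {M : Type*} [AddCommMonoid M] (f : Fin 24 → M) :
    ∑ T ∈ Finset.univ.image τ, ∑ i ∈ T, f i = ∑ i, f i := by
  rw [← Finset.sum_fiberwise_of_maps_to (g := τ) (t := Finset.univ.image τ)
    (fun i _ => Finset.mem_image_of_mem _ (Finset.mem_univ i))]
  refine Finset.sum_congr rfl fun T hT => Finset.sum_congr ?_ fun _ _ => rfl
  obtain ⟨i, -, rfl⟩ := Finset.mem_image.1 hT
  ext j
  simp [hτ.mem_iff]

theorem card_image (hτ : IsSextet τ) : (Finset.univ.image τ).card = 6 := by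
  have h := hτ.sum_blocks fun _ => 1
  rw [Finset.sum_const_nat (m := 4)] at h
  · simp at h
    omega
  · intro T hT
    obtain ⟨i, -, rfl⟩ := Finset.mem_image.1 hT
    rw [Finset.sum_const, hτ.card_eq]
    rfl

/-- A word that is constant on the blocks of a sextet is a codeword if it vanishes on an even
number of blocks. -/
theorem comp_mem_golayCode (hτ : IsSextet τ) (f : Finset (Fin 24) → ZMod 2)
    (hf : ∑ T ∈ Finset.univ.image τ, f T = 0) : (fun i => f (τ i)) ∈ golayCode := by
  -- The word is the sum of f(T) times the indicator of T. Adding τ 0 to every T changes nothing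
  -- because the coefficients sum to 0, and each T Δ τ 0 is a codeword.
  have h : (fun i => f (τ i)) =
      ∑ T ∈ Finset.univ.image τ, f T • indicatorWord (symmDiff T (τ 0)) := by
    simp only [indicatorWord_symmDiff, smul_add, Finset.sum_add_distrib, ← Finset.sum_smul, hf,
      zero_smul, add_zero]
    funext i
    rw [Finset.sum_apply, Finset.sum_eq_single (τ i)]
    · simp [indicatorWord, hτ.mem_self i]
    · intro T hT hne
      obtain ⟨j, -, rfl⟩ := Finset.mem_image.1 hT
      have : i ∉ τ j := fun h => hne (hτ.eq_of_mem j i h).symm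
      simp [indicatorWord, this]
    · intro h
      exact absurd (Finset.mem_image_of_mem _ (Finset.mem_univ i)) h
  rw [h]
  refine Submodule.sum_mem _ fun T hT => Submodule.smul_mem _ _ ?_
  obtain ⟨j, -, rfl⟩ := Finset.mem_image.1 hT
  exact mem_golaySets.1 (hτ.symmDiff_mem j 0)

/-- Twice the projection of `x` to the space of vectors that are constant on the blocks other than
`τ a` and have sum zero on `τ a`. -/
theorem exists_projection (hτ : IsSextet τ) (a : Fin 24) {x : Fin 24 → ℤ}
    (hx : IsScaledLeechVector x) : ∃ v, IsScaledLeechVector v ∧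
      ∀ i, 2 * v i = if τ i = τ a then 4 * x i - ∑ j ∈ τ i, x j else ∑ j ∈ τ i, x j := by
  obtain ⟨m, y, h1, h2, ⟨k, hk⟩, -⟩ := hx.exists_rep
  have hs : ∀ T ∈ Finset.univ.image τ, ∃ h, ∑ j ∈ T, x j = 2 * h := by
    intro T hT
    obtain ⟨i, -, rfl⟩ := Finset.mem_image.1 hT
    refine ⟨2 * m + ∑ j ∈ τ i, y j, ?_⟩
    simp only [h1, Finset.sum_add_distrib, ← Finset.mul_sum, Finset.sum_const, hτ.card_eq,
      nsmul_eq_mul]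
    push_cast
    ring
  have hs' : ∀ T, ∃ h, T ∈ Finset.univ.image τ → ∑ j ∈ T, x j = 2 * h := by
    intro T
    by_cases hT : T ∈ Finset.univ.image τ
    · obtain ⟨h, hh⟩ := hs T hT
      exact ⟨h, fun _ => hh⟩
    · exact ⟨0, fun h => absurd h hT⟩
  choose h hh using hs'
  have hmem : ∀ i, τ i ∈ Finset.univ.image τ := fun i =>
    Finset.mem_image_of_mem _ (Finset.mem_univ i)
  -- Block sums are 2 h(T). Two distinct blocks form a codeword, over which the sum of x is a
  -- multiple of 4, so all the h(T) have the same parity.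
  have hd : ∀ T, ∃ d, T ∈ Finset.univ.image τ → h T - h (τ a) = 2 * d := by
    intro T
    by_cases hT : T ∈ Finset.univ.image τ
    · obtain ⟨i, -, rfl⟩ := Finset.mem_image.1 hT
      by_cases hia : τ i = τ a
      · exact ⟨0, fun _ => by rw [hia]; ring⟩
      · have hdisj : Disjoint (τ i) (τ a) := by
          rw [Finset.disjoint_left]
          intro j hj hj'
          exact hia ((hτ.eq_of_mem i j hj).symm.trans (hτ.eq_of_mem a j hj'))
        have h4 := hx.four_dvd (hτ.symmDiff_mem i a)
        rw [hdisj.symmDiff_eq_sup, Finset.sup_eq_union, Finset.sum_union hdisj, hh _ (hmem i),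
          hh _ (hmem a)] at h4
        obtain ⟨l, hl⟩ := h4
        exact ⟨l - h (τ a), fun _ => by linarith⟩
    · exact ⟨0, fun h => absurd h hT⟩
  choose d hd using hd
  have hsum : ∑ T ∈ Finset.univ.image τ, 2 * h T = 4 * m + 8 * k := by
    rw [← hk, ← hτ.sum_blocks x]
    exact Finset.sum_congr rfl fun T hT => (hh T hT).symm
  have hda : d (τ a) = 0 := by
    have := hd _ (hmem a)
    linarith
  have hdsum : ∑ T ∈ Finset.univ.image τ, d T = m + 2 * k - 3 * h (τ a) := by
    have : ∑ T ∈ Finset.univ.image τ, (2 * h T - 2 * h (τ a)) =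
        ∑ T ∈ Finset.univ.image τ, 4 * d T :=
      Finset.sum_congr rfl fun T hT => by linarith [hd T hT]
    rw [Finset.sum_sub_distrib, hsum, ← Finset.mul_sum, ← Finset.mul_sum, Finset.sum_const, hτ.card_image,
      nsmul_eq_mul] at this
    push_cast at this
    linarith
  refine ⟨fun i => if τ i = τ a then 2 * x i - h (τ i) else h (τ i), ?_, fun i => ?_⟩
  · rw [isScaledLeechVector_iff]
    refine ⟨h (τ a), fun i => if τ i = τ a then x i - h (τ a) else d (τ i), fun i => ?_, ?_, ?_⟩
    · dsimp only
      split_ifs with hi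
      · rw [hi]; ring
      · linarith [hd _ (hmem i)]
    -- Modulo 2 all entries of x equal m, so the word to be tested is constant on blocks.
    · have := hτ.comp_mem_golayCode
        (fun T => if T = τ a then ((m - h (τ a) : ℤ) : ZMod 2) else ((d T : ℤ) : ZMod 2)) ?_
      · convert this using 2 with i
        dsimp only
        split_ifs with hi
        · rw [h1]
          push_cast
          have h2 : (2 : ZMod 2) = 0 := rfl
          rw [h2]
          ring
        · rfl
      · have hrw : ∀ T, (if T = τ a then ((m - h (τ a) : ℤ) : ZMod 2) else ((d T : ℤ) : ZMod 2)) =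
            ((d T : ℤ) : ZMod 2) + if T = τ a then ((m - h (τ a) : ℤ) : ZMod 2) else 0 := by
          intro T
          split_ifs with hT
          · rw [hT, hda]; simp
          · simp
        simp only [hrw, Finset.sum_add_distrib, Finset.sum_ite_eq', hmem a, if_true]
        rw [← Int.cast_sum, hdsum, ← Int.cast_add, ZMod.intCast_eq_zero_iff_even]
        exact ⟨m + k - 2 * h (τ a), by ring⟩
    · have hv : ∀ i, (if τ i = τ a then 2 * x i - h (τ i) else h (τ i)) =
          h (τ i) + if i ∈ τ a then 2 * x i - 2 * h (τ a) else 0 := by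
        intro i
        by_cases hi : τ i = τ a
        · rw [if_pos hi, if_pos ((hτ.mem_iff a i).2 hi), hi]; ring
        · rw [if_neg hi, if_neg (fun h => hi ((hτ.mem_iff a i).1 h)), add_zero]
      have hb : ∑ i, h (τ i) = ∑ T ∈ Finset.univ.image τ, 4 * h T := by
        rw [← hτ.sum_blocks]
        refine Finset.sum_congr rfl fun T hT => ?_
        obtain ⟨i, -, rfl⟩ := Finset.mem_image.1 hT
        rw [Finset.sum_congr rfl fun j hj => by rw [hτ.eq_of_mem i j hj], Finset.sum_const,
          hτ.card_eq, nsmul_eq_mul]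
        rfl
      have hb' : ∑ T ∈ Finset.univ.image τ, 4 * h T = 8 * m + 16 * k := by
        rw [← Finset.mul_sum] at hsum ⊢
        linarith
      simp only [hv, Finset.sum_add_distrib, Finset.sum_ite_mem, Finset.univ_inter,
        Finset.sum_sub_distrib, ← Finset.mul_sum, hh _ (hmem a), Finset.sum_const, hτ.card_eq,
        nsmul_eq_mul]
      rw [hb, hb', Int.modEq_iff_dvd]
      exact ⟨h (τ a) - m - 2 * k, by push_cast; ring⟩
  · dsimp only
    rw [hh _ (hmem i)]
    split_ifs <;> ring

end IsSextet

/-! ### The minimal vectors -/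

/-- The vector `x / √8`. -/
def scaled (x : Fin 24 → ℤ) : EuclideanSpace ℝ (Fin 24) :=
  WithLp.toLp 2 fun i => (x i : ℝ) / √8

theorem scaled_apply (x : Fin 24 → ℤ) (i : Fin 24) : scaled x i = (x i : ℝ) / √8 := rfl

theorem scaled_sub (x y : Fin 24 → ℤ) : scaled (x - y) = scaled x - scaled y := by
  ext i
  simp [scaled_apply, sub_div]

theorem scaled_neg (x : Fin 24 → ℤ) : scaled (-x) = -scaled x := by
  ext i
  simp [scaled_apply, neg_div]

theorem scaled_injective : Function.Injective scaled := by
  intro x y h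
  funext i
  have := congrArg (fun v : EuclideanSpace ℝ (Fin 24) => v i) h
  simp only [scaled_apply] at this
  have h8 : √(8 : ℝ) ≠ 0 := by positivity
  field_simp at this
  exact_mod_cast this

theorem inner_scaled (x y : Fin 24 → ℤ) :
    inner ℝ (scaled x) (scaled y) = ((∑ i, x i * y i : ℤ) : ℝ) / 8 := by
  have h8 : √(8 : ℝ) * √8 = 8 := Real.mul_self_sqrt (by norm_num)
  rw [PiLp.inner_apply]
  push_cast
  rw [Finset.sum_div]
  refine Finset.sum_congr rfl fun i _ => ?_
  rw [scaled_apply, scaled_apply, RCLike.inner_apply, conj_trivial, div_mul_div_comm, h8, mul_comm]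

theorem norm_sq_scaled (x : Fin 24 → ℤ) : ‖scaled x‖ ^ 2 = ((∑ i, x i ^ 2 : ℤ) : ℝ) / 8 := by
  rw [← real_inner_self_eq_norm_sq, inner_scaled]
  simp only [sq]

theorem leechLattice_eq : leechLattice = scaled '' {x | IsScaledLeechVector x} := by
  ext v
  constructor
  · rintro ⟨x, hx, h⟩
    exact ⟨x, hx, by ext i; rw [h, scaled_apply]⟩
  · rintro ⟨x, hx, rfl⟩
    exact ⟨x, hx, fun i => rfl⟩

theorem signVector_four_mem_shortVectors {i j : Fin 24} (h : i ≠ j) {D : Finset (Fin 24)}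
    (hD : D ⊆ {i, j}) : signVector 4 {i, j} D ∈ shortVectors := by
  have hc : ({i, j} : Finset (Fin 24)).card = 2 := Finset.card_pair h
  rw [mem_shortVectors]
  refine ⟨isScaledLeechVector_signVector_four hc hD, ?_⟩
  rw [sum_sq_signVector _ hD, hc]
  rfl

theorem scaled_zero : scaled 0 = 0 := by
  ext i
  simp [scaled_apply]

/-- `norm_ge` says that nonzero lattice vectors have length at least 2. The vectors of shape (4, 4,
0, …)/√8 attain it, so the least length is exactly 2. -/
theorem minimalVectors_eq : minimalVectors = scaled '' (shortVectors : Set (Fin 24 → ℤ)) := by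
  have h2 : ∀ x ∈ shortVectors, ‖scaled x‖ = 2 := by
    intro x hx
    have := norm_sq_scaled x
    rw [(mem_shortVectors.1 hx).2] at this
    have h0 := norm_nonneg (scaled x)
    nlinarith
  have hmin : ∀ x, IsScaledLeechVector x → scaled x ≠ 0 → 2 ≤ ‖scaled x‖ := by
    intro x hx h0
    have hx0 : x ≠ 0 := by rintro rfl; exact h0 scaled_zero
    have h32 := hx.norm_ge hx0
    have := norm_sq_scaled x
    have h4 : (4 : ℝ) ≤ ‖scaled x‖ ^ 2 := by
      rw [this]
      have : (32 : ℝ) ≤ ((∑ i, x i ^ 2 : ℤ) : ℝ) := by exact_mod_cast h32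
      linarith
    have h0 := norm_nonneg (scaled x)
    nlinarith
  ext v
  constructor
  · rintro ⟨hv, h0, h⟩
    rw [leechLattice_eq] at hv h
    obtain ⟨x, hx, rfl⟩ := hv
    refine ⟨x, ?_, rfl⟩
    have hs := signVector_four_mem_shortVectors (show (0 : Fin 24) ≠ 1 by decide)
      (Finset.empty_subset _)
    have hle := h _ ⟨_, (mem_shortVectors.1 hs).1, rfl⟩ (by
      rw [← norm_pos_iff, h2 _ hs]; norm_num)
    rw [h2 _ hs] at hle
    have h2' : ‖scaled x‖ = 2 := le_antisymm hle (hmin x hx h0)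
    have := norm_sq_scaled x
    rw [h2'] at this
    rw [Finset.mem_coe, mem_shortVectors]
    refine ⟨hx, ?_⟩
    have : ((∑ i, x i ^ 2 : ℤ) : ℝ) = 32 := by linarith
    exact_mod_cast this
  · rintro ⟨x, hx, rfl⟩
    have hx' := mem_shortVectors.1 hx
    refine ⟨?_, ?_, ?_⟩
    · rw [leechLattice_eq]
      exact ⟨x, hx'.1, rfl⟩
    · rw [← norm_pos_iff, h2 x hx]; norm_num
    · rw [leechLattice_eq]
      rintro _ ⟨y, hy, rfl⟩ h0
      rw [h2 x hx]
      exact hmin y hy h0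

theorem finite_minimalVectors : minimalVectors.Finite := by
  rw [minimalVectors_eq]
  exact (Finset.finite_toSet _).image _

theorem ncard_minimalVectors : minimalVectors.ncard = 196560 := by
  rw [minimalVectors_eq, Set.ncard_image_of_injective _ scaled_injective, Set.ncard_coe_finset,
    card_shortVectors]

theorem norm_of_mem_minimalVectors {v : EuclideanSpace ℝ (Fin 24)} (hv : v ∈ minimalVectors) :
    ‖v‖ = 2 := by
  rw [minimalVectors_eq] at hv
  obtain ⟨x, hx, rfl⟩ := hv
  have := norm_sq_scaled x
  rw [(mem_shortVectors.1 hx).2] at this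
  have h0 := norm_nonneg (scaled x)
  nlinarith

/-- The difference v - w is a nonzero lattice vector, so 4 ≤ |v - w|² = 8 - 2⟨v, w⟩. -/
theorem inner_le_two {v w : EuclideanSpace ℝ (Fin 24)} (hv : v ∈ minimalVectors)
    (hw : w ∈ minimalVectors) (h : v ≠ w) : inner ℝ v w ≤ 2 := by
  have hv2 := norm_of_mem_minimalVectors hv
  have hw2 := norm_of_mem_minimalVectors hw
  have h4 : (4 : ℝ) ≤ ‖v - w‖ ^ 2 := by
    rw [minimalVectors_eq] at hv hw
    obtain ⟨x, hx, rfl⟩ := hv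
    obtain ⟨y, hy, rfl⟩ := hw
    rw [← scaled_sub, norm_sq_scaled]
    have := ((mem_shortVectors.1 hx).1.sub (mem_shortVectors.1 hy).1).norm_ge (by
      intro h0
      exact h (by rw [sub_eq_zero.1 h0]))
    have : (32 : ℝ) ≤ ((∑ i, (x - y) i ^ 2 : ℤ) : ℝ) := by exact_mod_cast this
    linarith
  rw [@norm_sub_sq_real] at h4
  rw [hv2, hw2] at h4
  linarith

theorem isAntipodal_minimalVectors : IsAntipodal minimalVectors := by
  rintro v ⟨hv, h0, h⟩
  rw [leechLattice_eq] at *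
  obtain ⟨x, hx, rfl⟩ := hv
  exact ⟨leechLattice_eq ▸ ⟨-x, hx.neg, scaled_neg x⟩, neg_ne_zero.2 h0,
    fun w hw => by rw [norm_neg]; exact h w (leechLattice_eq ▸ hw)⟩

theorem ne_zero_of_mem_minimalVectors {v : EuclideanSpace ℝ (Fin 24)}
    (hv : v ∈ minimalVectors) : v ≠ 0 := hv.2.1

/-! ### Elements of the Conway group -/

theorem image_minimalVectors {g : EuclideanSpace ℝ (Fin 24) ≃ₗᵢ[ℝ] EuclideanSpace ℝ (Fin 24)}
    (hg : g ∈ conwayGroup) {v : EuclideanSpace ℝ (Fin 24)} (hv : v ∈ minimalVectors) :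
    g v ∈ minimalVectors := by
  have hg' : g '' leechLattice = leechLattice := hg
  obtain ⟨h1, h2, h3⟩ := hv
  refine ⟨hg' ▸ mem_image_of_mem _ h1, by simpa using h2, fun w hw h0 => ?_⟩
  rw [← hg'] at hw
  obtain ⟨u, hu, rfl⟩ := hw
  rw [g.norm_map, g.norm_map]
  exact h3 u hu (by simpa using h0)

/-- An involution that maps the lattice into itself maps it onto itself. -/
theorem exists_mem_conwayGroup
    (f : EuclideanSpace ℝ (Fin 24) →ₗ[ℝ] EuclideanSpace ℝ (Fin 24))
    (hf : Function.Involutive f) (hn : ∀ v, ‖f v‖ = ‖v‖)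
    (hl : ∀ x, IsScaledLeechVector x → ∃ x', IsScaledLeechVector x' ∧ f (scaled x) = scaled x') :
    ∃ g ∈ conwayGroup, ∀ v, g v = f v := by
  have hsub : f '' leechLattice ⊆ leechLattice := by
    rw [leechLattice_eq]
    rintro _ ⟨_, ⟨x, hx, rfl⟩, rfl⟩
    obtain ⟨x', hx', h⟩ := hl x hx
    exact ⟨x', hx', h.symm⟩
  let g : EuclideanSpace ℝ (Fin 24) ≃ₗᵢ[ℝ] EuclideanSpace ℝ (Fin 24) :=
    ⟨LinearEquiv.ofInvolutive f hf, hn⟩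
  have hgf : ∀ v, g v = f v := fun v => rfl
  refine ⟨g, ?_, hgf⟩
  change g '' leechLattice = leechLattice
  rw [show (g : EuclideanSpace ℝ (Fin 24) → EuclideanSpace ℝ (Fin 24)) = f from funext hgf]
  refine Subset.antisymm hsub fun v hv => ?_
  exact ⟨f v, hsub (mem_image_of_mem _ hv), hf v⟩

/-- The change of the signs of the coordinates in `A`. -/
def signMap (A : Finset (Fin 24)) : EuclideanSpace ℝ (Fin 24) →ₗ[ℝ] EuclideanSpace ℝ (Fin 24) where
  toFun v := WithLp.toLp 2 fun i => (if i ∈ A then -1 else 1) * v i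
  map_add' v w := by ext i; simp [mul_add]
  map_smul' c v := by ext i; simp

theorem signMap_apply (A : Finset (Fin 24)) (v : EuclideanSpace ℝ (Fin 24)) (i : Fin 24) :
    signMap A v i = (if i ∈ A then -1 else 1) * v i := rfl

/-- The change of signs subtracts 2x restricted to A. This is a lattice vector: modulo 2 the
restriction is a multiple of the codeword A, and its sum is a multiple of 4. -/
theorem exists_signChange {A : Finset (Fin 24)} (hA : A ∈ golaySets) :
    ∃ g ∈ conwayGroup, ∀ x, g (scaled x) = scaled fun i => if i ∈ A then -x i else x i := by
  have hmap : ∀ x, signMap A (scaled x) = scaled fun i => if i ∈ A then -x i else x i := by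
    intro x
    ext i
    rw [signMap_apply, scaled_apply, scaled_apply]
    split_ifs <;> push_cast <;> ring
  have hinv : Function.Involutive (signMap A) := by
    intro v
    ext i
    rw [signMap_apply, signMap_apply]
    split_ifs <;> ring
  have hnorm : ∀ v, ‖signMap A v‖ = ‖v‖ := by
    intro v
    rw [EuclideanSpace.norm_eq, EuclideanSpace.norm_eq]
    congr 1
    refine Finset.sum_congr rfl fun i _ => ?_
    rw [signMap_apply]
    split_ifs <;> simp
  obtain ⟨g, hg, h⟩ := exists_mem_conwayGroup (signMap A) hinv hnorm fun x hx => by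
    refine ⟨_, ?_, hmap x⟩
    have hv : IsScaledLeechVector fun i => 2 * if i ∈ A then x i else 0 := by
      apply isScaledLeechVector_of_half
      · obtain ⟨m, y, h1, -⟩ := hx.exists_rep
        convert Submodule.smul_mem golayCode (m : ZMod 2) (mem_golaySets.1 hA) using 1
        funext i
        have h2 : (2 : ZMod 2) = 0 := rfl
        by_cases hi : i ∈ A <;> simp [hi, indicatorWord, h1, h2]
      · simpa [Finset.sum_ite_mem] using hx.four_dvd hA
    convert hx.sub hv using 1
    funext i
    simp only [Pi.sub_apply]
    split_ifs <;> ring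
  exact ⟨g, hg, fun x => by rw [h, hmap]⟩

/-- The product of the reflections in the characteristic vectors of the blocks of a sextet,
with a change of the signs in the block of `a`. -/
def sextetMap (τ : Fin 24 → Finset (Fin 24)) (a : Fin 24) :
    EuclideanSpace ℝ (Fin 24) →ₗ[ℝ] EuclideanSpace ℝ (Fin 24) where
  toFun v := WithLp.toLp 2 fun i =>
    (if τ i = τ a then -1 else 1) * (v i - (∑ j ∈ τ i, v j) / 2)
  map_add' v w := by
    ext i
    simp only [PiLp.add_apply, Finset.sum_add_distrib]
    ring
  map_smul' c v := by
    ext i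
    simp only [PiLp.smul_apply, smul_eq_mul, ← Finset.mul_sum, RingHom.id_apply]
    ring

theorem sextetMap_apply (τ : Fin 24 → Finset (Fin 24)) (a : Fin 24)
    (v : EuclideanSpace ℝ (Fin 24)) (i : Fin 24) : sextetMap τ a v i =
      (if τ i = τ a then -1 else 1) * (v i - (∑ j ∈ τ i, v j) / 2) := rfl

theorem IsSextet.sum_sextetMap {τ : Fin 24 → Finset (Fin 24)} (hτ : IsSextet τ) (a : Fin 24)
    (v : EuclideanSpace ℝ (Fin 24)) (i : Fin 24) :
    ∑ j ∈ τ i, sextetMap τ a v j = -((if τ i = τ a then -1 else 1) * ∑ j ∈ τ i, v j) := by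
  have : ∀ j ∈ τ i, sextetMap τ a v j =
      (if τ i = τ a then -1 else 1) * (v j - (∑ j ∈ τ i, v j) / 2) := by
    intro j hj
    rw [sextetMap_apply, hτ.eq_of_mem i j hj]
  rw [Finset.sum_congr rfl this, ← Finset.mul_sum, Finset.sum_sub_distrib, Finset.sum_const,
    hτ.card_eq, nsmul_eq_mul]
  push_cast
  ring

theorem IsSextet.sextetMap_involutive {τ : Fin 24 → Finset (Fin 24)} (hτ : IsSextet τ)
    (a : Fin 24) : Function.Involutive (sextetMap τ a) := by
  intro v
  ext i
  rw [sextetMap_apply, hτ.sum_sextetMap, sextetMap_apply]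
  split_ifs <;> ring

/-- On a block with sum s the squares change by s²/4 - s v_i, which sums to 0 over the four places.
-/
theorem IsSextet.norm_sextetMap {τ : Fin 24 → Finset (Fin 24)} (hτ : IsSextet τ)
    (a : Fin 24) (v : EuclideanSpace ℝ (Fin 24)) : ‖sextetMap τ a v‖ = ‖v‖ := by
  rw [EuclideanSpace.norm_eq, EuclideanSpace.norm_eq]
  congr 1
  have h1 : ∀ i, ‖sextetMap τ a v i‖ ^ 2 = ‖v i‖ ^ 2 +
      ((∑ j ∈ τ i, (∑ k ∈ τ i, v k) * v j / 4) - ∑ j ∈ τ i, v i * v j) := by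
    intro i
    rw [sextetMap_apply, ← Finset.mul_sum, ← Finset.sum_div, ← Finset.mul_sum, Real.norm_eq_abs,
      Real.norm_eq_abs, sq_abs, sq_abs]
    split_ifs <;> ring
  have h2 : ∑ i, ∑ j ∈ τ i, (∑ k ∈ τ i, v k) * v j / 4 = ∑ i, ∑ j ∈ τ i, v i * v j := by
    rw [hτ.sum_comm]
    refine Finset.sum_congr rfl fun i _ => ?_
    rw [Finset.sum_congr rfl fun j hj => by rw [hτ.eq_of_mem i j hj], Finset.sum_const,
      hτ.card_eq, nsmul_eq_mul, ← Finset.mul_sum]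
    push_cast
    ring
  simp only [h1, Finset.sum_add_distrib, Finset.sum_sub_distrib]
  rw [h2]
  ring

/-- The map `sextetMap` is x ↦ x - v, with v the lattice vector of `exists_projection`. Only the new
entries on the block of `a` are needed later. -/
theorem IsSextet.exists_conway {τ : Fin 24 → Finset (Fin 24)} (hτ : IsSextet τ) (a : Fin 24)
    {x : Fin 24 → ℤ} (hx : IsScaledLeechVector x) : ∃ g ∈ conwayGroup, ∃ x',
      IsScaledLeechVector x' ∧ g (scaled x) = scaled x' ∧
      ∀ i, τ i = τ a → 2 * x' i = (∑ j ∈ τ i, x j) - 2 * x i := by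
  have hmap : ∀ x, IsScaledLeechVector x → ∃ x', IsScaledLeechVector x' ∧
      sextetMap τ a (scaled x) = scaled x' ∧
      ∀ i, τ i = τ a → 2 * x' i = (∑ j ∈ τ i, x j) - 2 * x i := by
    intro x hx
    obtain ⟨v, hv, h⟩ := hτ.exists_projection a hx
    refine ⟨x - v, hx.sub hv, ?_, fun i hi => ?_⟩
    · ext i
      have h' : 2 * (v i : ℝ) =
          if τ i = τ a then 4 * (x i : ℝ) - ∑ j ∈ τ i, (x j : ℝ) else ∑ j ∈ τ i, (x j : ℝ) := by
        have := h i
        split_ifs at this ⊢ <;> exact_mod_cast this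
      rw [sextetMap_apply]
      simp only [scaled_apply, ← Finset.sum_div, Pi.sub_apply]
      push_cast
      have h8 : √(8 : ℝ) ≠ 0 := by positivity
      split_ifs at h' ⊢ <;> field_simp <;> linarith
    · have := h i
      rw [if_pos hi] at this
      simp only [Pi.sub_apply]
      linarith
  obtain ⟨g, hg, h⟩ := exists_mem_conwayGroup (sextetMap τ a) (hτ.sextetMap_involutive a)
    (hτ.norm_sextetMap a) fun x hx => by
      obtain ⟨x', h1, h2, -⟩ := hmap x hx
      exact ⟨x', h1, h2⟩
  obtain ⟨x', h1, h2, h3⟩ := hmap x hx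
  exact ⟨g, hg, x', h1, by rw [h, h2], h3⟩

/-! ### Transitivity of the Conway group on the minimal vectors -/

/-- The vectors `x / √8` and `y / √8` are in one orbit of the Conway group. -/
def SameOrbit (x y : Fin 24 → ℤ) : Prop := ∃ g ∈ conwayGroup, g (scaled x) = scaled y

theorem SameOrbit.symm {x y : Fin 24 → ℤ} (h : SameOrbit x y) : SameOrbit y x := by
  obtain ⟨g, hg, h⟩ := h
  refine ⟨g⁻¹, inv_mem hg, ?_⟩
  rw [← h]
  exact g.symm_apply_apply _

theorem SameOrbit.trans {x y z : Fin 24 → ℤ} (h : SameOrbit x y) (h' : SameOrbit y z) :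
    SameOrbit x z := by
  obtain ⟨g, hg, h⟩ := h
  obtain ⟨g', hg', h'⟩ := h'
  exact ⟨g' * g, mul_mem hg' hg, by rw [LinearIsometryEquiv.coe_mul, Function.comp_apply, h, h']⟩

theorem SameOrbit.mem_shortVectors {x y : Fin 24 → ℤ} (h : SameOrbit x y)
    (hx : x ∈ shortVectors) : y ∈ shortVectors := by
  obtain ⟨g, hg, h⟩ := h
  have := image_minimalVectors hg (v := scaled x) (minimalVectors_eq ▸ mem_image_of_mem _ hx)
  rw [h, minimalVectors_eq] at this
  obtain ⟨y', hy', h'⟩ := this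
  rwa [scaled_injective h'] at hy'

theorem sameOrbit_signChange {A : Finset (Fin 24)} (hA : A ∈ golaySets) (x : Fin 24 → ℤ) :
    SameOrbit x fun i => if i ∈ A then -x i else x i := by
  obtain ⟨g, hg, h⟩ := exists_signChange hA
  exact ⟨g, hg, h x⟩

theorem exists_sameOrbit_of_four {A : Finset (Fin 24)} (hA : A.card = 4) {x : Fin 24 → ℤ}
    (hx : x ∈ shortVectors) : ∃ y, SameOrbit x y ∧ y ∈ shortVectors ∧
      ∀ i ∈ A, 2 * y i = (∑ j ∈ A, x j) - 2 * x i := by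
  obtain ⟨τ, hτ, hτA⟩ := exists_sextet hA
  obtain ⟨a, ha⟩ := Finset.card_pos.1 (by rw [hA]; norm_num : 0 < A.card)
  obtain ⟨g, hg, y, -, h, hy⟩ := hτ.exists_conway a (mem_shortVectors.1 hx).1
  have ho : SameOrbit x y := ⟨g, hg, h⟩
  refine ⟨y, ho, ho.mem_shortVectors hx, fun i hi => ?_⟩
  rw [hy i (by rw [hτA i hi, hτA a ha]), hτA i hi]

/-- In a sextet with `i` and `j` in different blocks, join the block of `i` to a block that contains
neither. -/
theorem exists_separating {i j : Fin 24} (h : i ≠ j) : ∃ A ∈ golaySets, i ∈ A ∧ j ∉ A := by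
  have hc : ({i} : Finset (Fin 24)).card ≤ 4 := by simp
  obtain ⟨B, hiB, hBj, hB⟩ := Finset.exists_subsuperset_card_eq
    (s := {i}) (t := Finset.univ.erase j) (n := 4) (by simp [h]) hc (by simp)
  obtain ⟨τ, hτ, hτB⟩ := exists_sextet hB
  have hiB' : i ∈ B := hiB (by simp)
  obtain ⟨k, hk⟩ : ∃ k, k ∉ τ i ∪ τ j := by
    by_contra hall
    push Not at hall
    have h1 : (τ i ∪ τ j) = Finset.univ := Finset.eq_univ_iff_forall.2 hall
    have h2 := Finset.card_union_le (τ i) (τ j)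
    rw [h1, hτ.card_eq, hτ.card_eq] at h2
    simp at h2
  rw [Finset.mem_union, not_or] at hk
  refine ⟨symmDiff (τ i) (τ k), hτ.symmDiff_mem i k, ?_, ?_⟩
  · rw [Finset.mem_symmDiff]
    exact Or.inl ⟨hτ.mem_self i, fun hik => hk.1 ((hτ.mem_comm i k).2 hik)⟩
  · rw [Finset.mem_symmDiff]
    rintro (⟨hj, -⟩ | ⟨hj, -⟩)
    · rw [hτB i hiB'] at hj
      simpa using hBj hj
    · exact hk.2 ((hτ.mem_comm j k).2 hj)

theorem exists_golaySet_inter_pair {i j : Fin 24} (h : i ≠ j) (D : Finset (Fin 24)) :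
    ∃ A ∈ golaySets, (i ∈ A ↔ i ∈ D) ∧ (j ∈ A ↔ j ∈ D) := by
  by_cases hi : i ∈ D <;> by_cases hj : j ∈ D
  · exact ⟨Finset.univ, univ_mem_golaySets, by simp [hi, hj]⟩
  · obtain ⟨A, hA, h1, h2⟩ := exists_separating h
    exact ⟨A, hA, by simp [hi, hj, h1, h2]⟩
  · obtain ⟨A, hA, h1, h2⟩ := exists_separating h.symm
    exact ⟨A, hA, by simp [hi, hj, h1, h2]⟩
  · refine ⟨symmDiff Finset.univ Finset.univ,
      symmDiff_mem_golaySets univ_mem_golaySets univ_mem_golaySets, by simp [hi, hj]⟩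

theorem eq_signVector_of_two_fours {x : Fin 24 → ℤ} (hx : x ∈ shortVectors) {k l : Fin 24}
    (hkl : k ≠ l) (hk : x k = 4) (hl : x l = 4) : x = signVector 4 {k, l} ∅ := by
  have hn := (mem_shortVectors.1 hx).2
  funext p
  unfold signVector
  by_cases hpk : p = k
  · simp [hpk, hk]
  by_cases hpl : p = l
  · simp [hpl, hl]
  have hle : ∑ i ∈ {k, l, p}, x i ^ 2 ≤ ∑ i, x i ^ 2 :=
    Finset.sum_le_sum_of_subset_of_nonneg (Finset.subset_univ _) fun _ _ _ => sq_nonneg _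
  rw [Finset.sum_insert (by simp [hkl, Ne.symm hpk]), Finset.sum_pair (Ne.symm hpl), hk, hl, hn]
    at hle
  have : x p ^ 2 = 0 := le_antisymm (by linarith) (sq_nonneg _)
  simp [hpk, hpl, (pow_eq_zero_iff two_ne_zero).1 this]

/-- Apply the sextet map of the block {i, j, k, l}: the block sum is 8, so each entry c becomes 4 -
c. The two entries 4 already exhaust the norm 32. -/
theorem sameOrbit_disjoint_pairs {i j k l : Fin 24} (hij : i ≠ j) (hkl : k ≠ l)
    (hik : i ≠ k) (hil : i ≠ l) (hjk : j ≠ k) (hjl : j ≠ l) :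
    SameOrbit (signVector 4 {i, j} ∅) (signVector 4 {k, l} ∅) := by
  have hx := signVector_four_mem_shortVectors hij (Finset.empty_subset _)
  have hA : ({i, j, k, l} : Finset (Fin 24)).card = 4 := by
    rw [Finset.card_insert_of_notMem (by simp [hij, hik, hil]),
      Finset.card_insert_of_notMem (by simp [hjk, hjl]), Finset.card_pair hkl]
  obtain ⟨y, ho, hy, h⟩ := exists_sameOrbit_of_four hA hx
  have hs : ∑ p ∈ {i, j, k, l}, signVector 4 {i, j} ∅ p = 8 := by
    rw [Finset.sum_insert (by simp [hij, hik, hil]), Finset.sum_insert (by simp [hjk, hjl]),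
      Finset.sum_pair hkl]
    simp [signVector, hik.symm, hil.symm, hjk.symm, hjl.symm]
  have hk := h k (by simp)
  have hl := h l (by simp)
  rw [hs] at hk hl
  simp only [signVector, Finset.notMem_empty, if_false, Finset.mem_insert, Finset.mem_singleton,
    hik.symm, hil.symm, hjk.symm, hjl.symm, or_self] at hk hl
  rwa [eq_signVector_of_two_fours hy hkl (by linarith) (by linarith)] at ho

/-- A vector of shape `(±4², 0²²)` to which all the minimal vectors are moved. -/
def baseVector : Fin 24 → ℤ := signVector 4 {0, 1} ∅

theorem sameOrbit_pair {i j : Fin 24} (hij : i ≠ j) (D : Finset (Fin 24)) (hD : D ⊆ {i, j}) :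
    SameOrbit (signVector 4 {i, j} D) baseVector := by
  have h1 : SameOrbit (signVector 4 {i, j} D) (signVector 4 {i, j} ∅) := by
    obtain ⟨A, hA, hi, hj⟩ := exists_golaySet_inter_pair hij D
    convert sameOrbit_signChange hA _ using 1
    funext p
    unfold signVector
    by_cases hpi : p = i
    · subst hpi
      by_cases h : p ∈ D <;> simp [h, hi]
    by_cases hpj : p = j
    · subst hpj
      by_cases h : p ∈ D <;> simp [h, hj]
    have : p ∉ D := fun h => by simpa [hpi, hpj] using hD h
    simp [this, hpi, hpj]
  -- The pairs {i, j} and {0, 1} may overlap, so the passage goes through a third pair disjoint from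
  -- both.
  have hc : (Finset.univ \ {i, j, 0, 1} : Finset (Fin 24)).card ≥ 2 := by
    rw [Finset.card_sdiff_of_subset (Finset.subset_univ _)]
    have : ({i, j, 0, 1} : Finset (Fin 24)).card ≤ 4 := Finset.card_le_four
    simp
    omega
  obtain ⟨k, hk, l, hl, hkl⟩ := Finset.one_lt_card.1 hc
  simp only [Finset.mem_sdiff, Finset.mem_univ, true_and, Finset.mem_insert,
    Finset.mem_singleton, not_or] at hk hl
  exact h1.trans ((sameOrbit_disjoint_pairs hij hkl (Ne.symm hk.1) (Ne.symm hl.1)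
    (Ne.symm hk.2.1) (Ne.symm hl.2.1)).trans
    (sameOrbit_disjoint_pairs hkl (by decide) hk.2.2.1 hk.2.2.2 hl.2.2.1 hl.2.2.2))

theorem even_of_mem_shortVectors {x : Fin 24 → ℤ} (hx : x ∈ shortVectors) {i : Fin 24}
    (hi : Even (x i)) (j : Fin 24) : Even (x j) := by
  by_contra h
  rw [Int.not_even_iff_odd] at h
  exact (Int.not_even_iff_odd.2 ((mem_shortVectors.1 hx).1.odd_of_odd h i)) hi

theorem sameOrbit_of_four_le_abs {x : Fin 24 → ℤ} (hx : x ∈ shortVectors) {i : Fin 24}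
    (hi : x i = 4 ∨ x i = -4) : SameOrbit x baseVector := by
  have hx' := mem_shortVectors.1 hx
  have he : Even (x i) := by rcases hi with h | h <;> rw [h] <;> decide
  rcases eq_signVector hx'.1 hx'.2 (even_of_mem_shortVectors hx he 0) with
    ⟨P, -, D, -, -, rfl⟩ | ⟨P, D, hP, hD, rfl⟩
  · exfalso
    have h : signVector 2 P D i ^ 2 ≤ 4 := by
      unfold signVector
      split_ifs <;> norm_num
    rcases hi with hi | hi <;> rw [hi] at h <;> norm_num at h
  · obtain ⟨k, l, hkl, rfl⟩ := Finset.card_eq_two.1 hP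
    exact sameOrbit_pair hkl D hD

theorem exists_three {α : Type*} [DecidableEq α] {P : Finset α} (hP : 5 ≤ P.card) (p q : α) :
    ∃ B ⊆ P, B.card = 3 ∧ p ∉ B ∧ q ∉ B := by
  have h1 : 3 ≤ (P \ {p, q}).card := by
    have := Finset.le_card_sdiff {p, q} P
    have h2 : ({p, q} : Finset α).card ≤ 2 := Finset.card_le_two
    omega
  obtain ⟨B, hB, hc⟩ := Finset.exists_subset_card_eq h1
  refine ⟨B, hB.trans Finset.sdiff_subset, hc, fun h => ?_, fun h => ?_⟩ <;>
    simpa using hB h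

/-- In the octad choose four places with an odd number of minus signs; three places other than p and
q, together with one of p and q, can be given either parity. The sum over them is ±4, and the sextet
map turns the entry whose sign occurs once into ±4. -/
theorem sameOrbit_of_both_signs {x : Fin 24 → ℤ} (hx : x ∈ shortVectors) {p q : Fin 24}
    (hp : x p = 2) (hq : x q = -2) : SameOrbit x baseVector := by
  have hx' := mem_shortVectors.1 hx
  have he : Even (x p) := by rw [hp]; decide
  rcases eq_signVector hx'.1 hx'.2 (even_of_mem_shortVectors hx he 0) with
    ⟨P, hP, D, hD, -, rfl⟩ | ⟨P, D, -, -, rfl⟩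
  · have hqD : q ∈ D := by
      unfold signVector at hq
      by_contra h
      rw [if_neg h] at hq
      split_ifs at hq
    have hpD : p ∉ D := by
      unfold signVector at hp
      intro h
      rw [if_pos h] at hp
      omega
    have hpP : p ∈ P := by
      unfold signVector at hp
      by_contra h
      rw [if_neg hpD, if_neg h] at hp
      omega
    obtain ⟨B, hB, hBc, hpB, hqB⟩ := exists_three (P := P) (by rw [(mem_octads.1 hP).2]; norm_num) p q
    obtain ⟨A, hA, hAP, hAD⟩ : ∃ A : Finset (Fin 24), A.card = 4 ∧ A ⊆ P ∧ Odd (A ∩ D).card := by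
      rcases Nat.even_or_odd (B ∩ D).card with h | h
      · refine ⟨insert q B, by rw [Finset.card_insert_of_notMem hqB, hBc],
          Finset.insert_subset (hD hqD) hB, ?_⟩
        rw [Finset.insert_inter_of_mem hqD, Finset.card_insert_of_notMem (by simp [hqB])]
        exact h.add_one
      · refine ⟨insert p B, by rw [Finset.card_insert_of_notMem hpB, hBc],
          Finset.insert_subset hpP hB, ?_⟩
        rwa [Finset.insert_inter_of_notMem hpD]
    obtain ⟨y, ho, hy, h⟩ := exists_sameOrbit_of_four hA hx
    have hs : ∑ j ∈ A, signVector 2 P D j = 8 - 4 * ((A ∩ D).card : ℤ) := by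
      have : ∀ j ∈ A, signVector 2 P D j = 2 - if j ∈ D then 4 else 0 := by
        intro j hj
        unfold signVector
        by_cases hjD : j ∈ D <;> simp [hjD, hAP hj]
      rw [Finset.sum_congr rfl this, Finset.sum_sub_distrib, Finset.sum_ite_mem, Finset.sum_const,
        Finset.sum_const, hA, nsmul_eq_mul, nsmul_eq_mul]
      push_cast
      ring
    have hle : (A ∩ D).card ≤ 4 := hA ▸ Finset.card_le_card Finset.inter_subset_left
    have hcase : (A ∩ D).card = 1 ∨ (A ∩ D).card = 3 := by
      rw [Nat.odd_iff] at hAD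
      omega
    rcases hcase with hc | hc
    · obtain ⟨r, hr⟩ := Finset.card_pos.1 (by rw [hc]; norm_num : 0 < (A ∩ D).card)
      rw [Finset.mem_inter] at hr
      have hyr := h r hr.1
      rw [hs, hc] at hyr
      simp only [signVector, hr.2, if_true] at hyr
      exact ho.trans (sameOrbit_of_four_le_abs hy (i := r) (Or.inl (by push_cast at hyr; linarith)))
    · have hpos : 0 < (A \ D).card := by
        have := Finset.card_sdiff_add_card_inter A D
        omega
      obtain ⟨r, hr⟩ := Finset.card_pos.1 hpos
      rw [Finset.mem_sdiff] at hr
      have hyr := h r hr.1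
      rw [hs, hc] at hyr
      simp only [signVector, hr.2, if_false, hAP hr.1, if_true] at hyr
      exact ho.trans (sameOrbit_of_four_le_abs hy (i := r) (Or.inr (by push_cast at hyr; linarith)))
  · unfold signVector at hp
    split_ifs at hp <;> omega

/-- A vector on an octad acquires both signs, if necessary, by a sign change on a codeword that
separates two of its places. -/
theorem sameOrbit_of_even {x : Fin 24 → ℤ} (hx : x ∈ shortVectors) (he : Even (x 0)) :
    SameOrbit x baseVector := by
  have hx' := mem_shortVectors.1 hx
  rcases eq_signVector hx'.1 hx'.2 he with ⟨P, hP, D, hD, -, rfl⟩ | ⟨P, D, hP, hD, rfl⟩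
  · obtain ⟨i, hi, j, hj, hij⟩ := Finset.one_lt_card.1
      (by rw [(mem_octads.1 hP).2]; norm_num : 1 < P.card)
    have hval : ∀ k ∈ P, signVector 2 P D k = 2 ∨ signVector 2 P D k = -2 := by
      intro k hk
      unfold signVector
      by_cases h : k ∈ D <;> simp [h, hk]
    obtain ⟨A, hA, hiA, hjA⟩ := exists_separating hij
    have ho := sameOrbit_signChange hA (signVector 2 P D)
    have hy := ho.mem_shortVectors hx
    rcases hval i hi with h1 | h1 <;> rcases hval j hj with h2 | h2
    · exact ho.trans (sameOrbit_of_both_signs hy (p := j) (q := i) (by simp [hjA, h2])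
        (by simp [hiA, h1]))
    · exact sameOrbit_of_both_signs hx h1 h2
    · exact sameOrbit_of_both_signs hx h2 h1
    · exact ho.trans (sameOrbit_of_both_signs hy (p := i) (q := j) (by simp [hiA, h1])
        (by simp [hjA, h2]))
  · obtain ⟨k, l, hkl, rfl⟩ := Finset.card_eq_two.1 hP
    exact sameOrbit_pair hkl D hD

/-- Add p or q to three other places. The two sums differ by 2 modulo 4, so one is 2 modulo 4. Half
of it is odd, and the sextet map of these four places makes odd entries even. -/
theorem sameOrbit_of_not_modEq {x : Fin 24 → ℤ} (hx : x ∈ shortVectors) (ho : Odd (x 0))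
    {p q : Fin 24} (hpq : ¬ 4 ∣ x p - x q) : SameOrbit x baseVector := by
  have hodd := (mem_shortVectors.1 hx).1.odd_of_odd ho
  obtain ⟨B, -, hBc, hpB, hqB⟩ := exists_three (P := Finset.univ) (by simp) p q
  have hBs : Odd (∑ j ∈ B, x j) := by
    obtain ⟨a, b, c, hab, hac, hbc, rfl⟩ := Finset.card_eq_three.1 hBc
    rw [Finset.sum_insert (by simp [hab, hac]), Finset.sum_pair hbc]
    exact (hodd a).add_even ((hodd b).add_odd (hodd c))
  obtain ⟨A, hA, a, ha, hAs⟩ : ∃ A : Finset (Fin 24), A.card = 4 ∧ ∃ a ∈ A,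
      ∃ k, ∑ j ∈ A, x j = 4 * k + 2 := by
    obtain ⟨s, hs⟩ := hBs
    obtain ⟨u, hu⟩ := hodd p
    obtain ⟨v, hv⟩ := hodd q
    rcases Int.even_or_odd (s + u) with ⟨k, hk⟩ | ⟨k, hk⟩
    · refine ⟨insert p B, by rw [Finset.card_insert_of_notMem hpB, hBc], p, by simp, k, ?_⟩
      rw [Finset.sum_insert hpB]
      omega
    · refine ⟨insert q B, by rw [Finset.card_insert_of_notMem hqB, hBc], q, by simp, (s + v) / 2, ?_⟩
      rw [Finset.sum_insert hqB]
      omega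
  obtain ⟨y, hxy, hy, h⟩ := exists_sameOrbit_of_four hA hx
  obtain ⟨k, hk⟩ := hAs
  have hya := h a ha
  rw [hk] at hya
  have he : Even (y a) := by
    obtain ⟨t, ht⟩ := hodd a
    exact ⟨k - t, by linarith⟩
  exact hxy.trans (sameOrbit_of_even hy (even_of_mem_shortVectors hy he 0))

/-- If two odd entries agree modulo 4, changing the sign of just one of them by a separating
codeword makes them differ. -/
theorem sameOrbit_baseVector {x : Fin 24 → ℤ} (hx : x ∈ shortVectors) :
    SameOrbit x baseVector := by
  rcases Int.even_or_odd (x 0) with he | ho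
  · exact sameOrbit_of_even hx he
  · by_cases hpq : 4 ∣ x 0 - x 1
    · obtain ⟨A, hA, h0, h1⟩ := exists_separating (show (0 : Fin 24) ≠ 1 by decide)
      have h := sameOrbit_signChange hA x
      have hy := h.mem_shortVectors hx
      refine h.trans (sameOrbit_of_not_modEq hy ?_ (p := 0) (q := 1) ?_)
      · simpa [h0] using ho.neg
      · simp only [h0, h1, if_true, if_false]
        obtain ⟨t, ht⟩ := ho
        omega
    · exact sameOrbit_of_not_modEq hx ho hpq

theorem exists_conway_apply_eq {v w : EuclideanSpace ℝ (Fin 24)} (hv : v ∈ minimalVectors)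
    (hw : w ∈ minimalVectors) : ∃ g ∈ conwayGroup, g v = w := by
  rw [minimalVectors_eq] at hv hw
  obtain ⟨x, hx, rfl⟩ := hv
  obtain ⟨y, hy, rfl⟩ := hw
  exact (sameOrbit_baseVector hx).trans (sameOrbit_baseVector hy).symm

/-! ### Averages over the Conway group -/

theorem scaled_add_scaled {i j : Fin 24} (h : i ≠ j) :
    scaled (signVector 4 {i, j} ∅) + scaled (signVector 4 {i, j} {j}) =
      (8 / √8 : ℝ) • EuclideanSpace.single i (1 : ℝ) := by
  ext p
  simp only [PiLp.add_apply, scaled_apply, PiLp.smul_apply, smul_eq_mul,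
    PiLp.single_apply, signVector]
  by_cases hpi : p = i
  · subst hpi
    simp only [Finset.notMem_empty, if_false, Finset.mem_insert, true_or, if_true,
      Finset.mem_singleton, h]
    push_cast
    ring
  · by_cases hpj : p = j
    · subst hpj
      simp [hpi, neg_div]
    · simp [hpi, hpj]

/-- By `scaled_add_scaled` each basis vector is a multiple of a sum of two minimal vectors.
Consequently `conwayGroup` embeds in the self-maps of a finite set, and means over it make sense. -/
theorem linearIsometryEquiv_eq_of_eqOn_minimalVectors
    {g h : EuclideanSpace ℝ (Fin 24) ≃ₗᵢ[ℝ] EuclideanSpace ℝ (Fin 24)}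
    (hgh : ∀ v ∈ minimalVectors, g v = h v) : g = h := by
  have h8 : (8 / √8 : ℝ) ≠ 0 := by positivity
  have hsingle : ∀ i, g (EuclideanSpace.single i (1 : ℝ)) = h (EuclideanSpace.single i 1) := by
    intro i
    obtain ⟨j, hj⟩ := exists_ne i
    have hmem : ∀ D ⊆ {i, j}, scaled (signVector 4 {i, j} D) ∈ minimalVectors := fun D hD => by
      rw [minimalVectors_eq]
      exact mem_image_of_mem _ (signVector_four_mem_shortVectors hj.symm hD)
    have key : (8 / √8 : ℝ) • g (EuclideanSpace.single i (1 : ℝ)) =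
        (8 / √8 : ℝ) • h (EuclideanSpace.single i 1) := by
      rw [← map_smul, ← map_smul, ← scaled_add_scaled hj.symm, map_add, map_add,
        hgh _ (hmem _ (by simp)), hgh _ (hmem _ (by simp))]
    exact smul_right_injective _ h8 key
  have hlin : (g.toLinearEquiv : EuclideanSpace ℝ (Fin 24) →ₗ[ℝ] EuclideanSpace ℝ (Fin 24)) =
      h.toLinearEquiv :=
    (EuclideanSpace.basisFun (Fin 24) ℝ).toBasis.ext fun i => by
      simpa using hsingle i
  ext1 v
  exact LinearMap.congr_fun hlin v

instance finite_conwayGroup : Finite conwayGroup := by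
  have : Finite minimalVectors := finite_minimalVectors
  refine Finite.of_injective
    (fun g : conwayGroup => fun v : minimalVectors =>
      (⟨g.1 v, image_minimalVectors g.2 v.2⟩ : minimalVectors)) fun g h hgh => ?_
  refine Subtype.ext (linearIsometryEquiv_eq_of_eqOn_minimalVectors fun v hv => ?_)
  exact congrArg Subtype.val (congrFun hgh ⟨v, hv⟩)

instance fintype_conwayGroup : Fintype conwayGroup := Fintype.ofFinite _

/-- The size of `gS ∩ U`. -/
def overlap (S U : Set (EuclideanSpace ℝ (Fin 24))) (g : conwayGroup) : ℕ :=
  ((g.1 '' S) ∩ U).ncard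

-- By transitivity and right multiplication, the number of g with g v in U does not depend on the
-- minimal vector v. Summed over all v it is counted g by g, each g contributing |U|.
open Classical in
theorem sum_mem_eq {U : Set (EuclideanSpace ℝ (Fin 24))} (hU : U ⊆ minimalVectors)
    {v : EuclideanSpace ℝ (Fin 24)} (hv : v ∈ minimalVectors) :
    196560 * ∑ g : conwayGroup, (if g.1 v ∈ U then 1 else 0) =
      Fintype.card conwayGroup * U.ncard := by
  set C := finite_minimalVectors.toFinset with hC
  have hcard : C.card = 196560 := by
    rw [← ncard_minimalVectors, Set.ncard_eq_toFinset_card _ finite_minimalVectors]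
  have hconst : ∀ w ∈ C, ∑ g : conwayGroup, (if g.1 w ∈ U then 1 else 0) =
      ∑ g : conwayGroup, (if g.1 v ∈ U then 1 else 0) := by
    intro w hw
    obtain ⟨h, hh, rfl⟩ := exists_conway_apply_eq hv (finite_minimalVectors.mem_toFinset.1 hw)
    exact Fintype.sum_equiv (Equiv.mulRight (⟨h, hh⟩ : conwayGroup)) _ _ fun g => rfl
  rw [← hcard, ← smul_eq_mul, ← Finset.sum_const, ← Finset.sum_congr rfl hconst, Finset.sum_comm,
    ← Finset.card_univ, ← smul_eq_mul, ← Finset.sum_const]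
  refine Finset.sum_congr rfl fun g _ => ?_
  rw [← Finset.card_filter, ← Set.ncard_image_of_injective U g.1.symm.injective,
    ← Set.ncard_coe_finset]
  congr 1
  ext w
  simp only [Finset.coe_filter, hC, Set.Finite.mem_toFinset, Set.mem_ofPred_eq, Set.mem_image]
  constructor
  · rintro ⟨-, h⟩
    exact ⟨_, h, g.1.symm_apply_apply w⟩
  · rintro ⟨u, hu, rfl⟩
    exact ⟨image_minimalVectors (inv_mem g.2) (hU hu), by simpa using hu⟩

theorem sum_overlap {S U : Set (EuclideanSpace ℝ (Fin 24))} (hS : S ⊆ minimalVectors)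
    (hU : U ⊆ minimalVectors) :
    196560 * ∑ g : conwayGroup, overlap S U g =
      Fintype.card conwayGroup * (S.ncard * U.ncard) := by
  classical
  have hfin : S.Finite := finite_minimalVectors.subset hS
  have h1 : ∀ g : conwayGroup, overlap S U g = ∑ v ∈ hfin.toFinset, if g.1 v ∈ U then 1 else 0 := by
    intro g
    have himage : (g.1 '' S) ∩ U = g.1 '' (hfin.toFinset.filter fun v => g.1 v ∈ U) := by
      ext w
      simp only [Set.mem_inter_iff, Set.mem_image, Finset.coe_filter, Set.Finite.mem_toFinset,
        Set.mem_ofPred_eq]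
      constructor
      · rintro ⟨⟨v, hv, rfl⟩, h⟩
        exact ⟨v, ⟨hv, h⟩, rfl⟩
      · rintro ⟨v, ⟨hv, h⟩, rfl⟩
        exact ⟨⟨v, hv, rfl⟩, h⟩
    rw [overlap, himage, Set.ncard_image_of_injective _ g.1.injective, Set.ncard_coe_finset,
      Finset.card_filter]
  simp only [h1]
  rw [Finset.sum_comm, Finset.mul_sum, Finset.sum_congr rfl fun v hv =>
    sum_mem_eq hU (hS (hfin.mem_toFinset.1 hv)), Finset.sum_const, smul_eq_mul,
    Set.ncard_eq_toFinset_card S hfin]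
  ring

theorem mean_overlap {S U : Set (EuclideanSpace ℝ (Fin 24))} (hS : S ⊆ minimalVectors)
    (hU : U ⊆ minimalVectors) :
    (∑ᶠ g : conwayGroup, (((g.1 '' S) ∩ U).ncard : ℝ)) / Nat.card conwayGroup =
      S.ncard * U.ncard / 196560 := by
  have h := sum_overlap hS hU
  have hpos : (0 : ℝ) < Fintype.card conwayGroup := by exact_mod_cast Fintype.card_pos
  rw [finsum_eq_sum_of_fintype, Nat.card_eq_fintype_card, div_eq_div_iff hpos.ne' (by norm_num)]
  have : (196560 : ℝ) * ∑ g : conwayGroup, (overlap S U g : ℝ) =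
      Fintype.card conwayGroup * (S.ncard * U.ncard) := by exact_mod_cast h
  simp only [overlap] at this
  linarith

theorem exists_overlap_le {S U : Set (EuclideanSpace ℝ (Fin 24))} (hS : S ⊆ minimalVectors)
    (hU : U ⊆ minimalVectors) :
    ∃ g : conwayGroup, 196560 * overlap S U g ≤ S.ncard * U.ncard := by
  have h := sum_overlap hS hU
  by_contra! hlt
  have := Finset.sum_lt_sum_of_nonempty (s := (Finset.univ : Finset conwayGroup))
    Finset.univ_nonempty fun g _ => hlt g
  rw [Finset.sum_const, ← Finset.mul_sum, h, Finset.card_univ, smul_eq_mul] at this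
  exact lt_irrefl _ this

/-- Right multiplication by `t` permutes the group, so both terms have the same mean. -/
theorem exists_overlap_add_le {S U : Set (EuclideanSpace ℝ (Fin 24))} (hS : S ⊆ minimalVectors)
    (hU : U ⊆ minimalVectors) (t : conwayGroup) : ∃ g : conwayGroup,
      196560 * (overlap S U g + overlap S U (g * t)) ≤ 2 * (S.ncard * U.ncard) := by
  have h := sum_overlap hS hU
  have h' : ∑ g : conwayGroup, overlap S U (g * t) = ∑ g : conwayGroup, overlap S U g :=
    Fintype.sum_equiv (Equiv.mulRight t) _ _ fun g => rfl
  by_contra! hlt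
  have := Finset.sum_lt_sum_of_nonempty (s := (Finset.univ : Finset conwayGroup))
    Finset.univ_nonempty fun g _ => hlt g
  rw [Finset.sum_const, ← Finset.mul_sum, Finset.sum_add_distrib, h', mul_add, h,
    Finset.card_univ, smul_eq_mul] at this
  linarith

/-! ### Kissing configurations from disjoint admissible sets -/

/-- For vectors of norm 2, |v - w|² = 8 - 2⟨v, w⟩, so inner product at most 2 means distance at
least 2. -/
theorem card_le_kissingNumber {n : ℕ} {ι : Type*} (s : Finset ι)
    (p : ι → EuclideanSpace ℝ (Fin n)) (hp : ∀ i ∈ s, ‖p i‖ = 2)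
    (hi : ∀ i ∈ s, ∀ j ∈ s, i ≠ j → inner ℝ (p i) (p j) ≤ 2) :
    (s.card : ℕ∞) ≤ kissingNumber n := by
  have hinj : Set.InjOn p s := by
    intro i his j hjs h
    by_contra hne
    have h1 := hi i his j hjs hne
    rw [← h, real_inner_self_eq_norm_sq, hp i his] at h1
    norm_num at h1
  have hconf : IsKissingConfiguration (p '' s) := by
    refine ⟨?_, ?_⟩
    · rintro _ ⟨i, his, rfl⟩
      rw [dist_zero_right, hp i his]
    · rintro _ ⟨i, his, rfl⟩ _ ⟨j, hjs, rfl⟩ hne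
      refine Metric.ball_disjoint_ball ?_
      have h1 := hi i his j hjs fun h => hne (by rw [h])
      have h2 := norm_sub_sq_real (p i) (p j)
      rw [hp i his, hp j hjs, ← dist_eq_norm] at h2
      nlinarith [dist_nonneg (x := p i) (y := p j)]
  have hcard : (p '' (s : Set ι)).encard = s.card := by
    rw [hinj.encard_image, Set.encard_coe_eq_coe_finsetCard]
  rw [← hcard]
  exact le_iSup₂_of_le (p '' s) hconf le_rfl

/-- The vector with the coordinates of `u` followed by those of `w`. -/
def joinVector {d : ℕ} (u : EuclideanSpace ℝ (Fin 24)) (w : EuclideanSpace ℝ (Fin d)) :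
    EuclideanSpace ℝ (Fin (24 + d)) :=
  WithLp.toLp 2 (Fin.append (WithLp.ofLp u) (WithLp.ofLp w))

theorem inner_joinVector {d : ℕ} (u u' : EuclideanSpace ℝ (Fin 24))
    (w w' : EuclideanSpace ℝ (Fin d)) :
    inner ℝ (joinVector u w) (joinVector u' w') = inner ℝ u u' + inner ℝ w w' := by
  simp only [PiLp.inner_apply, joinVector, Fin.sum_univ_add, Fin.append_left, Fin.append_right]

theorem norm_eq_two_of_inner {n : ℕ} {v : EuclideanSpace ℝ (Fin n)} (h : inner ℝ v v = (4 : ℝ)) :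
    ‖v‖ = 2 := by
  rw [real_inner_self_eq_norm_sq] at h
  nlinarith [norm_nonneg v]

/-- Each vector in `T j` is replaced by several vectors, with the directions in `Y j` in the new
coordinates. -/
theorem card_add_sum_le_kissingNumber {d : ℕ} (J : Finset ℕ)
    (T : ℕ → Set (EuclideanSpace ℝ (Fin 24))) (Y : ℕ → Finset (EuclideanSpace ℝ (Fin d)))
    (α β ρ : ℕ → ℝ) (hT : ∀ j ∈ J, IsAdmissible (T j))
    (hdisj : ∀ i ∈ J, ∀ j ∈ J, i ≠ j → Disjoint (T i) (T j))
    (hY : ∀ j ∈ J, ∀ y ∈ Y j, ‖y‖ = 1)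
    (hsame : ∀ j ∈ J, ∀ y ∈ Y j, ∀ y' ∈ Y j, y ≠ y' → inner ℝ y y' ≤ ρ j)
    (hcross : ∀ i ∈ J, ∀ j ∈ J, i ≠ j → ∀ y ∈ Y i, ∀ y' ∈ Y j, inner ℝ y y' ≤ (1 / 2 : ℝ))
    (hα : ∀ j ∈ J, 0 ≤ α j ∧ α j ≤ 1) (hβ : ∀ j ∈ J, 0 ≤ β j)
    (hnorm : ∀ j ∈ J, 4 * α j ^ 2 + β j ^ 2 = 4) (hle : ∀ j ∈ J, α j ^ 2 + β j ^ 2 ≤ 2)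
    (hρ : ∀ j ∈ J, 4 * α j ^ 2 + β j ^ 2 * ρ j ≤ 2)
    (hαβ : ∀ i ∈ J, ∀ j ∈ J, 2 * (α i * α j) + β i * β j / 2 ≤ 2) :
    ((196560 + ∑ j ∈ J, (T j).ncard * (Y j).card - ∑ j ∈ J, (T j).ncard : ℕ) : ℕ∞) ≤
      kissingNumber (24 + d) := by
  classical
  have hTfin : ∀ j, j ∈ J → (T j).Finite := fun j hj => finite_minimalVectors.subset (hT j hj).1
  let F : ℕ → Finset (EuclideanSpace ℝ (Fin 24)) := fun j =>
    if h : j ∈ J then (hTfin j h).toFinset else ∅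
  have hF : ∀ j ∈ J, ∀ x, x ∈ F j ↔ x ∈ T j := by
    intro j hj x
    simp only [F, dif_pos hj, Set.Finite.mem_toFinset]
  have hFcard : ∀ j ∈ J, (F j).card = (T j).ncard := by
    intro j hj
    simp only [F, dif_pos hj]
    rw [Set.ncard_eq_toFinset_card _ (hTfin j hj)]
  have hFdisj : ∀ i ∈ J, ∀ j ∈ J, i ≠ j → Disjoint (F i) (F j) := by
    intro i hi j hj hij
    rw [Finset.disjoint_left]
    intro x hx hx'
    exact Set.disjoint_left.1 (hdisj i hi j hj hij) ((hF i hi x).1 hx) ((hF j hj x).1 hx')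
  let C := finite_minimalVectors.toFinset
  have hC : C.card = 196560 := by
    rw [← ncard_minimalVectors, Set.ncard_eq_toFinset_card _ finite_minimalVectors]
  have hFC : J.biUnion F ⊆ C := by
    intro x hx
    obtain ⟨j, hj, hxj⟩ := Finset.mem_biUnion.1 hx
    exact finite_minimalVectors.mem_toFinset.2 ((hT j hj).1 ((hF j hj x).1 hxj))
  -- The index set: minimal vectors outside all T j, which are kept, and pairs (x, y) with x in some
  -- T j.
  let s : Finset (EuclideanSpace ℝ (Fin 24) ⊕
      (_ : ℕ) × (EuclideanSpace ℝ (Fin 24) × EuclideanSpace ℝ (Fin d))) :=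
    (C \ J.biUnion F).disjSum (J.sigma fun j => F j ×ˢ Y j)
  let p : EuclideanSpace ℝ (Fin 24) ⊕
      (_ : ℕ) × (EuclideanSpace ℝ (Fin 24) × EuclideanSpace ℝ (Fin d)) →
      EuclideanSpace ℝ (Fin (24 + d)) :=
    Sum.elim (fun x => joinVector x 0) fun q => joinVector (α q.1 • q.2.1) (β q.1 • q.2.2)
  have hs : s.card = 196560 + ∑ j ∈ J, (T j).ncard * (Y j).card - ∑ j ∈ J, (T j).ncard := by
    rw [Finset.card_disjSum, Finset.card_sdiff_of_subset hFC, hC, Finset.card_sigma,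
      Finset.card_biUnion fun i hi j hj hij => hFdisj i hi j hj hij,
      Finset.sum_congr rfl fun j hj => hFcard j hj]
    have h1 : ∑ j ∈ J, (T j).ncard ≤ 196560 := by
      rw [← hC, ← Finset.sum_congr rfl fun j hj => hFcard j hj,
        ← Finset.card_biUnion fun i hi j hj hij => hFdisj i hi j hj hij]
      exact Finset.card_le_card hFC
    have h2 : ∑ j ∈ J, (F j ×ˢ Y j).card = ∑ j ∈ J, (T j).ncard * (Y j).card :=
      Finset.sum_congr rfl fun j hj => by rw [Finset.card_product, hFcard j hj]
    rw [h2]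
    omega
  rw [← hs]
  have hself : ∀ x ∈ minimalVectors, inner ℝ x x = (4 : ℝ) := by
    intro x hx
    rw [real_inner_self_eq_norm_sq, norm_of_mem_minimalVectors hx]
    norm_num
  have hmem1 : ∀ x, Sum.inl x ∈ s → x ∈ minimalVectors ∧ ∀ j ∈ J, x ∉ T j := by
    intro x hx
    simp only [s, Finset.inl_mem_disjSum, Finset.mem_sdiff, Finset.mem_biUnion, not_exists,
      not_and] at hx
    exact ⟨finite_minimalVectors.mem_toFinset.1 hx.1, fun j hj h => hx.2 j hj ((hF j hj x).2 h)⟩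
  have hmem2 : ∀ j x y, Sum.inr ⟨j, x, y⟩ ∈ s → j ∈ J ∧ x ∈ T j ∧ y ∈ Y j := by
    intro j x y h
    simp only [s, Finset.inr_mem_disjSum, Finset.mem_sigma, Finset.mem_product] at h
    exact ⟨h.1, (hF j h.1 x).1 h.2.1, h.2.2⟩
  have hmixed : ∀ x, Sum.inl x ∈ s → ∀ j x' y, Sum.inr ⟨j, x', y⟩ ∈ s →
      inner ℝ (joinVector x (0 : EuclideanSpace ℝ (Fin d))) (joinVector (α j • x') (β j • y)) ≤
        2 := by
    intro x hx j x' y h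
    obtain ⟨h1, h2⟩ := hmem1 x hx
    obtain ⟨hj, hx', hy⟩ := hmem2 j x' y h
    rw [inner_joinVector, inner_zero_left, add_zero, real_inner_smul_right]
    have hne : x ≠ x' := by rintro rfl; exact h2 j hj hx'
    have := inner_le_two h1 ((hT j hj).1 hx') hne
    nlinarith [hα j hj]
  refine card_le_kissingNumber s p ?_ ?_
  · rintro (x | ⟨j, x, y⟩) h
    · refine norm_eq_two_of_inner ?_
      simp only [p, Sum.elim_inl]
      rw [inner_joinVector, inner_zero_left, add_zero, hself x (hmem1 x h).1]
    · obtain ⟨hj, hx, hy⟩ := hmem2 j x y h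
      refine norm_eq_two_of_inner ?_
      simp only [p, Sum.elim_inr]
      rw [inner_joinVector, real_inner_smul_left, real_inner_smul_right, real_inner_smul_left,
        real_inner_smul_right, hself x ((hT j hj).1 hx), real_inner_self_eq_norm_sq, hY j hj y hy]
      linarith [hnorm j hj]
  · rintro (x | ⟨i, x, y⟩) h (x' | ⟨j, x', y'⟩) h' hne
    · simp only [p, Sum.elim_inl]
      rw [inner_joinVector, inner_zero_left, add_zero]
      exact inner_le_two (hmem1 x h).1 (hmem1 x' h').1 fun h => hne (by rw [h])
    · exact hmixed x h j x' y' h'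
    · rw [real_inner_comm]
      exact hmixed x' h' i x y h
    · obtain ⟨hi, hx, hy⟩ := hmem2 i x y h
      obtain ⟨hj, hx', hy'⟩ := hmem2 j x' y' h'
      simp only [p, Sum.elim_inr]
      rw [inner_joinVector, real_inner_smul_left, real_inner_smul_right, real_inner_smul_left,
        real_inner_smul_right, ← mul_assoc, ← mul_assoc]
      have hαi := hα i hi
      have hαj := hα j hj
      have hβi := hβ i hi
      have hβj := hβ j hj
      -- Within one T j, pairs with different y rely on `hρ`, whether or not x changes, and pairs
      -- with equal y on admissibility and `hle`. For different T j, the inner product 2 of minimal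
      -- vectors and the bound 1/2 for directions enter `hαβ`.
      by_cases hij : i = j
      · subst hij
        have h1 := hle i hi
        have h2 := hρ i hi
        by_cases hxx : x = x'
        · subst hxx
          have hyy : y ≠ y' := by rintro rfl; exact hne rfl
          rw [hself x ((hT i hi).1 hx)]
          have := mul_le_mul_of_nonneg_left (hsame i hi y hy y' hy' hyy) (mul_nonneg hβi hβi)
          nlinarith
        · have h3 := mul_le_mul_of_nonneg_left ((hT i hi).2 x hx x' hx' hxx)
            (mul_nonneg hαi.1 hαi.1)
          by_cases hyy : y = y'
          · subst hyy
            rw [real_inner_self_eq_norm_sq, hY i hi y hy]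
            nlinarith
          · have := mul_le_mul_of_nonneg_left (hsame i hi y hy y' hy' hyy) (mul_nonneg hβi hβi)
            nlinarith
      · have hxx : x ≠ x' := by
          rintro rfl
          exact Set.disjoint_left.1 (hdisj i hi j hj hij) hx hx'
        have h1 := mul_le_mul_of_nonneg_left (inner_le_two ((hT i hi).1 hx) ((hT j hj).1 hx') hxx)
          (mul_nonneg hαi.1 hαj.1)
        have h2 := mul_le_mul_of_nonneg_left (hcross i hi j hj hij y hy y' hy')
          (mul_nonneg hβi hβj)
        have := hαβ i hi j hj
        linarith

/-! ### Directions with integral coordinates in an orthogonal basis -/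

/-- The inner product of integer vectors in an orthogonal basis of vectors of norms `w`. -/
def weightedDot : List ℤ → List ℤ → List ℤ → ℤ
  | a :: w, b :: l, c :: l' => a * b * c + weightedDot w l l'
  | _, _, _ => 0

theorem sum_eq_weightedDot (w l l' : List ℤ) :
    ∑ i : Fin w.length, w.getD i 0 * l.getD i 0 * l'.getD i 0 = weightedDot w l l' := by
  induction w generalizing l l' with
  | nil => simp [weightedDot]
  | cons a w ih =>
    have hsucc : ∑ i : Fin (a :: w).length, (a :: w).getD i 0 * l.getD i 0 * l'.getD i 0 =
        a * l.getD 0 0 * l'.getD 0 0 +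
          ∑ i : Fin w.length, w.getD i 0 * l.getD (i + 1) 0 * l'.getD (i + 1) 0 := by
      exact Fin.sum_univ_succ (n := w.length)
        fun i => (a :: w).getD i 0 * l.getD i 0 * l'.getD i 0
    rw [hsucc]
    cases l with
    | nil => simp [weightedDot]
    | cons b l =>
      cases l' with
      | nil => simp [weightedDot]
      | cons c l' =>
        simp only [weightedDot, ← ih]
        simp

/-- The vector with coordinates `l` in an orthogonal basis of vectors of norms `w / N`. -/
def weightedVector (w : List ℤ) (N : ℤ) (l : List ℤ) : EuclideanSpace ℝ (Fin w.length) :=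
  WithLp.toLp 2 fun i => √(w.getD i 0 : ℝ) * (l.getD i 0 : ℝ) / √(N : ℝ)

theorem inner_weightedVector {w : List ℤ} (hw : ∀ a ∈ w, 0 ≤ a) {N : ℤ} (hN : 0 < N)
    (l l' : List ℤ) : inner ℝ (weightedVector w N l) (weightedVector w N l') =
      (weightedDot w l l' : ℝ) / N := by
  have hN' : √(N : ℝ) * √(N : ℝ) = N := Real.mul_self_sqrt (by exact_mod_cast hN.le)
  rw [← sum_eq_weightedDot, PiLp.inner_apply]
  push_cast
  rw [Finset.sum_div]
  refine Finset.sum_congr rfl fun i _ => ?_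
  have hi : √(w.getD i 0 : ℝ) * √(w.getD i 0 : ℝ) = w.getD i 0 := by
    refine Real.mul_self_sqrt ?_
    have : 0 ≤ w.getD i 0 := by
      rw [List.getD_eq_getElem _ _ i.2]
      exact hw _ (List.getElem_mem _)
    exact_mod_cast this
  simp only [weightedVector, RCLike.inner_apply, conj_trivial]
  rw [div_mul_div_comm, hN', mul_mul_mul_comm, hi]
  ring

/-- A list of triangles and a list of antipodal pairs of vectors, all of norm `N`, such that
distinct triangles or pairs are at angles at least `π / 3`. -/
def AreDirections (w : List ℤ) (N : ℤ) (tri prs : List (List (List ℤ))) : Prop :=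
  (∀ L ∈ tri ++ prs, ∀ y ∈ L, weightedDot w y y = N) ∧
  (tri ++ prs).Pairwise (fun L L' => ∀ y ∈ L, ∀ y' ∈ L', 2 * weightedDot w y y' ≤ N) ∧
  (∀ L ∈ tri, L.length = 3 ∧ L.Pairwise fun y y' => 2 * weightedDot w y y' ≤ -N) ∧
  ∀ L ∈ prs, L.length = 2 ∧ L.Pairwise fun y y' => weightedDot w y y' ≤ -N

instance (w : List ℤ) (N : ℤ) (tri prs : List (List (List ℤ))) :
    Decidable (AreDirections w N tri prs) := by
  unfold AreDirections
  infer_instance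

theorem weightedDot_comm (w l l' : List ℤ) : weightedDot w l l' = weightedDot w l' l := by
  rw [← sum_eq_weightedDot, ← sum_eq_weightedDot]
  exact Finset.sum_congr rfl fun i _ => by ring

/-- The first sets are matched with triangles, the remaining ones with antipodal pairs. A triangle
replaces x by three vectors and a pair by two, so the gains are twice and once the size of the set.
-/
theorem le_kissingNumber_of_areDirections {w : List ℤ} (hw : ∀ a ∈ w, 0 ≤ a) {N : ℤ} (hN : 0 < N)
    {tri prs : List (List (List ℤ))} (h : AreDirections w N tri prs)
    (T : ℕ → Set (EuclideanSpace ℝ (Fin 24)))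
    (hT : ∀ j ∈ Finset.Icc 1 (tri.length + prs.length), IsAdmissible (T j))
    (hdisj : ∀ i ∈ Finset.Icc 1 (tri.length + prs.length),
      ∀ j ∈ Finset.Icc 1 (tri.length + prs.length), i ≠ j → Disjoint (T i) (T j)) :
    ((196560 + 2 * ∑ j ∈ Finset.Icc 1 tri.length, (T j).ncard +
      ∑ j ∈ Finset.Icc (tri.length + 1) (tri.length + prs.length), (T j).ncard : ℕ) : ℕ∞) ≤
      kissingNumber (24 + w.length) := by
  classical
  obtain ⟨h1, h2, h3, h4⟩ := h
  set a := tri.length with ha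
  set b := prs.length with hb
  let L : ℕ → List (List ℤ) := fun j => (tri ++ prs).getD (j - 1) []
  let Y : ℕ → Finset (EuclideanSpace ℝ (Fin w.length)) := fun j =>
    ((L j).map (weightedVector w N)).toFinset
  have hlen : (tri ++ prs).length = a + b := List.length_append
  have hNR : (0 : ℝ) < N := by exact_mod_cast hN
  have hLget : ∀ j (hj : j ∈ Finset.Icc 1 (a + b)),
      L j = (tri ++ prs)[j - 1]'(by rw [Finset.mem_Icc] at hj; omega) := by
    intro j hj
    exact List.getD_eq_getElem _ _ _
  have hLmem : ∀ j ∈ Finset.Icc 1 (a + b), L j ∈ tri ++ prs := by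
    intro j hj
    rw [hLget j hj]
    exact List.getElem_mem _
  have hLtri : ∀ j ∈ Finset.Icc 1 (a + b), j ≤ a → L j ∈ tri := by
    intro j hj hja
    have hj' := Finset.mem_Icc.1 hj
    rw [hLget j hj, List.getElem_append_left (by omega)]
    exact List.getElem_mem _
  have hLprs : ∀ j ∈ Finset.Icc 1 (a + b), ¬ j ≤ a → L j ∈ prs := by
    intro j hj hja
    have hj' := Finset.mem_Icc.1 hj
    rw [hLget j hj, List.getElem_append_right (by omega)]
    exact List.getElem_mem _
  have hYmem : ∀ j y, y ∈ Y j ↔ ∃ l ∈ L j, weightedVector w N l = y := by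
    intro j y
    simp [Y]
  have hinner := fun l l' => inner_weightedVector hw hN l l'
  have hunit : ∀ j ∈ Finset.Icc 1 (a + b), ∀ y ∈ Y j, ‖y‖ = 1 := by
    intro j hj y hy
    obtain ⟨l, hl, rfl⟩ := (hYmem j y).1 hy
    have := hinner l l
    rw [h1 _ (hLmem j hj) l hl, div_self hNR.ne', real_inner_self_eq_norm_sq] at this
    nlinarith [norm_nonneg (weightedVector w N l)]
  have hpair : ∀ (r : ℤ) (K : List (List ℤ)),
      (K.Pairwise fun y y' => r * weightedDot w y y' ≤ -N) →
      ∀ l ∈ K, ∀ l' ∈ K, l ≠ l' → r * weightedDot w l l' ≤ -N := by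
    intro r K hK l hl l' hl' hne
    have hsymm : Std.Symm fun y y' => r * weightedDot w y y' ≤ -N :=
      ⟨fun y y' h => by rw [weightedDot_comm]; exact h⟩
    exact hK.forall hl hl' hne
  have hcardY : ∀ j ∈ Finset.Icc 1 (a + b), (Y j).card = if j ≤ a then 3 else 2 := by
    intro j hj
    -- Equal images would have product N, which contradicts r · N ≤ -N; r = 2 serves for triangles
    -- and r = 1 for pairs.
    have hnodup : ∀ (r : ℤ), 0 < r → (L j).Pairwise (fun y y' => r * weightedDot w y y' ≤ -N) →
        ((L j).map (weightedVector w N)).Nodup := by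
      intro r hr hK
      rw [List.Nodup, List.pairwise_map]
      refine hK.imp_of_mem fun {y y'} hy hy' hle heq => ?_
      have e1 := hinner y y
      have e2 := hinner y y'
      rw [← heq, e1, h1 _ (hLmem j hj) y hy, div_self hNR.ne', eq_div_iff hNR.ne', one_mul] at e2
      have e3 : N = weightedDot w y y' := by exact_mod_cast e2
      rw [← e3] at hle
      nlinarith
    by_cases hja : j ≤ a
    · obtain ⟨hl, hp⟩ := h3 _ (hLtri j hj hja)
      rw [if_pos hja, List.toFinset_card_of_nodup (hnodup 2 (by norm_num) hp), List.length_map, hl]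
    · obtain ⟨hl, hp⟩ := h4 _ (hLprs j hj hja)
      rw [if_neg hja, List.toFinset_card_of_nodup (hnodup 1 (by norm_num) (by simpa using hp)),
        List.length_map, hl]
  have hs1 : √(2 / 3 : ℝ) ^ 2 = 2 / 3 := Real.sq_sqrt (by norm_num)
  have hs2 : √(3 / 4 : ℝ) ^ 2 = 3 / 4 := Real.sq_sqrt (by norm_num)
  have hs3 : √(4 / 3 : ℝ) ^ 2 = 4 / 3 := Real.sq_sqrt (by norm_num)
  have hn1 := Real.sqrt_nonneg (2 / 3 : ℝ)
  have hn2 := Real.sqrt_nonneg (3 / 4 : ℝ)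
  have hn3 := Real.sqrt_nonneg (4 / 3 : ℝ)
  -- Decimal bounds are needed only for a triangle against a pair, where the inner product is at
  -- most √2 + 1/√3 < 2. All other bounds reduce to squares of α and β.
  have hu1 : √(2 / 3 : ℝ) ≤ 0.8167 := Real.sqrt_le_iff.2 (by norm_num)
  have hu2 : √(3 / 4 : ℝ) ≤ 0.8661 := Real.sqrt_le_iff.2 (by norm_num)
  have hu3 : √(4 / 3 : ℝ) ≤ 1.155 := Real.sqrt_le_iff.2 (by norm_num)
  have hu12 : √(2 / 3 : ℝ) * √(3 / 4 : ℝ) ≤ 0.8167 * 0.8661 :=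
    mul_le_mul hu1 hu2 hn2 (by norm_num)
  have key := card_add_sum_le_kissingNumber (Finset.Icc 1 (a + b)) T Y
    (fun j => if j ≤ a then √(2 / 3) else √(3 / 4)) (fun j => if j ≤ a then √(4 / 3) else 1)
    (fun j => if j ≤ a then -1 / 2 else -1) hT hdisj hunit ?_ ?_ ?_ ?_ ?_ ?_ ?_ ?_
  · refine le_trans ?_ key
    rw [Nat.cast_le]
    have hsplit : ∀ f : ℕ → ℕ, ∑ j ∈ Finset.Icc 1 (a + b), f j =
        ∑ j ∈ Finset.Icc 1 a, f j + ∑ j ∈ Finset.Icc (a + 1) (a + b), f j := by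
      intro f
      rw [← Finset.sum_union]
      · congr 1
        ext j
        simp only [Finset.mem_Icc, Finset.mem_union]
        omega
      · rw [Finset.disjoint_left]
        intro j hj hj'
        rw [Finset.mem_Icc] at hj hj'
        omega
    have hA : ∑ j ∈ Finset.Icc 1 a, (T j).ncard * (Y j).card =
        (∑ j ∈ Finset.Icc 1 a, (T j).ncard) * 3 := by
      rw [Finset.sum_mul]
      refine Finset.sum_congr rfl fun j hj => ?_
      have hj' := Finset.mem_Icc.1 hj
      rw [hcardY j (Finset.mem_Icc.2 ⟨hj'.1, by omega⟩), if_pos hj'.2]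
    have hB : ∑ j ∈ Finset.Icc (a + 1) (a + b), (T j).ncard * (Y j).card =
        (∑ j ∈ Finset.Icc (a + 1) (a + b), (T j).ncard) * 2 := by
      rw [Finset.sum_mul]
      refine Finset.sum_congr rfl fun j hj => ?_
      have hj' := Finset.mem_Icc.1 hj
      rw [hcardY j (Finset.mem_Icc.2 ⟨by omega, hj'.2⟩), if_neg (by omega)]
    rw [hsplit, hsplit, hA, hB]
    omega
  · intro j hj y hy y' hy' hne
    obtain ⟨l, hl, rfl⟩ := (hYmem j y).1 hy
    obtain ⟨l', hl', rfl⟩ := (hYmem j y').1 hy'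
    have hll : l ≠ l' := fun h => hne (by rw [h])
    rw [hinner, div_le_iff₀ hNR]
    by_cases hja : j ≤ a
    · have := hpair 2 _ (h3 _ (hLtri j hj hja)).2 l hl l' hl' hll
      have h' : 2 * (weightedDot w l l' : ℝ) ≤ -N := by exact_mod_cast this
      simp only [hja, if_true]
      linarith
    · have := hpair 1 _ (by simpa using (h4 _ (hLprs j hj hja)).2) l hl l' hl' hll
      have h' : 1 * (weightedDot w l l' : ℝ) ≤ -N := by exact_mod_cast this
      simp only [hja, if_false]
      linarith
  · have hlt : ∀ i ∈ Finset.Icc 1 (a + b), ∀ j ∈ Finset.Icc 1 (a + b), i < j → ∀ y ∈ Y i,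
        ∀ y' ∈ Y j, inner ℝ y y' ≤ (1 / 2 : ℝ) := by
      intro i hi j hj hij y hy y' hy'
      obtain ⟨l, hl, rfl⟩ := (hYmem i y).1 hy
      obtain ⟨l', hl', rfl⟩ := (hYmem j y').1 hy'
      rw [hLget i hi] at hl
      rw [hLget j hj] at hl'
      have := List.pairwise_iff_getElem.1 h2 (i - 1) (j - 1) _ _
        (by have := Finset.mem_Icc.1 hi; omega) l hl l' hl'
      have h' : 2 * (weightedDot w l l' : ℝ) ≤ N := by exact_mod_cast this
      rw [hinner, div_le_iff₀ hNR]
      linarith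
    intro i hi j hj hij y hy y' hy'
    rcases lt_or_gt_of_ne hij with h | h
    · exact hlt i hi j hj h y hy y' hy'
    · rw [real_inner_comm]
      exact hlt j hj i hi h y' hy' y hy
  · intro j _
    split_ifs
    · exact ⟨hn1, by linarith⟩
    · exact ⟨hn2, by linarith⟩
  · intro j _
    split_ifs
    · exact hn3
    · norm_num
  · intro j _
    split_ifs
    · rw [hs1, hs3]; norm_num
    · rw [hs2]; norm_num
  · intro j _
    split_ifs
    · rw [hs1, hs3]; norm_num
    · rw [hs2]; norm_num
  · intro j _
    split_ifs
    · rw [hs1, hs3]; norm_num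
    · rw [hs2]; norm_num
  · intro i _ j _
    split_ifs
    · nlinarith
    · linarith
    · rw [mul_comm √(3 / 4 : ℝ)]; linarith
    · nlinarith

/-! ### Root systems as unions of triangles and antipodal pairs -/

/-- The coordinates of the cube roots of unity in the basis `1 / 2`, `√-3 / 2`. -/
def cubeRoots : List (List ℤ) := [[2, 0], [-1, 1], [-1, -1]]

/-- The multiples of a complex vector by the cube roots of unity, in the coordinates of
`cubeRoots`. -/
def triangle (l : List ℤ) : List (List ℤ) :=
  let rec rotate : List ℤ → List ℤ
    -- Multiplication of (a + b√-3)/2 by (-1 + √-3)/2. The divisions are exact, since a and b have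
    -- the same parity in all vectors used.
    | a :: b :: l => (-a - 3 * b) / 2 :: (a - b) / 2 :: rotate l
    | l => l
  [l, rotate l, rotate (rotate l)]

/-- The triangle of a vector, and its negative. -/
def hexagon (l : List ℤ) : List (List (List ℤ)) := [triangle l, triangle (l.map (-·))]

/-- A vector and its negative. -/
def antipodes (l : List ℤ) : List (List ℤ) := [l, l.map (-·)]

/-- Eight triangles that make up the root system `D₄`. -/
def trianglesD4 : List (List (List ℤ)) :=
  [[[-1, -1, 0, 0], [1, 0, 1, 0], [0, 1, -1, 0]], [[1, 1, 0, 0], [-1, 0, -1, 0], [0, -1, 1, 0]],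
    [[1, -1, 0, 0], [-1, 0, 0, -1], [0, 1, 0, 1]], [[1, 0, -1, 0], [-1, 0, 0, 1], [0, 0, 1, -1]],
    [[-1, 0, 1, 0], [1, 0, 0, 1], [0, 0, -1, -1]], [[-1, 1, 0, 0], [1, 0, 0, -1], [0, -1, 0, 1]],
    [[0, -1, -1, 0], [0, 1, 0, -1], [0, 0, 1, 1]], [[0, 1, 1, 0], [0, -1, 0, -1], [0, 0, -1, 1]]]

/-- The pairs of roots of `D₅` outside `D₄`. -/
def pairsD5 : List (List (List ℤ)) :=
  [antipodes [1, 0, 0, 0, 1], antipodes [1, 0, 0, 0, -1], antipodes [0, 1, 0, 0, 1],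
    antipodes [0, 1, 0, 0, -1], antipodes [0, 0, 1, 0, 1], antipodes [0, 0, 1, 0, -1],
    antipodes [0, 0, 0, 1, 1], antipodes [0, 0, 0, 1, -1]]

/-- Twelve hexagons that make up the root system `E₆`. -/
def trianglesE6 : List (List (List ℤ)) :=
  hexagon [0, 2, 0, 0, 0, 0] ++ hexagon [0, 0, 0, 2, 0, 0] ++ hexagon [0, 0, 0, 0, 0, 2] ++
    (cubeRoots.flatMap fun u => cubeRoots.flatMap fun v => hexagon ([2, 0] ++ u ++ v))

/-- The pairs of roots of `E₇` outside `E₆`. -/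
def pairsE7 : List (List (List ℤ)) :=
  cubeRoots.flatMap fun u => cubeRoots.flatMap fun v =>
    [antipodes (u ++ v.map (-·) ++ [0, 0, 2]), antipodes ([0, 0] ++ u ++ v.map (-·) ++ [2]),
      antipodes (v.map (-·) ++ [0, 0] ++ u ++ [2])]

theorem areDirections_A1 : AreDirections [1] 1 [] [antipodes [1]] := by
  decide +kernel

theorem areDirections_A2 : AreDirections [1, 3] 4 (hexagon [2, 0]) [] := by
  decide +kernel

/-- The six roots with coordinate sum 0 form a hexagon, hence two triangles; the other six are three
antipodal pairs. -/
theorem areDirections_A3 : AreDirections [1, 1, 1] 2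
    [[[1, -1, 0], [0, 1, -1], [-1, 0, 1]], [[-1, 1, 0], [0, -1, 1], [1, 0, -1]]]
    [antipodes [1, 1, 0], antipodes [1, 0, 1], antipodes [0, 1, 1]] := by
  decide +kernel

theorem areDirections_D4 : AreDirections [1, 1, 1, 1] 2 trianglesD4 [] := by
  decide +kernel

theorem areDirections_D5 :
    AreDirections [1, 1, 1, 1, 1] 2 (trianglesD4.map (·.map (· ++ [0]))) pairsD5 := by
  decide +kernel

theorem areDirections_E6 : AreDirections [1, 3, 1, 3, 1, 3] 12 trianglesE6 [] := by
  decide +kernel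

theorem areDirections_E7 : AreDirections [1, 3, 1, 3, 1, 3, 1] 12
    (trianglesE6.map (·.map (· ++ [0]))) pairsE7 := by
  decide +kernel

/-- Disjoint admissible sets give kissing configurations in dimensions `25` to `31`. -/
theorem tableSum_le_kissingNumber {T : ℕ → Set (EuclideanSpace ℝ (Fin 24))}
    (hT : ∀ j ∈ Finset.Icc 1 51, IsAdmissible (T j))
    (hdisj : ∀ i ∈ Finset.Icc 1 51, ∀ j ∈ Finset.Icc 1 51, i ≠ j → Disjoint (T i) (T j))
    {n : ℕ} (hn : n ∈ Finset.Icc 25 31) :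
    (tableSum n (fun j => (T j).ncard) : ℕ∞) ≤ kissingNumber n := by
  -- The numbers of triangles and pairs are passed as separate variables, so that the ranges of
  -- summation become the numerals of `tableSum`. A range such as 9 to 8 is empty.
  have key : ∀ (w : List ℤ) (N : ℤ) (tri prs : List (List (List ℤ))), (∀ a ∈ w, 0 ≤ a) → 0 < N →
      AreDirections w N tri prs → ∀ a c e n : ℕ, tri.length = a → a + 1 = c →
      a + prs.length = e → 24 + w.length = n → e ≤ 51 →
      ((196560 + 2 * ∑ j ∈ Finset.Icc 1 a, (T j).ncard +
        ∑ j ∈ Finset.Icc c e, (T j).ncard : ℕ) : ℕ∞) ≤ kissingNumber n := by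
    rintro w N tri prs hw hN h _ _ _ _ rfl rfl rfl rfl hle
    have hsub : Finset.Icc 1 (tri.length + prs.length) ⊆ Finset.Icc 1 51 :=
      Finset.Icc_subset_Icc_right hle
    exact le_kissingNumber_of_areDirections hw hN h T (fun j hj => hT j (hsub hj))
      fun i hi j hj => hdisj i (hsub hi) j (hsub hj)
  have h12 : ∑ j ∈ Finset.Icc 1 2, (T j).ncard = (T 1).ncard + (T 2).ncard := by
    rw [show Finset.Icc 1 2 = {1, 2} from rfl, Finset.sum_pair (by norm_num)]
  obtain ⟨h1, h2⟩ := Finset.mem_Icc.1 hn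
  interval_cases n
  · refine le_trans (Nat.cast_le.2 ?_) (key _ _ _ _ (by decide) (by decide) areDirections_A1
      0 1 1 25 rfl rfl rfl rfl (by norm_num))
    simp only [tableSum]
    simp
  · refine le_trans (Nat.cast_le.2 ?_) (key _ _ _ _ (by decide) (by decide) areDirections_A2
      2 3 2 26 rfl rfl rfl rfl (by norm_num))
    simp only [tableSum, h12]
    omega
  · refine le_trans (Nat.cast_le.2 ?_) (key _ _ _ _ (by decide) (by decide) areDirections_A3
      2 3 5 27 rfl rfl rfl rfl (by norm_num))
    simp only [tableSum, h12]
    omega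
  · refine le_trans (Nat.cast_le.2 ?_) (key _ _ _ _ (by decide) (by decide) areDirections_D4
      8 9 8 28 rfl rfl rfl rfl (by norm_num))
    simp only [tableSum]
    exact Nat.le_add_right _ _
  · exact key _ _ _ _ (by decide) (by decide) areDirections_D5 8 9 16 29 rfl rfl rfl rfl
      (by norm_num)
  · refine le_trans (Nat.cast_le.2 ?_) (key _ _ _ _ (by decide) (by decide) areDirections_E6
      24 25 24 30 rfl rfl rfl rfl (by norm_num))
    simp only [tableSum]
    exact Nat.le_add_right _ _
  · exact key _ _ _ _ (by decide) (by decide) areDirections_E7 24 25 51 31 rfl rfl rfl rfl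
      (by norm_num)

/-! ### An antipodal admissible set with `488` elements -/

/-- Representatives of `244` pairs of opposite minimal vectors: the vector with digits `a` is
`(2 a - 4) / √8`. -/
def digitTable : List (List ℕ) := [
  [2,2,2,2,2,2,2,2,2,2,2,2,2,2,2,2,2,4,2,2,2,0,2,2],
  [2,2,2,2,2,2,2,2,2,2,2,2,2,2,2,2,2,4,2,2,2,4,2,2],
  [2,2,2,2,2,2,2,2,2,2,2,2,2,2,2,2,4,2,2,2,2,2,0,2],
  [2,2,2,2,2,2,2,2,2,2,2,2,2,2,2,2,4,2,2,2,2,2,4,2],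
  [2,2,2,2,2,2,2,2,2,2,2,2,2,4,2,2,2,2,2,0,2,2,2,2],
  [2,2,2,2,2,2,2,2,2,2,2,2,2,4,2,2,2,2,2,4,2,2,2,2],
  [2,2,2,2,2,2,2,2,2,2,4,2,2,2,2,0,2,2,2,2,2,2,2,2],
  [2,2,2,2,2,2,2,2,2,2,4,2,2,2,2,4,2,2,2,2,2,2,2,2],
  [2,2,2,2,2,2,2,2,2,4,2,2,2,2,2,2,2,2,0,2,2,2,2,2],
  [2,2,2,2,2,2,2,2,2,4,2,2,2,2,2,2,2,2,4,2,2,2,2,2],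
  [2,2,2,2,2,2,2,2,3,2,2,1,2,2,2,2,2,1,1,1,3,2,3,3],
  [2,2,2,2,2,2,2,2,3,2,2,1,2,2,2,2,2,1,3,3,3,2,1,1],
  [2,2,2,2,2,2,2,2,3,2,2,1,2,2,2,2,2,3,1,1,1,2,1,1],
  [2,2,2,2,2,2,2,2,3,2,2,1,2,2,2,2,2,3,3,3,1,2,3,3],
  [2,2,2,2,2,2,2,2,3,2,2,3,2,2,2,2,2,1,1,3,1,2,1,3],
  [2,2,2,2,2,2,2,2,3,2,2,3,2,2,2,2,2,1,3,1,1,2,3,1],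
  [2,2,2,2,2,2,2,2,3,2,2,3,2,2,2,2,2,3,1,3,3,2,3,1],
  [2,2,2,2,2,2,2,2,3,2,2,3,2,2,2,2,2,3,3,1,3,2,1,3],
  [2,2,2,2,2,2,2,3,1,2,2,1,1,2,1,3,2,2,2,2,2,2,3,3],
  [2,2,2,2,2,2,2,3,1,2,2,1,3,2,3,3,2,2,2,2,2,2,1,1],
  [2,2,2,2,2,2,2,3,1,2,2,3,1,2,3,1,2,2,2,2,2,2,1,3],
  [2,2,2,2,2,2,2,3,1,2,2,3,3,2,1,1,2,2,2,2,2,2,3,1],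
  [2,2,2,2,2,2,2,3,3,2,2,1,1,2,3,1,2,2,2,2,2,2,3,1],
  [2,2,2,2,2,2,2,3,3,2,2,1,3,2,1,1,2,2,2,2,2,2,1,3],
  [2,2,2,2,2,2,2,3,3,2,2,3,1,2,1,3,2,2,2,2,2,2,1,1],
  [2,2,2,2,2,2,2,3,3,2,2,3,3,2,3,3,2,2,2,2,2,2,3,3],
  [2,2,2,2,2,2,3,1,2,2,1,1,2,1,3,2,2,2,2,2,2,1,2,1],
  [2,2,2,2,2,2,3,1,2,2,1,1,2,3,1,2,2,2,2,2,2,3,2,3],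
  [2,2,2,2,2,2,3,1,2,2,3,3,2,1,1,2,2,2,2,2,2,3,2,1],
  [2,2,2,2,2,2,3,1,2,2,3,3,2,3,3,2,2,2,2,2,2,1,2,3],
  [2,2,2,2,2,2,3,3,2,2,1,3,2,3,3,2,2,2,2,2,2,3,2,1],
  [2,2,2,2,2,2,3,3,2,2,3,1,2,1,3,2,2,2,2,2,2,3,2,3],
  [2,2,2,2,2,2,4,2,0,2,2,2,2,2,2,2,2,2,2,2,2,2,2,2],
  [2,2,2,2,2,2,4,2,4,2,2,2,2,2,2,2,2,2,2,2,2,2,2,2],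
  [2,2,2,2,2,3,2,2,1,1,2,1,2,1,2,2,1,1,2,2,3,2,2,2],
  [2,2,2,2,2,3,2,2,1,1,2,3,2,3,2,2,3,1,2,2,1,2,2,2],
  [2,2,2,2,2,3,2,2,1,3,2,1,2,3,2,2,1,3,2,2,1,2,2,2],
  [2,2,2,2,2,3,2,2,1,3,2,3,2,1,2,2,3,3,2,2,3,2,2,2],
  [2,2,2,2,2,3,2,2,3,1,2,1,2,3,2,2,3,3,2,2,3,2,2,2],
  [2,2,2,2,2,3,2,2,3,1,2,3,2,1,2,2,1,3,2,2,1,2,2,2],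
  [2,2,2,2,2,3,2,2,3,3,2,1,2,1,2,2,3,1,2,2,1,2,2,2],
  [2,2,2,2,2,3,2,2,3,3,2,3,2,3,2,2,1,1,2,2,3,2,2,2],
  [2,2,2,2,2,4,2,2,2,2,2,2,2,2,2,2,2,2,2,2,2,2,2,0],
  [2,2,2,2,2,4,2,2,2,2,2,2,2,2,2,2,2,2,2,2,2,2,2,4],
  [2,2,2,2,3,1,2,2,2,2,2,2,1,2,1,2,1,2,3,1,2,1,2,2],
  [2,2,2,2,3,1,2,2,2,2,2,2,1,2,3,2,3,2,1,1,2,3,2,2],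
  [2,2,2,2,3,1,2,2,2,2,2,2,3,2,1,2,3,2,3,3,2,3,2,2],
  [2,2,2,2,3,1,2,2,2,2,2,2,3,2,3,2,1,2,1,3,2,1,2,2],
  [2,2,2,2,3,2,1,1,2,1,1,1,1,2,2,2,2,2,2,2,2,2,3,2],
  [2,2,2,2,3,2,1,1,2,3,3,3,1,2,2,2,2,2,2,2,2,2,1,2],
  [2,2,2,2,3,2,2,1,1,3,2,1,2,1,2,3,2,2,2,2,2,3,2,2],
  [2,2,2,2,3,2,2,1,3,1,2,3,2,3,2,3,2,2,2,2,2,3,2,2],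
  [2,2,2,2,3,2,2,3,1,1,2,1,2,3,2,1,2,2,2,2,2,3,2,2],
  [2,2,2,2,3,2,2,3,3,3,2,3,2,1,2,1,2,2,2,2,2,3,2,2],
  [2,2,2,2,3,2,3,3,2,1,3,3,1,2,2,2,2,2,2,2,2,2,3,2],
  [2,2,2,2,3,2,3,3,2,3,1,1,1,2,2,2,2,2,2,2,2,2,1,2],
  [2,2,2,2,3,3,2,2,2,2,2,2,1,2,1,2,3,2,1,3,2,1,2,2],
  [2,2,2,2,3,3,2,2,2,2,2,2,1,2,3,2,1,2,3,3,2,3,2,2],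
  [2,2,2,2,3,3,2,2,2,2,2,2,3,2,1,2,1,2,1,1,2,3,2,2],
  [2,2,2,2,3,3,2,2,2,2,2,2,3,2,3,2,3,2,3,1,2,1,2,2],
  [2,2,2,2,4,2,2,2,2,2,2,2,2,2,2,2,2,2,2,2,0,2,2,2],
  [2,2,2,2,4,2,2,2,2,2,2,2,2,2,2,2,2,2,2,2,4,2,2,2],
  [2,2,2,3,1,2,1,3,2,2,2,2,1,2,2,2,1,3,3,2,2,2,2,2],
  [2,2,2,3,1,2,3,1,2,2,2,2,1,2,2,2,3,3,1,2,2,2,2,2],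
  [2,2,2,3,2,1,2,2,1,2,1,2,2,3,2,2,2,2,3,2,1,2,3,2],
  [2,2,2,3,2,1,2,2,1,2,3,2,2,1,2,2,2,2,1,2,3,2,3,2],
  [2,2,2,3,2,1,2,2,3,2,1,2,2,3,2,2,2,2,1,2,3,2,1,2],
  [2,2,2,3,2,1,2,2,3,2,3,2,2,1,2,2,2,2,3,2,1,2,1,2],
  [2,2,2,3,2,2,2,2,1,1,1,2,2,2,2,2,3,2,2,1,3,2,2,3],
  [2,2,2,3,2,2,2,2,1,3,1,2,2,2,2,2,1,2,2,3,3,2,2,1],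
  [2,2,2,3,2,2,2,2,3,1,3,2,2,2,2,2,1,2,2,3,3,2,2,3],
  [2,2,2,3,2,2,2,2,3,3,3,2,2,2,2,2,3,2,2,1,3,2,2,1],
  [2,2,2,3,2,3,2,2,1,2,1,2,2,1,2,2,2,2,1,2,1,2,1,2],
  [2,2,2,3,2,3,2,2,1,2,3,2,2,3,2,2,2,2,3,2,3,2,1,2],
  [2,2,2,3,2,3,2,2,3,2,1,2,2,1,2,2,2,2,3,2,3,2,3,2],
  [2,2,2,3,2,3,2,2,3,2,3,2,2,3,2,2,2,2,1,2,1,2,3,2],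
  [2,2,2,3,3,2,1,3,2,2,2,2,3,2,2,2,3,3,1,2,2,2,2,2],
  [2,2,2,3,3,2,3,1,2,2,2,2,3,2,2,2,1,3,3,2,2,2,2,2],
  [2,2,2,4,2,2,2,2,2,2,2,2,2,2,0,2,2,2,2,2,2,2,2,2],
  [2,2,2,4,2,2,2,2,2,2,2,2,2,2,4,2,2,2,2,2,2,2,2,2],
  [2,2,3,1,2,2,2,2,1,2,2,2,2,1,2,2,1,3,1,2,2,2,2,1],
  [2,2,3,1,2,2,2,2,1,2,2,2,2,3,2,2,3,3,3,2,2,2,2,3],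
  [2,2,3,2,1,2,1,2,2,2,2,1,2,1,3,3,2,2,2,2,2,2,3,2],
  [2,2,3,2,1,2,1,2,2,2,2,3,2,1,1,1,2,2,2,2,2,2,1,2],
  [2,2,3,2,1,2,2,2,1,2,1,3,3,2,3,2,2,2,2,2,2,1,2,2],
  [2,2,3,2,1,2,2,2,1,2,3,1,3,2,1,2,2,2,2,2,2,3,2,2],
  [2,2,3,2,1,2,2,2,3,2,1,1,1,2,1,2,2,2,2,2,2,1,2,2],
  [2,2,3,2,1,2,2,2,3,2,3,3,1,2,3,2,2,2,2,2,2,3,2,2],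
  [2,2,3,2,1,2,3,2,2,2,2,1,2,3,3,1,2,2,2,2,2,2,1,2],
  [2,2,3,2,1,2,3,2,2,2,2,3,2,3,1,3,2,2,2,2,2,2,3,2],
  [2,2,3,2,2,2,1,2,2,1,2,1,3,2,2,1,2,2,2,2,2,1,2,1],
  [2,2,3,2,2,2,1,2,2,1,2,3,1,2,2,3,2,2,2,2,2,1,2,3],
  [2,2,3,2,2,2,1,2,2,3,2,1,1,2,2,1,2,2,2,2,2,3,2,3],
  [2,2,3,2,2,2,1,2,2,3,2,3,3,2,2,3,2,2,2,2,2,3,2,1],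
  [2,2,3,2,2,2,3,2,2,1,2,1,1,2,2,3,2,2,2,2,2,3,2,1],
  [2,2,3,2,2,2,3,2,2,1,2,3,3,2,2,1,2,2,2,2,2,3,2,3],
  [2,2,3,2,2,2,3,2,2,3,2,1,3,2,2,3,2,2,2,2,2,1,2,3],
  [2,2,3,2,2,2,3,2,2,3,2,3,1,2,2,1,2,2,2,2,2,1,2,1],
  [2,2,3,2,3,2,1,2,2,2,2,1,2,3,1,3,2,2,2,2,2,2,1,2],
  [2,2,3,2,3,2,1,2,2,2,2,3,2,3,3,1,2,2,2,2,2,2,3,2],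
  [2,2,3,2,3,2,2,2,1,2,1,3,1,2,1,2,2,2,2,2,2,3,2,2],
  [2,2,3,2,3,2,2,2,1,2,3,1,1,2,3,2,2,2,2,2,2,1,2,2],
  [2,2,3,2,3,2,2,2,3,2,1,1,3,2,3,2,2,2,2,2,2,3,2,2],
  [2,2,3,2,3,2,2,2,3,2,3,3,3,2,1,2,2,2,2,2,2,1,2,2],
  [2,2,3,2,3,2,3,2,2,2,2,1,2,1,1,1,2,2,2,2,2,2,3,2],
  [2,2,3,2,3,2,3,2,2,2,2,3,2,1,3,3,2,2,2,2,2,2,1,2],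
  [2,2,3,3,2,2,2,2,1,2,2,2,2,1,2,2,3,1,3,2,2,2,2,1],
  [2,2,3,3,2,2,2,2,1,2,2,2,2,3,2,2,1,1,1,2,2,2,2,3],
  [2,2,4,2,2,2,2,0,2,2,2,2,2,2,2,2,2,2,2,2,2,2,2,2],
  [2,2,4,2,2,2,2,4,2,2,2,2,2,2,2,2,2,2,2,2,2,2,2,2],
  [2,3,1,2,1,2,1,2,2,3,3,2,2,1,2,2,2,2,2,2,2,3,2,2],
  [2,3,1,2,1,2,2,2,1,1,2,2,3,2,2,1,2,2,2,2,2,2,1,2],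
  [2,3,1,2,1,2,2,2,3,1,2,2,1,2,2,3,2,2,2,2,2,2,3,2],
  [2,3,1,2,1,2,3,2,2,3,1,2,2,3,2,2,2,2,2,2,2,1,2,2],
  [2,3,1,2,2,2,1,2,2,2,1,2,1,2,1,2,2,2,2,2,2,2,1,3],
  [2,3,1,2,2,2,1,2,2,2,1,2,3,2,3,2,2,2,2,2,2,2,3,1],
  [2,3,1,2,2,2,2,2,1,2,2,2,2,1,3,3,2,2,2,2,2,1,2,3],
  [2,3,1,2,2,2,2,2,1,2,2,2,2,3,1,3,2,2,2,2,2,3,2,1],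
  [2,3,1,2,3,2,1,2,2,1,3,2,2,3,2,2,2,2,2,2,2,1,2,2],
  [2,3,1,2,3,2,2,2,1,3,2,2,1,2,2,1,2,2,2,2,2,2,3,2],
  [2,3,1,2,3,2,2,2,3,3,2,2,3,2,2,3,2,2,2,2,2,2,1,2],
  [2,3,1,2,3,2,3,2,2,1,1,2,2,1,2,2,2,2,2,2,2,3,2,2],
  [2,3,2,1,1,3,2,2,2,2,2,2,1,2,2,1,2,3,2,3,2,2,2,2],
  [2,3,2,1,1,3,2,2,2,2,2,2,3,2,2,3,2,1,2,1,2,2,2,2],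
  [2,3,2,1,2,2,2,3,2,2,2,2,1,2,2,2,1,2,2,1,3,3,2,2],
  [2,3,2,1,2,2,2,3,2,2,2,2,3,2,2,2,3,2,2,3,3,1,2,2],
  [2,3,2,1,3,1,2,2,2,2,2,2,1,2,2,3,2,1,2,3,2,2,2,2],
  [2,3,2,1,3,1,2,2,2,2,2,2,3,2,2,1,2,3,2,1,2,2,2,2],
  [2,3,2,2,1,2,2,1,1,2,1,2,2,1,1,2,2,2,2,2,2,2,3,2],
  [2,3,2,2,1,2,2,1,3,2,3,2,2,3,1,2,2,2,2,2,2,2,1,2],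
  [2,3,2,2,1,2,2,3,1,2,3,2,2,3,3,2,2,2,2,2,2,2,3,2],
  [2,3,2,2,1,2,2,3,3,2,1,2,2,1,3,2,2,2,2,2,2,2,1,2],
  [2,3,2,2,2,1,1,1,2,2,2,2,2,2,2,3,1,2,1,1,2,2,2,2],
  [2,3,2,2,2,1,3,2,2,2,2,2,1,2,3,2,1,3,2,2,1,2,2,2],
  [2,3,2,2,2,1,3,2,2,2,2,2,3,2,1,2,1,1,2,2,3,2,2,2],
  [2,3,2,2,2,1,3,3,2,2,2,2,2,2,2,3,3,2,3,1,2,2,2,2],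
  [2,3,2,2,2,2,2,1,1,1,3,2,1,2,2,2,2,2,2,2,2,3,2,3],
  [2,3,2,2,2,2,2,1,1,3,3,2,3,2,2,2,2,2,2,2,2,1,2,1],
  [2,3,2,2,2,2,2,1,3,1,1,2,3,2,2,2,2,2,2,2,2,1,2,3],
  [2,3,2,2,2,2,2,1,3,3,1,2,1,2,2,2,2,2,2,2,2,3,2,1],
  [2,3,2,2,2,2,2,3,1,1,1,2,1,2,2,2,2,2,2,2,2,1,2,1],
  [2,3,2,2,2,2,2,3,1,3,1,2,3,2,2,2,2,2,2,2,2,3,2,3],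
  [2,3,2,2,2,2,2,3,3,1,3,2,3,2,2,2,2,2,2,2,2,3,2,1],
  [2,3,2,2,2,2,2,3,3,3,3,2,1,2,2,2,2,2,2,2,2,1,2,3],
  [2,3,2,2,2,2,3,1,2,1,2,2,2,3,2,1,2,2,2,2,2,2,3,1],
  [2,3,2,2,2,2,3,1,2,3,2,2,2,1,2,1,2,2,2,2,2,2,1,3],
  [2,3,2,2,2,3,1,1,2,2,2,2,2,2,2,3,3,2,3,3,2,2,2,2],
  [2,3,2,2,2,3,3,2,2,2,2,2,1,2,3,2,3,1,2,2,3,2,2,2],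
  [2,3,2,2,2,3,3,2,2,2,2,2,3,2,1,2,3,3,2,2,1,2,2,2],
  [2,3,2,2,2,3,3,3,2,2,2,2,2,2,2,3,1,2,1,3,2,2,2,2],
  [2,3,2,2,3,2,2,1,1,2,1,2,2,3,3,2,2,2,2,2,2,2,1,2],
  [2,3,2,2,3,2,2,1,3,2,3,2,2,1,3,2,2,2,2,2,2,2,3,2],
  [2,3,2,2,3,2,2,3,1,2,3,2,2,1,1,2,2,2,2,2,2,2,1,2],
  [2,3,2,2,3,2,2,3,3,2,1,2,2,3,1,2,2,2,2,2,2,2,3,2],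
  [2,3,2,3,1,1,2,2,2,2,2,2,1,2,2,1,2,1,2,1,2,2,2,2],
  [2,3,2,3,1,1,2,2,2,2,2,2,3,2,2,3,2,3,2,3,2,2,2,2],
  [2,3,2,3,2,2,2,3,2,2,2,2,1,2,2,2,3,2,2,3,1,3,2,2],
  [2,3,2,3,2,2,2,3,2,2,2,2,3,2,2,2,1,2,2,1,1,1,2,2],
  [2,3,2,3,3,3,2,2,2,2,2,2,1,2,2,3,2,3,2,1,2,2,2,2],
  [2,3,2,3,3,3,2,2,2,2,2,2,3,2,2,1,2,1,2,3,2,2,2,2],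
  [2,3,3,2,1,2,1,2,2,1,1,2,2,3,2,2,2,2,2,2,2,3,2,2],
  [2,3,3,2,1,2,2,2,1,3,2,2,1,2,2,3,2,2,2,2,2,2,1,2],
  [2,3,3,2,1,2,2,2,3,3,2,2,3,2,2,1,2,2,2,2,2,2,3,2],
  [2,3,3,2,1,2,3,2,2,1,3,2,2,1,2,2,2,2,2,2,2,1,2,2],
  [2,3,3,2,2,2,1,2,2,2,3,2,1,2,1,2,2,2,2,2,2,2,3,1],
  [2,3,3,2,2,2,1,2,2,2,3,2,3,2,3,2,2,2,2,2,2,2,1,3],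
  [2,3,3,2,2,2,2,2,3,2,2,2,2,1,1,3,2,2,2,2,2,3,2,3],
  [2,3,3,2,2,2,2,2,3,2,2,2,2,3,3,3,2,2,2,2,2,1,2,1],
  [2,3,3,2,3,2,1,2,2,3,1,2,2,1,2,2,2,2,2,2,2,1,2,2],
  [2,3,3,2,3,2,2,2,1,1,2,2,3,2,2,3,2,2,2,2,2,2,3,2],
  [2,3,3,2,3,2,2,2,3,1,2,2,1,2,2,1,2,2,2,2,2,2,1,2],
  [2,3,3,2,3,2,3,2,2,3,3,2,2,3,2,2,2,2,2,2,2,3,2,2],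
  [2,4,2,2,2,2,2,2,2,2,2,0,2,2,2,2,2,2,2,2,2,2,2,2],
  [2,4,2,2,2,2,2,2,2,2,2,4,2,2,2,2,2,2,2,2,2,2,2,2],
  [3,1,2,1,2,2,1,1,2,2,2,2,2,2,2,3,2,1,2,2,1,2,2,2],
  [3,1,2,1,2,2,1,3,2,2,2,2,2,2,2,1,2,3,2,2,3,2,2,2],
  [3,1,2,2,2,1,2,2,2,2,2,2,2,2,1,3,2,2,2,3,3,1,2,2],
  [3,1,2,2,2,3,2,2,2,2,2,2,2,2,3,3,2,2,2,1,3,3,2,2],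
  [3,1,2,3,2,2,3,1,2,2,2,2,2,2,2,1,2,1,2,2,3,2,2,2],
  [3,1,2,3,2,2,3,3,2,2,2,2,2,2,2,3,2,3,2,2,1,2,2,2],
  [3,2,1,1,2,1,2,2,2,1,3,2,2,1,2,2,1,2,2,2,2,2,2,2],
  [3,2,1,1,2,2,2,2,2,2,1,2,2,2,2,2,2,2,1,3,2,2,1,1],
  [3,2,1,1,2,2,2,2,2,2,1,2,2,2,2,2,2,2,3,1,2,2,3,3],
  [3,2,1,1,2,3,2,2,2,3,3,2,2,3,2,2,3,2,2,2,2,2,2,2],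
  [3,2,1,2,2,1,2,2,2,2,2,3,2,3,2,2,2,1,1,2,2,2,3,2],
  [3,2,1,2,2,2,2,2,2,1,2,1,2,2,2,2,3,1,2,1,2,2,2,1],
  [3,2,1,2,2,2,2,2,2,1,2,3,2,2,2,2,3,3,2,3,2,2,2,3],
  [3,2,1,2,2,2,2,2,2,3,2,1,2,2,2,2,1,1,2,3,2,2,2,3],
  [3,2,1,2,2,2,2,2,2,3,2,3,2,2,2,2,1,3,2,1,2,2,2,1],
  [3,2,1,3,2,1,2,2,2,3,1,2,2,1,2,2,3,2,2,2,2,2,2,2],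
  [3,2,1,3,2,2,2,2,2,2,3,2,2,2,2,2,2,2,1,1,2,2,1,3],
  [3,2,1,3,2,2,2,2,2,2,3,2,2,2,2,2,2,2,3,3,2,2,3,1],
  [3,2,1,3,2,3,2,2,2,1,1,2,2,3,2,2,1,2,2,2,2,2,2,2],
  [3,2,2,1,1,2,2,1,2,2,2,2,2,2,2,1,2,2,1,1,2,3,2,2],
  [3,2,2,1,1,2,2,3,2,2,2,2,2,2,2,3,2,2,3,3,2,3,2,2],
  [3,2,2,1,2,2,2,2,2,1,2,2,2,3,2,2,2,1,2,2,3,2,1,3],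
  [3,2,2,1,2,2,2,2,2,3,2,2,2,1,2,2,2,1,2,2,3,2,3,1],
  [3,2,2,1,3,2,2,1,2,2,2,2,2,2,2,1,2,2,3,3,2,1,2,2],
  [3,2,2,1,3,2,2,3,2,2,2,2,2,2,2,3,2,2,1,1,2,1,2,2],
  [3,2,2,2,1,1,3,2,2,2,2,2,2,2,1,1,2,3,3,2,2,2,2,2],
  [3,2,2,2,1,3,1,2,2,2,2,2,2,2,1,3,2,3,1,2,2,2,2,2],
  [3,2,2,2,1,3,1,2,2,2,2,2,2,2,3,1,2,1,3,2,2,2,2,2],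
  [3,2,2,2,2,1,2,2,2,1,1,3,2,2,2,2,2,2,2,1,1,2,1,2],
  [3,2,2,2,2,1,2,2,2,3,3,1,2,2,2,2,2,2,2,1,1,2,3,2],
  [3,2,2,2,2,2,1,1,2,2,2,2,2,2,1,2,1,2,3,2,3,3,2,2],
  [3,2,2,2,2,2,1,1,2,2,2,2,2,2,3,2,3,2,1,2,3,1,2,2],
  [3,2,2,2,2,2,1,3,2,2,2,2,2,2,1,2,3,2,3,2,1,1,2,2],
  [3,2,2,2,2,2,1,3,2,2,2,2,2,2,3,2,1,2,1,2,1,3,2,2],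
  [3,2,2,2,2,2,2,2,2,2,1,3,2,1,2,2,1,2,1,2,3,2,2,3],
  [3,2,2,2,2,2,2,2,2,2,3,1,2,3,2,2,1,2,1,2,3,2,2,1],
  [3,2,2,2,2,2,3,1,2,2,2,2,2,2,1,2,1,2,1,2,1,1,2,2],
  [3,2,2,2,2,2,3,1,2,2,2,2,2,2,3,2,3,2,3,2,1,3,2,2],
  [3,2,2,2,2,2,3,3,2,2,2,2,2,2,1,2,3,2,1,2,3,3,2,2],
  [3,2,2,2,2,2,3,3,2,2,2,2,2,2,3,2,1,2,3,2,3,1,2,2],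
  [3,2,2,2,2,3,2,2,2,1,3,1,2,2,2,2,2,2,2,3,1,2,1,2],
  [3,2,2,2,2,3,2,2,2,3,1,3,2,2,2,2,2,2,2,3,1,2,3,2],
  [3,2,2,2,3,1,1,2,2,2,2,2,2,2,3,3,2,3,3,2,2,2,2,2],
  [3,2,2,2,3,3,3,2,2,2,2,2,2,2,1,3,2,1,3,2,2,2,2,2],
  [3,2,2,2,3,3,3,2,2,2,2,2,2,2,3,1,2,3,1,2,2,2,2,2],
  [3,2,2,3,2,2,2,2,2,1,2,2,2,1,2,2,2,1,2,2,1,2,3,3],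
  [3,2,2,3,2,2,2,2,2,1,2,2,2,1,2,2,2,3,2,2,3,2,1,1],
  [3,2,2,3,2,2,2,2,2,3,2,2,2,3,2,2,2,1,2,2,1,2,1,1],
  [3,2,2,3,2,2,2,2,2,3,2,2,2,3,2,2,2,3,2,2,3,2,3,3],
  [3,2,3,1,2,1,2,2,2,3,1,2,2,3,2,2,1,2,2,2,2,2,2,2],
  [3,2,3,1,2,2,2,2,2,2,3,2,2,2,2,2,2,2,1,3,2,2,3,3],
  [3,2,3,1,2,2,2,2,2,2,3,2,2,2,2,2,2,2,3,1,2,2,1,1],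
  [3,2,3,1,2,3,2,2,2,1,1,2,2,1,2,2,3,2,2,2,2,2,2,2],
  [3,2,3,2,2,1,2,2,2,2,2,1,2,1,2,2,2,1,1,2,2,2,1,2],
  [3,2,3,2,2,2,2,2,2,1,2,1,2,2,2,2,1,3,2,1,2,2,2,3],
  [3,2,3,2,2,2,2,2,2,1,2,3,2,2,2,2,1,1,2,3,2,2,2,1],
  [3,2,3,2,2,2,2,2,2,3,2,1,2,2,2,2,3,3,2,3,2,2,2,1],
  [3,2,3,2,2,2,2,2,2,3,2,3,2,2,2,2,3,1,2,1,2,2,2,3],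
  [3,2,3,3,2,1,2,2,2,1,3,2,2,3,2,2,3,2,2,2,2,2,2,2],
  [3,2,3,3,2,2,2,2,2,2,1,2,2,2,2,2,2,2,1,1,2,2,3,1],
  [3,2,3,3,2,2,2,2,2,2,1,2,2,2,2,2,2,2,3,3,2,2,1,3],
  [3,2,3,3,2,3,2,2,2,3,3,2,2,1,2,2,1,2,2,2,2,2,2,2],
  [3,3,2,1,2,2,3,1,2,2,2,2,2,2,2,3,2,3,2,2,3,2,2,2],
  [3,3,2,1,2,2,3,3,2,2,2,2,2,2,2,1,2,1,2,2,1,2,2,2],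
  [3,3,2,2,2,1,2,2,2,2,2,2,2,2,3,1,2,2,2,3,3,3,2,2],
  [3,3,2,2,2,3,2,2,2,2,2,2,2,2,1,1,2,2,2,1,3,1,2,2],
  [3,3,2,3,2,2,1,1,2,2,2,2,2,2,2,1,2,3,2,2,1,2,2,2],
  [3,3,2,3,2,2,1,3,2,2,2,2,2,2,2,3,2,1,2,2,3,2,2,2],
  [4,2,2,2,2,2,2,2,2,2,2,2,0,2,2,2,2,2,2,2,2,2,2,2],
  [4,2,2,2,2,2,2,2,2,2,2,2,4,2,2,2,2,2,2,2,2,2,2,2]]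

/-- The integer vector `2 a - 4`. -/
def digitVector (l : List ℕ) (i : Fin 24) : ℤ := 2 * ((l.getD i 0 : ℤ) - 2)

/-- The sum of the products of the digits. -/
def digitDot (l : List ℕ) : List ℕ → ℕ :=
  l.rec (fun _ => 0) fun a _ ih l' => l'.rec 0 fun b l' _ => a * b + ih l'

/-- Whether inner products of a vector with the vectors in a list are at most `8` in absolute
value. -/
def digitCheck (l : List ℕ) (t : List (List ℕ)) : Bool :=
  t.rec true fun l' _ ih =>
    -- The product of the integer vectors is 4(D - 2(s + s') + 96), with D the product of the digit
    -- lists and s, s' their sums. Being at most 8 in absolute value means that the bracket lies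
    -- between -2 and 2.
    ((Nat.ble (digitDot l l' + 96) (2 * (l.sum + l'.sum) + 2)).and
      (Nat.ble (2 * (l.sum + l'.sum)) (digitDot l l' + 98))).and ih

/-- Whether the inner products of the vectors in a list are at most `8` in absolute value. -/
def digitCheckAll (t : List (List ℕ)) : Bool :=
  t.rec true fun l t ih => (digitCheck l t).and ih

/-- The number whose binary digits are the parities of the digits in a list. -/
def parityMask (l : List ℕ) : ℕ := l.foldr (fun a n => a % 2 + 2 * n) 0

/-- The remainder of the division of a mask by the generator polynomial of the Golay code. -/
def golayRemainder (n : ℕ) : ℕ :=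
  (List.range 12).foldl (fun n i => if n.testBit i then n ^^^ (2 ^ 23 + 3189 * 2 ^ i) else n) n

/-- Whether a list of digits gives a vector of norm `32` in the scaled Leech lattice. -/
def rowCheck (l : List ℕ) : Bool :=
  l.length = 24 ∧ digitDot l l + 96 = 4 * l.sum + 8 ∧ l.sum % 4 = 0 ∧
    golayRemainder (parityMask l) = 0

theorem digitCheckAll_digitTable : digitCheckAll digitTable = true := by
  decide +kernel

theorem rowCheck_digitTable : ∀ l ∈ digitTable, rowCheck l = true := by
  decide +kernel

theorem length_digitTable : digitTable.length = 244 := by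
  decide +kernel

theorem digitDot_eq_sum {l : List ℕ} {n : ℕ} (hl : l.length ≤ n) (l' : List ℕ) :
    digitDot l l' = ∑ i ∈ Finset.range n, l.getD i 0 * l'.getD i 0 := by
  induction l generalizing n l' with
  | nil => simp [digitDot]
  | cons a l ih =>
    obtain ⟨n, rfl⟩ : ∃ k, n = k + 1 := ⟨n - 1, by simp at hl; omega⟩
    rw [Finset.sum_range_succ']
    cases l' with
    | nil => simp [digitDot]
    | cons b l' =>
      have h := ih (n := n) (by simpa using hl) l'
      simp only [List.getD_cons_succ, List.getD_cons_zero, ← h, digitDot]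
      ring

theorem sum_eq_sum_getD {l : List ℕ} {n : ℕ} (hl : l.length ≤ n) :
    l.sum = ∑ i ∈ Finset.range n, l.getD i 0 := by
  induction l generalizing n with
  | nil => simp
  | cons a l ih =>
    obtain ⟨n, rfl⟩ : ∃ k, n = k + 1 := ⟨n - 1, by simp at hl; omega⟩
    rw [Finset.sum_range_succ', List.sum_cons, ih (n := n) (by simpa using hl)]
    simp only [List.getD_cons_succ, List.getD_cons_zero]
    ring

theorem sum_mul_digitVector {l l' : List ℕ} (hl : l.length = 24) (hl' : l'.length = 24) :
    ∑ i, digitVector l i * digitVector l' i =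
      4 * ((digitDot l l' : ℤ) - 2 * (l.sum + l'.sum) + 96) := by
  have h0 : ∑ i, digitVector l i * digitVector l' i = ∑ i ∈ Finset.range 24,
      (2 * ((l.getD i 0 : ℤ) - 2)) * (2 * ((l'.getD i 0 : ℤ) - 2)) :=
    Fin.sum_univ_eq_sum_range
      (fun i => (2 * ((l.getD i 0 : ℤ) - 2)) * (2 * ((l'.getD i 0 : ℤ) - 2))) 24
  have h1 : ∀ i, (2 * ((l.getD i 0 : ℤ) - 2)) * (2 * ((l'.getD i 0 : ℤ) - 2)) =
      4 * ((l.getD i 0 * l'.getD i 0 : ℕ) : ℤ) - 8 * (l.getD i 0 : ℤ) - 8 * (l'.getD i 0 : ℤ) +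
        16 := by
    intro i
    push_cast
    ring
  rw [h0, Finset.sum_congr rfl fun i _ => h1 i, digitDot_eq_sum hl.le, sum_eq_sum_getD hl.le,
    sum_eq_sum_getD hl'.le]
  simp only [Finset.sum_add_distrib, Finset.sum_sub_distrib, ← Finset.mul_sum, Finset.sum_const,
    Finset.card_range, nsmul_eq_mul]
  push_cast
  ring

theorem testBit_parityMask (l : List ℕ) (i : ℕ) :
    (parityMask l).testBit i = decide (l.getD i 0 % 2 = 1) := by
  induction l generalizing i with
  | nil => simp [parityMask]
  | cons a l ih =>
    have hrec : parityMask (a :: l) = a % 2 + 2 * parityMask l := rfl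
    cases i with
    | zero =>
      rw [hrec, Nat.testBit_zero, List.getD_cons_zero]
      congr 2
      omega
    | succ i =>
      rw [hrec, Nat.testBit_succ, List.getD_cons_succ, ← ih]
      congr 1
      omega

theorem mem_xorSpan_of_mem {r : ℕ} {l : List ℕ} (h : r ∈ l) : r ∈ xorSpan l := by
  have h0 : ∀ l : List ℕ, 0 ∈ xorSpan l := by
    intro l
    induction l with
    | nil => simp [xorSpan]
    | cons a l ih => exact List.mem_append_left _ ih
  induction l with
  | nil => simp at h
  | cons a l ih =>
    rcases List.mem_cons.1 h with rfl | h
    · exact List.mem_append_right _ (List.mem_map.2 ⟨0, h0 l, Nat.xor_zero _⟩)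
    · exact List.mem_append_left _ (ih h)

/-- Each reduction step adds a row or nothing, so it does not affect membership in the code. -/
theorem mem_xorSpan_of_golayRemainder {n : ℕ} (h : golayRemainder n = 0) :
    n ∈ xorSpan golayMasks := by
  have key : ∀ (L : List ℕ), (∀ i ∈ L, i < 12) → ∀ n,
      L.foldl (fun n i => if n.testBit i then n ^^^ (2 ^ 23 + 3189 * 2 ^ i) else n) n ∈
        xorSpan golayMasks → n ∈ xorSpan golayMasks := by
    intro L
    induction L with
    | nil => intro _ n hn; exact hn
    | cons i L ih =>
      intro hL n hn
      have h1 := ih (fun j hj => hL j (List.mem_cons_of_mem _ hj)) _ hn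
      dsimp only at h1
      split_ifs at h1
      · have h2 : 2 ^ 23 + 3189 * 2 ^ i ∈ xorSpan golayMasks :=
          mem_xorSpan_of_mem (List.mem_map.2 ⟨i, by simpa using hL i (by simp), rfl⟩)
        have h3 := xor_mem_xorSpan _ h1 h2
        rwa [Nat.xor_assoc, Nat.xor_self, Nat.xor_zero] at h3
      · exact h1
  refine key (List.range 12) (fun i hi => by simpa using hi) n ?_
  change golayRemainder n ∈ _
  rw [h]
  have h1 := mem_xorSpan_of_mem (r := 2 ^ 23 + 3189) (l := golayMasks)
    (List.mem_map.2 ⟨0, by simp, by norm_num⟩)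
  simpa using xor_mem_xorSpan _ h1 h1

theorem digitVector_mem_shortVectors {l : List ℕ} (h : rowCheck l = true) :
    digitVector l ∈ shortVectors := by
  simp only [rowCheck, decide_eq_true_eq] at h
  obtain ⟨h1, h2, h3, h4⟩ := h
  rw [mem_shortVectors]
  refine ⟨?_, ?_⟩
  · refine isScaledLeechVector_of_half (y := fun i => (l.getD i 0 : ℤ) - 2) ?_ ?_
    · rw [mem_golayCode_iff]
      refine ⟨_, mem_xorSpan_of_golayRemainder h4, ?_⟩
      funext i
      have h2 : (2 : ZMod 2) = 0 := rfl
      simp only [indicatorWord, maskSet, Finset.mem_filter, Finset.mem_univ, true_and,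
        testBit_parityMask, decide_eq_true_eq]
      push_cast
      rw [h2, sub_zero]
      split_ifs with h
      · exact ((ZMod.natCast_eq_one_iff_odd).2 (Nat.odd_iff.2 h)).symm
      · exact ((ZMod.natCast_eq_zero_iff_even).2 (Nat.even_iff.2 (by omega))).symm
    · have h0 : ∑ i : Fin 24, ((l.getD i 0 : ℤ) - 2) = (l.sum : ℤ) - 48 := by
        rw [sum_eq_sum_getD h1.le, Finset.sum_sub_distrib,
          Fin.sum_univ_eq_sum_range (fun i => (l.getD i 0 : ℤ)) 24]
        push_cast
        simp
      rw [h0]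
      omega
  · have := sum_mul_digitVector h1 h1
    simp only [sq]
    rw [this]
    omega

theorem pairwise_of_digitCheckAll {t : List (List ℕ)} (h : digitCheckAll t = true)
    (hlen : ∀ l ∈ t, l.length = 24) :
    t.Pairwise fun l l' => |∑ i, digitVector l i * digitVector l' i| ≤ 8 := by
  induction t with
  | nil => exact List.Pairwise.nil
  | cons l t ih =>
    have h' : (digitCheck l t && digitCheckAll t) = true := h
    rw [Bool.and_eq_true] at h'
    refine List.Pairwise.cons ?_ (ih h'.2 fun l hl => hlen l (List.mem_cons_of_mem _ hl))
    have key : ∀ s : List (List ℕ), digitCheck l s = true → (∀ l ∈ s, l.length = 24) →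
        ∀ l' ∈ s, |∑ i, digitVector l i * digitVector l' i| ≤ 8 := by
      intro s
      induction s with
      | nil => intro _ _ l' hl'; simp at hl'
      | cons r s ihs =>
        intro hs hslen l' hl'
        have hs' : ((Nat.ble (digitDot l r + 96) (2 * (l.sum + r.sum) + 2) &&
          Nat.ble (2 * (l.sum + r.sum)) (digitDot l r + 98)) && digitCheck l s) = true := hs
        rw [Bool.and_eq_true, Bool.and_eq_true, Nat.ble_eq, Nat.ble_eq] at hs'
        rcases List.mem_cons.1 hl' with rfl | hl'
        · rw [sum_mul_digitVector (hlen l (by simp)) (hslen l' (by simp)), abs_le]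
          omega
        · exact ihs hs'.2 (fun l hl => hslen l (List.mem_cons_of_mem _ hl)) l' hl'
    exact key t h'.1 fun l hl => hlen l (List.mem_cons_of_mem _ hl)

/-- The bound 8 on scaled products is the bound 1 on inner products. Imposed on absolute values, it
survives all choices of signs, so the vectors can be joined by their negatives. -/
theorem exists_admissible_of_pairwise {t : List (Fin 24 → ℤ)} (ht : ∀ x ∈ t, x ∈ shortVectors)
    (hp : t.Pairwise fun x y => |∑ i, x i * y i| ≤ 8) :
    ∃ S, IsAdmissible S ∧ IsAntipodal S ∧ S.ncard = 2 * t.length := by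
  have hself : ∀ x ∈ t, ∑ i, x i * x i = 32 := by
    intro x hx
    have := (mem_shortVectors.1 (ht x hx)).2
    simpa only [sq] using this
  have hsymm : Std.Symm fun x y : Fin 24 → ℤ => |∑ i, x i * y i| ≤ 8 :=
    ⟨fun x y h => by simpa only [mul_comm] using h⟩
  have hne : ∀ x ∈ t, ∀ y ∈ t, x ≠ y → |∑ i, x i * y i| ≤ 8 := fun x hx y hy h =>
    hp.forall hx hy h
  have hneg : ∀ x ∈ t, -x ∉ t := by
    intro x hx hx'
    have h1 : x ≠ -x := by
      intro h
      have h0 : ∀ i, x i = 0 := fun i => by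
        have : x i = -x i := congrFun h i
        omega
      have := hself x hx
      simp [h0] at this
    have h2 := hne x hx _ hx' h1
    simp only [Pi.neg_apply, mul_neg, Finset.sum_neg_distrib, abs_neg, hself x hx] at h2
    norm_num at h2
  have hnodup : (t ++ t.map (-·)).Nodup := by
    have ht' : t.Nodup := hp.imp_of_mem fun {x y} hx hy h heq => by
      rw [← heq, hself x hx] at h
      norm_num at h
    rw [List.nodup_append]
    refine ⟨ht', ht'.map neg_injective, ?_⟩
    rintro x hx y hy rfl
    obtain ⟨z, hz, rfl⟩ := List.mem_map.1 hy
    exact hneg z hz hx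
  refine ⟨scaled '' {x | x ∈ t ++ t.map (-·)}, ⟨?_, ?_⟩, ?_, ?_⟩
  · rintro _ ⟨x, hx, rfl⟩
    have hx : x ∈ t ++ t.map (-·) := hx
    rcases List.mem_append.1 hx with hx | hx
    · rw [minimalVectors_eq]
      exact mem_image_of_mem _ (ht x hx)
    · obtain ⟨z, hz, rfl⟩ := List.mem_map.1 hx
      rw [scaled_neg]
      apply isAntipodal_minimalVectors
      rw [minimalVectors_eq]
      exact mem_image_of_mem _ (ht z hz)
  · have hgen : ∀ x ∈ t ++ t.map (-·), ∃ z ∈ t, ∃ e : ℤ, (e = 1 ∨ e = -1) ∧ x = fun i => e * z i := by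
      intro x hx
      rcases List.mem_append.1 hx with hx | hx
      · exact ⟨x, hx, 1, Or.inl rfl, by simp⟩
      · obtain ⟨z, hz, rfl⟩ := List.mem_map.1 hx
        exact ⟨z, hz, -1, Or.inr rfl, by funext i; simp⟩
    rintro _ ⟨x, hx, rfl⟩ _ ⟨y, hy, rfl⟩ hxy
    obtain ⟨z, hz, e, he, rfl⟩ := hgen x hx
    obtain ⟨z', hz', e', he', rfl⟩ := hgen y hy
    have hsum : ∑ i, (e * z i) * (e' * z' i) = e * e' * ∑ i, z i * z' i := by
      rw [Finset.mul_sum]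
      exact Finset.sum_congr rfl fun i _ => by ring
    rw [inner_scaled, hsum]
    have hle : e * e' * ∑ i, z i * z' i ≤ 8 := by
      by_cases hzz : z = z'
      · subst hzz
        have hee : e ≠ e' := by rintro rfl; exact hxy rfl
        rw [hself z hz]
        rcases he with rfl | rfl <;> rcases he' with rfl | rfl <;> simp_all
      · have := abs_le.1 (hne z hz z' hz' hzz)
        rcases he with rfl | rfl <;> rcases he' with rfl | rfl <;> linarith
    have : ((e * e' * ∑ i, z i * z' i : ℤ) : ℝ) ≤ 8 := by exact_mod_cast hle
    linarith
  · rintro _ ⟨x, hx, rfl⟩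
    have hx : x ∈ t ++ t.map (-·) := hx
    refine ⟨-x, ?_, scaled_neg x⟩
    change -x ∈ t ++ t.map (-·)
    rcases List.mem_append.1 hx with hx | hx
    · exact List.mem_append_right _ (List.mem_map.2 ⟨x, hx, rfl⟩)
    · obtain ⟨z, hz, rfl⟩ := List.mem_map.1 hx
      rw [neg_neg]
      exact List.mem_append_left _ hz
  · classical
    have hcoe : {x | x ∈ t ++ t.map (-·)} = ((t ++ t.map (-·)).toFinset : Set (Fin 24 → ℤ)) := by
      ext x
      simp
    rw [Set.ncard_image_of_injective _ scaled_injective, hcoe, Set.ncard_coe_finset,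
      List.toFinset_card_of_nodup hnodup, List.length_append, List.length_map]
    ring

/-- There are antipodal admissible sets with `2 k` elements, for `k ≤ 244`. -/
theorem exists_antipodal_admissible {k : ℕ} (hk : k ≤ 244) :
    ∃ S, IsAdmissible S ∧ IsAntipodal S ∧ S.ncard = 2 * k := by
  have hlen : ∀ l ∈ digitTable, l.length = 24 := by
    intro l hl
    have := rowCheck_digitTable l hl
    simp only [rowCheck, decide_eq_true_eq] at this
    exact this.1
  have h := exists_admissible_of_pairwise (t := (digitTable.take k).map digitVector) ?_ ?_
  · rwa [List.length_map, List.length_take, length_digitTable, min_eq_left hk] at h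
  · intro x hx
    obtain ⟨l, hl, rfl⟩ := List.mem_map.1 hx
    exact digitVector_mem_shortVectors (rowCheck_digitTable l (List.mem_of_mem_take hl))
  · rw [List.pairwise_map]
    -- An initial part of the table inherits the pairwise bound; this yields the smaller sizes,
    -- among them 480.
    exact (pairwise_of_digitCheckAll digitCheckAll_digitTable hlen).sublist
      (List.take_sublist _ _)

/-! ### Rounding -/

section Rounding

variable {K : Type*} [Field K] [LinearOrder K] [IsStrictOrderedRing K] [FloorRing K]

theorem floor_overlap (m N : ℕ) : ⌊(m : K) * N / 196560⌋ = ((m * N / 196560 : ℕ) : ℤ) := by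
  have h := Int.floor_div_natCast ((m * N : ℕ) : K) 196560
  push_cast at h ⊢
  rw [h, ← Nat.cast_mul, Int.floor_natCast]
  push_cast
  rfl

theorem floor_overlap_half (m N : ℕ) :
    ⌊(m : K) * N / 196560 / 2⌋ = ((m * N / 393120 : ℕ) : ℤ) := by
  have h := Int.floor_div_natCast ((m * N : ℕ) : K) 393120
  rw [div_div]
  push_cast at h ⊢
  norm_num at h ⊢
  rw [h, ← Nat.cast_mul, Int.floor_natCast]
  push_cast
  rfl

theorem floorEven_overlap (m N : ℕ) :
    floorEven ((m : K) * N / 196560) = ((2 * (m * N / 393120) : ℕ) : ℤ) := by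
  rw [floorEven, floor_overlap_half]
  push_cast
  rfl

/-- For even m, rounding m - E up to an even integer is subtracting the even floor of E. The divisor
393120 is 2 · 196560. The field is left general because the recursion on sizes is rational and the
one on sets is real. -/
theorem ceilEven_bound {m : ℕ} (hm : Even m) (N : ℕ) :
    ceilEven ((m : K) * (1 - N / 196560)) = m - ((2 * (m * N / 393120) : ℕ) : ℤ) := by
  obtain ⟨a, rfl⟩ := hm
  have h : ((a + a : ℕ) : K) * (1 - N / 196560) / 2 =
      ((a : ℤ) : K) + -(((a + a : ℕ) : K) * N / 196560 / 2) := by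
    push_cast
    ring
  rw [ceilEven, h, Int.ceil_intCast_add, Int.ceil_neg, floor_overlap_half]
  push_cast
  ring

end Rounding

/-! ### Antipodal sets -/

theorem IsAntipodal.exists_add_two {S T : Set (EuclideanSpace ℝ (Fin 24))}
    (hS : S ⊆ minimalVectors) (hS' : IsAntipodal S) (hT : IsAntipodal T) (hTS : T ⊂ S) :
    ∃ T' ⊆ S, IsAntipodal T' ∧ T'.ncard = T.ncard + 2 := by
  obtain ⟨x, hxS, hxT⟩ := exists_of_ssubset hTS
  have hfin : T.Finite := finite_minimalVectors.subset (hTS.subset.trans hS)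
  have hx : x ≠ -x := fun h => by
    have h2 : (2 : ℝ) • x = 0 := by
      rw [two_smul]
      exact add_eq_zero_iff_eq_neg.2 h
    exact ne_zero_of_mem_minimalVectors (hS hxS) ((smul_eq_zero_iff_right two_ne_zero).1 h2)
  have hxT' : -x ∉ T := fun h => hxT (by simpa using hT _ h)
  refine ⟨insert x (insert (-x) T), ?_, ?_, ?_⟩
  · exact insert_subset hxS (insert_subset (hS' _ hxS) hTS.subset)
  · rintro y (rfl | rfl | hy)
    · simp
    · simp
    · exact mem_insert_of_mem _ (mem_insert_of_mem _ (hT _ hy))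
  · rw [ncard_insert_of_notMem (by simp [hx, hxT]) (hfin.insert _),
      ncard_insert_of_notMem hxT' hfin]

/-- Opposite pairs are added one at a time. The slack `+ 1` in the bound lets `even_ncard` follow: a
set of odd size would contain a subset larger than itself. -/
theorem IsAntipodal.exists_subset_ncard {S : Set (EuclideanSpace ℝ (Fin 24))}
    (hS : S ⊆ minimalVectors) (hS' : IsAntipodal S) :
    ∀ k : ℕ, 2 * k ≤ S.ncard + 1 → ∃ T ⊆ S, IsAntipodal T ∧ T.ncard = 2 * k
  | 0, _ => ⟨∅, empty_subset _, fun _ h => h.elim, by simp⟩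
  | k + 1, hk => by
    obtain ⟨T, hTS, hT, hcard⟩ := IsAntipodal.exists_subset_ncard hS hS' k (by omega)
    have hne : T ≠ S := by
      rintro rfl
      omega
    obtain ⟨T', h1, h2, h3⟩ := IsAntipodal.exists_add_two hS hS' hT (hTS.ssubset_of_ne hne)
    exact ⟨T', h1, h2, by omega⟩

theorem IsAntipodal.even_ncard {S : Set (EuclideanSpace ℝ (Fin 24))}
    (hS : S ⊆ minimalVectors) (hS' : IsAntipodal S) : Even S.ncard := by
  by_contra h
  obtain ⟨k, hk⟩ := Nat.not_even_iff_odd.1 h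
  obtain ⟨T, hTS, -, hT⟩ := hS'.exists_subset_ncard hS (k + 1) (by omega)
  have := ncard_le_ncard hTS (finite_minimalVectors.subset hS)
  omega

theorem IsAntipodal.image {S : Set (EuclideanSpace ℝ (Fin 24))} (hS : IsAntipodal S)
    (g : EuclideanSpace ℝ (Fin 24) ≃ₗᵢ[ℝ] EuclideanSpace ℝ (Fin 24)) :
    IsAntipodal (g '' S) := by
  rintro _ ⟨x, hx, rfl⟩
  exact ⟨-x, hS x hx, map_neg _ _⟩

theorem IsAntipodal.inter {S U : Set (EuclideanSpace ℝ (Fin 24))} (hS : IsAntipodal S)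
    (hU : IsAntipodal U) : IsAntipodal (S ∩ U) :=
  fun x hx => ⟨hS x hx.1, hU x hx.2⟩

theorem IsAntipodal.diff {S U : Set (EuclideanSpace ℝ (Fin 24))} (hS : IsAntipodal S)
    (hU : IsAntipodal U) : IsAntipodal (S \ U) :=
  fun x hx => ⟨hS x hx.1, fun h => hx.2 (by simpa using hU _ h)⟩

theorem IsAdmissible.image {S : Set (EuclideanSpace ℝ (Fin 24))} (hS : IsAdmissible S)
    {g : EuclideanSpace ℝ (Fin 24) ≃ₗᵢ[ℝ] EuclideanSpace ℝ (Fin 24)} (hg : g ∈ conwayGroup) :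
    IsAdmissible (g '' S) := by
  refine ⟨?_, ?_⟩
  · rintro _ ⟨x, hx, rfl⟩
    exact image_minimalVectors hg (hS.1 hx)
  · rintro _ ⟨x, hx, rfl⟩ _ ⟨y, hy, rfl⟩ hne
    rw [LinearIsometryEquiv.inner_map_map]
    exact hS.2 x hx y hy fun h => hne (by rw [h])

theorem IsAdmissible.mono {S T : Set (EuclideanSpace ℝ (Fin 24))} (hS : IsAdmissible S)
    (hTS : T ⊆ S) : IsAdmissible T :=
  ⟨hTS.trans hS.1, fun x hx y hy => hS.2 x (hTS hx) y (hTS hy)⟩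

/-! ### Parts of translates, and the two averaging steps -/

/-- An antipodal subset of a translate of `S` under the Conway group. -/
def IsTranslatePart (S X : Set (EuclideanSpace ℝ (Fin 24))) : Prop :=
  IsAntipodal X ∧ ∃ g ∈ conwayGroup, X ⊆ g '' S

theorem IsTranslatePart.isAdmissible {S X : Set (EuclideanSpace ℝ (Fin 24))}
    (hX : IsTranslatePart S X) (hS : IsAdmissible S) : IsAdmissible X := by
  obtain ⟨-, g, hg, hXg⟩ := hX
  exact (hS.image hg).mono hXg

theorem IsTranslatePart.ncard_le {S X : Set (EuclideanSpace ℝ (Fin 24))}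
    (hX : IsTranslatePart S X) (hS : IsAdmissible S) : X.ncard ≤ S.ncard := by
  obtain ⟨-, g, hg, hXg⟩ := hX
  rw [← ncard_image_of_injective S g.injective]
  exact ncard_le_ncard hXg (finite_minimalVectors.subset (hS.image hg).1)

theorem ncard_image_diff {S U : Set (EuclideanSpace ℝ (Fin 24))} (hS : S ⊆ minimalVectors)
    (g : conwayGroup) : (g.1 '' S \ U).ncard + overlap S U g = S.ncard := by
  have hfin : S.Finite := finite_minimalVectors.subset hS
  rw [overlap, add_comm, ncard_inter_add_ncard_sdiff_eq_ncard _ _ (hfin.image _),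
    ncard_image_of_injective S g.1.injective]

theorem even_overlap {S U : Set (EuclideanSpace ℝ (Fin 24))} (hS : IsAntipodal S)
    (hU : U ⊆ minimalVectors) (hU' : IsAntipodal U) (g : conwayGroup) :
    Even (overlap S U g) :=
  ((hS.image g.1).inter hU').even_ncard (inter_subset_right.trans hU)

/-- A translate of `S`, chosen by averaging, supplies a new antipodal set disjoint from `U`. -/
theorem exists_translatePart {S U : Set (EuclideanSpace ℝ (Fin 24))} (hS : IsAdmissible S)
    (hS' : IsAntipodal S) (hU : U ⊆ minimalVectors) (hU' : IsAntipodal U) :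
    ∃ X, IsTranslatePart S X ∧ Disjoint X U ∧
      X.ncard = S.ncard - 2 * (S.ncard * U.ncard / 393120) := by
  obtain ⟨g, hg⟩ := exists_overlap_le hS.1 hU
  obtain ⟨a, ha⟩ := hS'.even_ncard hS.1
  obtain ⟨x, hx⟩ := even_overlap hS' hU hU' g
  have hdiff := ncard_image_diff (U := U) hS.1 g
  -- The overlap is 2x, so the average bounds x by half the mean, rounded down. Surplus pairs are
  -- then deleted to reach the exact size.
  have hle : x ≤ S.ncard * U.ncard / 393120 := by
    rw [Nat.le_div_iff_mul_le (by norm_num)]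
    rw [hx] at hg
    linarith
  obtain ⟨X, hXS, hX, hcard⟩ := ((hS'.image g.1).diff hU').exists_subset_ncard
    (sdiff_subset.trans (hS.image g.2).1) (a - S.ncard * U.ncard / 393120) (by omega)
  exact ⟨X, ⟨hX, g.1, g.2, hXS.trans sdiff_subset⟩, disjoint_sdiff_left.mono_left hXS,
    by omega⟩

/-- Some translate of a small antipodal set is disjoint from it. -/
theorem exists_disjoint_translate {S : Set (EuclideanSpace ℝ (Fin 24))} (hS : IsAdmissible S)
    (hS' : IsAntipodal S) (hm : S.ncard * S.ncard < 2 * 196560) :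
    ∃ t : conwayGroup, Disjoint (t.1 '' S) S := by
  obtain ⟨t, ht⟩ := exists_overlap_le hS.1 hS.1
  obtain ⟨x, hx⟩ := even_overlap hS' hS.1 hS' t
  -- The overlap is even and, by averaging and `hm`, less than 2.
  have h0 : overlap S S t = 0 := by omega
  refine ⟨t, disjoint_iff_inter_eq_empty.2 ?_⟩
  exact (ncard_eq_zero (finite_minimalVectors.subset (inter_subset_right.trans hS.1))).1 h0

/-- Averaging over pairs of disjoint translates: if the mean overlap with `U` has even integral
part `e`, then two new disjoint antipodal sets of total size `2 (|S| - e)` are available. -/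
theorem exists_translatePart_pair {S U : Set (EuclideanSpace ℝ (Fin 24))} (hS : IsAdmissible S)
    (hS' : IsAntipodal S) (hU : U ⊆ minimalVectors) (hU' : IsAntipodal U)
    (hm : S.ncard * S.ncard < 2 * 196560) (he : Even (S.ncard * U.ncard / 196560))
    (hsmall : 4 * (S.ncard * U.ncard / 393120) ≤ S.ncard) :
    ∃ X Y, IsTranslatePart S X ∧ IsTranslatePart S Y ∧ Disjoint X U ∧ Disjoint Y U ∧
      Disjoint X Y ∧ S.ncard - 2 * (S.ncard * U.ncard / 393120) ≤ X.ncard ∧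
      X.ncard + Y.ncard = 2 * (S.ncard - 2 * (S.ncard * U.ncard / 393120)) := by
  obtain ⟨t, ht⟩ := exists_disjoint_translate hS hS' hm
  obtain ⟨g, hg⟩ := exists_overlap_add_le hS.1 hU t
  have key : ∀ g h : conwayGroup, Disjoint (g.1 '' S) (h.1 '' S) →
      196560 * (overlap S U g + overlap S U h) ≤ 2 * (S.ncard * U.ncard) →
      overlap S U g ≤ overlap S U h →
      ∃ X Y, IsTranslatePart S X ∧ IsTranslatePart S Y ∧ Disjoint X U ∧ Disjoint Y U ∧
        Disjoint X Y ∧ S.ncard - 2 * (S.ncard * U.ncard / 393120) ≤ X.ncard ∧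
        X.ncard + Y.ncard = 2 * (S.ncard - 2 * (S.ncard * U.ncard / 393120)) := by
    intro g h hdisj hle hgh
    obtain ⟨a, ha⟩ := hS'.even_ncard hS.1
    obtain ⟨x, hx⟩ := even_overlap hS' hU hU' g
    obtain ⟨y, hy⟩ := even_overlap hS' hU hU' h
    obtain ⟨b, hb⟩ := he
    have hdg := ncard_image_diff (U := U) hS.1 g
    have hdh := ncard_image_diff (U := U) hS.1 h
    generalize S.ncard * U.ncard = p at *
    have hb' : p / 393120 = b := by omega
    rw [hb'] at hsmall ⊢
    -- Here the parity of the floor is used: the overlaps are 2x and 2y, the floor of the mean is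
    -- 2b, and 2x + 2y < 2(2b + 1).
    have hxy : x + y ≤ 2 * b := by omega
    -- The translate with the smaller overlap is kept whole, so it has at least |S| - 2b elements.
    -- Only the other one is trimmed, to make the total exactly 2(|S| - 2b). `hsmall` keeps the
    -- target size nonnegative.
    obtain ⟨Y, hYS, hY, hcard⟩ := ((hS'.image h.1).diff hU').exists_subset_ncard
      (sdiff_subset.trans (hS.image h.2).1) (a + x - 2 * b) (by omega)
    exact ⟨g.1 '' S \ U, Y, ⟨(hS'.image g.1).diff hU', g.1, g.2, sdiff_subset⟩,
      ⟨hY, h.1, h.2, hYS.trans sdiff_subset⟩, disjoint_sdiff_left,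
      disjoint_sdiff_left.mono_left hYS,
      hdisj.mono sdiff_subset (hYS.trans sdiff_subset), by omega, by omega⟩
  have hdisj : Disjoint ((g * t).1 '' S) (g.1 '' S) := by
    have himage : (g * t).1 '' S = g.1 '' (t.1 '' S) := by
      rw [← image_comp]
      rfl
    rw [himage]
    exact disjoint_image_of_injective g.1.injective ht
  rcases le_total (overlap S U g) (overlap S U (g * t)) with h | h
  · exact key _ _ hdisj.symm hg h
  · exact key _ _ hdisj (by rwa [add_comm]) h

/-! ### Runs of the improved recursion -/

/-- The union of the first `k` sets. -/
def covered (T : ℕ → Set (EuclideanSpace ℝ (Fin 24))) (k : ℕ) : Set (EuclideanSpace ℝ (Fin 24)) :=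
  ⋃ j ∈ Finset.Icc 1 k, T j

/-- The sum of the sizes of the first `k` sets. -/
def totalSize (T : ℕ → Set (EuclideanSpace ℝ (Fin 24))) (k : ℕ) : ℕ :=
  ∑ j ∈ Finset.Icc 1 k, (T j).ncard

theorem covered_zero (T : ℕ → Set (EuclideanSpace ℝ (Fin 24))) : covered T 0 = ∅ := by
  simp [covered]

theorem covered_succ (T : ℕ → Set (EuclideanSpace ℝ (Fin 24))) (k : ℕ) :
    covered T (k + 1) = covered T k ∪ T (k + 1) := by
  rw [covered, covered, ← Finset.insert_Icc_right_eq_Icc_add_one (by omega),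
    Finset.set_biUnion_insert, union_comm]

theorem totalSize_succ (T : ℕ → Set (EuclideanSpace ℝ (Fin 24))) (k : ℕ) :
    totalSize T (k + 1) = totalSize T k + (T (k + 1)).ncard :=
  Finset.sum_Icc_succ_top (by omega) _

theorem covered_congr {T T' : ℕ → Set (EuclideanSpace ℝ (Fin 24))} {k : ℕ}
    (h : ∀ j ≤ k, T' j = T j) : covered T' k = covered T k :=
  iUnion₂_congr fun j hj => h j (Finset.mem_Icc.1 hj).2

theorem totalSize_congr {T T' : ℕ → Set (EuclideanSpace ℝ (Fin 24))} {k : ℕ}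
    (h : ∀ j ≤ k, T' j = T j) : totalSize T' k = totalSize T k :=
  Finset.sum_congr rfl fun j hj => by rw [h j (Finset.mem_Icc.1 hj).2]

theorem expectedOverlap_congr {S : Set (EuclideanSpace ℝ (Fin 24))}
    {T T' : ℕ → Set (EuclideanSpace ℝ (Fin 24))} {k : ℕ} (h : ∀ j ≤ k, T' j = T j) :
    expectedOverlap S T' k = expectedOverlap S T k := by
  have := covered_congr h
  simp only [covered] at this
  rw [expectedOverlap, expectedOverlap, this]

theorem basicBound_eq (S : Set (EuclideanSpace ℝ (Fin 24)))
    (T : ℕ → Set (EuclideanSpace ℝ (Fin 24))) (k : ℕ) :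
    basicBound S T k = (S.ncard : ℝ) * (1 - (totalSize T k : ℝ) / 196560) := by
  rw [basicBound, ncard_minimalVectors, totalSize]
  push_cast
  rfl

theorem basicBound_congr {S : Set (EuclideanSpace ℝ (Fin 24))}
    {T T' : ℕ → Set (EuclideanSpace ℝ (Fin 24))} {k : ℕ} (h : ∀ j ≤ k, T' j = T j) :
    basicBound S T' k = basicBound S T k := by
  rw [basicBound_eq, basicBound_eq, totalSize_congr h]

/-- The conditions on the first k sets do not see later ones, so a run can be extended by changing
the family beyond k. -/
theorem ImprovedRounds.congr {S : Set (EuclideanSpace ℝ (Fin 24))}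
    {T T' : ℕ → Set (EuclideanSpace ℝ (Fin 24))} {k : ℕ} (hk : ImprovedRounds S T k) :
    (∀ j ≤ k, T' j = T j) → ImprovedRounds S T' k := by
  induction hk with
  | start h1 h2 =>
    intro h
    refine .start (by rw [h 1 (by norm_num), h1]) ?_
    rw [h 2 le_rfl, basicBound_congr fun j hj => h j (by omega), h2]
  | even k _ hk50 heven hE hsum hsum' ih =>
    intro h
    have h' : ∀ j ≤ k, T' j = T j := fun j hj => h j (by omega)
    have hs : ∑ j ∈ Finset.Icc 1 k, ((T' j).ncard : ℝ) =
        ∑ j ∈ Finset.Icc 1 k, ((T j).ncard : ℝ) :=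
      Finset.sum_congr rfl fun j hj => by rw [h' j (Finset.mem_Icc.1 hj).2]
    refine .even k (ih h') hk50 ?_ ?_ ?_ ?_
    · rwa [expectedOverlap_congr h']
    · rwa [expectedOverlap_congr h', expectedOverlap_congr h, hs]
    · rwa [expectedOverlap_congr h', h _ (by omega), h _ le_rfl]
    · rwa [expectedOverlap_congr h', h _ (by omega), h _ le_rfl]
  | odd k _ hk50 hodd hcard ih =>
    intro h
    have h' : ∀ j ≤ k, T' j = T j := fun j hj => h j (by omega)
    refine .odd k (ih h') hk50 ?_ ?_
    · rwa [expectedOverlap_congr h']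
    · rwa [basicBound_congr h', h _ le_rfl]

/-- `T 1, …, T k` are disjoint antipodal subsets of translates of `S`. -/
structure IsDisjointParts (S : Set (EuclideanSpace ℝ (Fin 24)))
    (T : ℕ → Set (EuclideanSpace ℝ (Fin 24))) (k : ℕ) : Prop where
  part : ∀ j ∈ Finset.Icc 1 k, IsTranslatePart S (T j)
  disjoint : ∀ i ∈ Finset.Icc 1 k, ∀ j ∈ Finset.Icc 1 k, i ≠ j → Disjoint (T i) (T j)

namespace IsDisjointParts

variable {S : Set (EuclideanSpace ℝ (Fin 24))} {T : ℕ → Set (EuclideanSpace ℝ (Fin 24))} {k : ℕ}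

theorem mono (h : IsDisjointParts S T k) {l : ℕ} (hl : l ≤ k) : IsDisjointParts S T l :=
  ⟨fun j hj => h.part j (Finset.Icc_subset_Icc_right hl hj), fun i hi j hj =>
    h.disjoint i (Finset.Icc_subset_Icc_right hl hi) j (Finset.Icc_subset_Icc_right hl hj)⟩

theorem covered_subset (h : IsDisjointParts S T k) (hS : IsAdmissible S) :
    covered T k ⊆ minimalVectors :=
  iUnion₂_subset fun j hj => ((h.part j hj).isAdmissible hS).1

theorem isAntipodal_covered (h : IsDisjointParts S T k) : IsAntipodal (covered T k) := by
  intro x hx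
  obtain ⟨j, hj, hx⟩ := mem_iUnion₂.1 hx
  exact mem_iUnion₂.2 ⟨j, hj, (h.part j hj).1 x hx⟩

theorem ncard_covered (h : IsDisjointParts S T k) (hS : IsAdmissible S) :
    (covered T k).ncard = totalSize T k := by
  induction k with
  | zero => simp [covered_zero, totalSize]
  | succ k ih =>
    have hk := h.mono (Nat.le_succ k)
    have hdisj : Disjoint (covered T k) (T (k + 1)) := by
      refine disjoint_iUnion₂_left.2 fun j hj => ?_
      rw [Finset.mem_Icc] at hj
      exact h.disjoint j (Finset.mem_Icc.2 (by omega)) _ (Finset.mem_Icc.2 (by omega)) (by omega)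
    rw [covered_succ, totalSize_succ, ncard_union_eq hdisj
      (finite_minimalVectors.subset (hk.covered_subset hS))
      (finite_minimalVectors.subset
        ((h.part _ (Finset.mem_Icc.2 (by omega))).isAdmissible hS).1), ih hk]

theorem expectedOverlap_eq (h : IsDisjointParts S T k) (hS : IsAdmissible S) :
    expectedOverlap S T k = (S.ncard : ℝ) * totalSize T k / 196560 := by
  rw [← h.ncard_covered hS]
  exact mean_overlap hS.1 (h.covered_subset hS)

theorem totalSize_le (h : IsDisjointParts S T k) (hS : IsAdmissible S) :
    totalSize T k ≤ k * S.ncard := by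
  refine (Finset.sum_le_card_nsmul _ _ _ fun j hj => (h.part j hj).ncard_le hS).trans ?_
  simp

theorem append (h : IsDisjointParts S T k) {X : Set (EuclideanSpace ℝ (Fin 24))}
    (hX : IsTranslatePart S X) (hdisj : Disjoint X (covered T k)) :
    IsDisjointParts S (Function.update T (k + 1) X) (k + 1) := by
  have hXT : ∀ j ∈ Finset.Icc 1 k, Disjoint X (T j) := fun j hj =>
    disjoint_iUnion₂_right.1 hdisj j hj
  have hcases : ∀ j ∈ Finset.Icc 1 (k + 1), j = k + 1 ∨ j ≠ k + 1 ∧ j ∈ Finset.Icc 1 k := by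
    intro j hj
    rw [Finset.mem_Icc] at hj ⊢
    omega
  refine ⟨fun j hj => ?_, fun i hi j hj hij => ?_⟩
  · obtain rfl | ⟨hne, hj⟩ := hcases j hj
    · simpa using hX
    · simpa [hne] using h.part j hj
  · obtain rfl | ⟨hi', hi⟩ := hcases i hi
    · obtain rfl | ⟨hj', hj⟩ := hcases j hj
      · exact absurd rfl hij
      · simpa [hj'] using hXT j hj
    · obtain rfl | ⟨hj', hj⟩ := hcases j hj
      · simpa [hi'] using (hXT i hi).symm
      · simpa [hi', hj'] using h.disjoint i hi j hj hij

theorem update_congr (T : ℕ → Set (EuclideanSpace ℝ (Fin 24)))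
    (X : Set (EuclideanSpace ℝ (Fin 24))) : ∀ j ≤ k, Function.update T (k + 1) X j = T j :=
  fun j hj => Function.update_of_ne (by omega) _ _

/-- One more round can be carried out. -/
theorem exists_round (hS : IsAdmissible S) (hS' : IsAntipodal S) (hm : S.ncard ≤ 488)
    (hm' : 240 ≤ S.ncard) (h : IsDisjointParts S T k) (hr : ImprovedRounds S T k) (hk : k ≤ 50) :
    ∃ T' k', k < k' ∧ IsDisjointParts S T' k' ∧ ImprovedRounds S T' k' := by
  have hU := h.covered_subset hS
  have hU' := h.isAntipodal_covered
  have hE := h.expectedOverlap_eq hS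
  have hN := h.ncard_covered hS
  have heven := hS'.even_ncard hS.1
  have hmm : S.ncard * S.ncard < 2 * 196560 := by nlinarith
  -- Since |S| ≤ 488 and k ≤ 50, half the mean overlap is below 60. This gives the requirement of
  -- `exists_translatePart_pair` because 4 · 60 ≤ 240 ≤ |S|.
  have hsmall : S.ncard * totalSize T k / 393120 ≤ 60 := by
    refine Nat.div_le_of_le_mul ?_
    have h1 := h.totalSize_le hS
    calc S.ncard * totalSize T k ≤ S.ncard * (50 * S.ncard) :=
          Nat.mul_le_mul_left _ (h1.trans (Nat.mul_le_mul_right _ hk))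
      _ ≤ 393120 * 60 := by nlinarith
  have hfloor : ⌊expectedOverlap S T k⌋ = ((S.ncard * totalSize T k / 196560 : ℕ) : ℤ) := by
    rw [hE, floor_overlap]
  have hfloorEven : floorEven (expectedOverlap S T k) =
      ((2 * (S.ncard * totalSize T k / 393120) : ℕ) : ℤ) := by
    rw [hE, floorEven_overlap]
  rcases Nat.even_or_odd (S.ncard * totalSize T k / 196560) with he | ho
  · obtain ⟨X, Y, hX, hY, hXU, hYU, hXY, hle, hsum⟩ :=
      exists_translatePart_pair hS hS' hU hU' hmm (by rwa [hN]) (by rw [hN]; omega)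
    rw [hN] at hle hsum
    set T₁ := Function.update T (k + 1) X with hT₁
    have h₁ : IsDisjointParts S T₁ (k + 1) := h.append hX hXU
    have hcov : covered T₁ (k + 1) = covered T k ∪ X := by
      rw [covered_succ, covered_congr (update_congr T X), hT₁, Function.update_self]
    have h₂ : IsDisjointParts S (Function.update T₁ (k + 2) Y) (k + 2) :=
      h₁.append hY (by
        rw [hcov]
        exact disjoint_union_right.2 ⟨hYU, hXY.symm⟩)
    set T₂ := Function.update T₁ (k + 2) Y with hT₂
    have hc : ∀ j ≤ k, T₂ j = T j := fun j hj =>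
      (update_congr T₁ Y j (by omega)).trans (update_congr T X j hj)
    have hXc : T₂ (k + 1) = X :=
      (update_congr T₁ Y _ le_rfl).trans (Function.update_self _ _ _)
    have hYc : T₂ (k + 2) = Y := Function.update_self _ _ _
    refine ⟨T₂, k + 2, by omega, h₂, .even k (hr.congr hc) hk ?_ ?_ ?_ ?_⟩
    · rw [expectedOverlap_congr hc, hfloor]
      exact_mod_cast he
    -- The prescribed value of E_{k+2} holds because the pair has exactly the required total size.
    · have htot : totalSize T₂ (k + 2) = totalSize T k + X.ncard + Y.ncard := by
        rw [totalSize_succ, totalSize_succ, totalSize_congr hc, hXc, hYc]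
      have hs : ∑ j ∈ Finset.Icc 1 k, ((T₂ j).ncard : ℝ) = (totalSize T k : ℝ) := by
        rw [← totalSize_congr hc, totalSize]
        push_cast
        rfl
      have hsum' : (X.ncard : ℝ) + Y.ncard =
          2 * (S.ncard - ((2 * (S.ncard * totalSize T k / 393120) : ℕ) : ℝ)) := by
        rw [← Nat.cast_sub (by omega)]
        exact_mod_cast hsum
      rw [h₂.expectedOverlap_eq hS, expectedOverlap_congr hc, hfloorEven, hs, htot,
        ncard_minimalVectors, Int.cast_natCast, ← hsum']
      push_cast
      ring
    · rw [expectedOverlap_congr hc, hfloorEven, hXc, hYc]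
      omega
    · rw [expectedOverlap_congr hc, hfloorEven, hXc, hYc]
      omega
  · obtain ⟨X, hX, hXU, hcard⟩ := exists_translatePart hS hS' hU hU'
    have hc := update_congr (k := k) T X
    refine ⟨_, k + 1, Nat.lt_succ_self k, h.append hX hXU, .odd k (hr.congr hc) hk ?_ ?_⟩
    · rw [expectedOverlap_congr hc, hfloor]
      exact_mod_cast ho
    · rw [basicBound_congr hc, basicBound_eq, ceilEven_bound heven, Function.update_self, hcard, hN]
      omega

end IsDisjointParts

/-- The start is one basic step from S alone. Each further round adds at least one set and can be
made while k ≤ 50. -/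
theorem exists_isImprovedRun {S : Set (EuclideanSpace ℝ (Fin 24))} (hS : IsAdmissible S)
    (hS' : IsAntipodal S) (hm : S.ncard ≤ 488) (hm' : 240 ≤ S.ncard) :
    ∃ T K, IsImprovedRun S T K := by
  have heven := hS'.even_ncard hS.1
  have hstart : ∃ T, IsDisjointParts S T 2 ∧ ImprovedRounds S T 2 := by
    have h₀ : IsDisjointParts S (fun _ => S) 1 := by
      refine ⟨fun _ _ => ⟨hS', 1, one_mem _, by simp⟩, fun i hi j hj hij => ?_⟩
      rw [Finset.mem_Icc] at hi hj
      omega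
    obtain ⟨X, hX, hXU, hcard⟩ := exists_translatePart hS hS' (h₀.covered_subset hS)
      h₀.isAntipodal_covered
    have hc := IsDisjointParts.update_congr (k := 1) (fun _ => S) X
    refine ⟨_, h₀.append hX hXU, .start (hc 1 le_rfl) ?_⟩
    rw [basicBound_congr hc, basicBound_eq, ceilEven_bound heven, Function.update_self, hcard,
      h₀.ncard_covered hS]
    have hle : S.ncard * totalSize (fun _ => S) 1 / 393120 ≤ 60 := by
      refine Nat.div_le_of_le_mul ?_
      have := h₀.totalSize_le hS
      nlinarith
    omega
  have hreach : ∀ n ≤ 51, ∃ T k, n ≤ k ∧ IsDisjointParts S T k ∧ ImprovedRounds S T k := by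
    intro n
    induction n with
    | zero =>
      obtain ⟨T, h, hr⟩ := hstart
      exact fun _ => ⟨T, 2, by omega, h, hr⟩
    | succ n ih =>
      intro hn
      obtain ⟨T, k, hnk, h, hr⟩ := ih (by omega)
      rcases le_or_gt k 50 with hk | hk
      · obtain ⟨T', k', hlt, h', hr'⟩ := h.exists_round hS hS' hm hm' hr hk
        exact ⟨T', k', by omega, h', hr'⟩
      · exact ⟨T, k, by omega, h, hr⟩
  obtain ⟨T, K, hK, h, hr⟩ := hreach 51 le_rfl
  exact ⟨T, K, fun j hj => (h.part j hj).isAdmissible hS, fun j hj => (h.part j hj).1,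
    fun j hj => (h.part j hj).2, h.disjoint, hr, hK⟩

/-! ### Comparison of a run with the recursion on sizes -/

theorem sum_Icc_split (b : ℕ → ℕ) {k l : ℕ} (h : k ≤ l) :
    ∑ i ∈ Finset.Icc 1 l, b i = ∑ i ∈ Finset.Icc 1 k, b i + ∑ i ∈ Finset.Icc (k + 1) l, b i := by
  induction l, h using Nat.le_induction with
  | base => simp
  | succ l hl ih =>
    rw [Finset.sum_Icc_succ_top (by omega), Finset.sum_Icc_succ_top (by omega), ih, add_assoc]

/-- With P_k the k-th partial sum, the variable parts are P₁, 2P₂, P₂ + P₅, 2P₈, P₈ + P₁₆, 2P₂₄ and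
P₂₄ + P₅₁ for n = 25, …, 31. -/
theorem tableSum_mono {b c : ℕ → ℕ}
    (h : ∀ k ≤ 51, ∑ i ∈ Finset.Icc 1 k, b i ≤ ∑ i ∈ Finset.Icc 1 k, c i) {n : ℕ}
    (hn : n ∈ Finset.Icc 25 31) : tableSum n b ≤ tableSum n c := by
  have hone : ∀ a : ℕ → ℕ, ∑ i ∈ Finset.Icc 1 1, a i = a 1 := fun a => by simp
  have htwo : ∀ a : ℕ → ℕ, ∑ i ∈ Finset.Icc 1 2, a i = a 1 + a 2 := fun a => by
    rw [Finset.sum_Icc_succ_top (by norm_num), hone]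
  have hsplit : ∀ a : ℕ → ℕ,
      ∑ i ∈ Finset.Icc 1 5, a i = ∑ i ∈ Finset.Icc 1 2, a i + ∑ i ∈ Finset.Icc 3 5, a i ∧
      ∑ i ∈ Finset.Icc 1 16, a i = ∑ i ∈ Finset.Icc 1 8, a i + ∑ i ∈ Finset.Icc 9 16, a i ∧
      ∑ i ∈ Finset.Icc 1 51, a i = ∑ i ∈ Finset.Icc 1 24, a i + ∑ i ∈ Finset.Icc 25 51, a i :=
    fun a => ⟨sum_Icc_split a (by norm_num), sum_Icc_split a (by norm_num),
      sum_Icc_split a (by norm_num)⟩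
  have h1 := h 1 (by norm_num)
  have h2 := h 2 (by norm_num)
  have h5 := h 5 (by norm_num)
  have h8 := h 8 (by norm_num)
  have h16 := h 16 (by norm_num)
  have h24 := h 24 (by norm_num)
  have h51 := h 51 (by norm_num)
  have hb := hsplit b
  have hc := hsplit c
  rw [hone, hone] at h1
  rw [htwo, htwo] at h2
  rw [htwo] at hb hc
  obtain ⟨hn1, hn2⟩ := Finset.mem_Icc.1 hn
  interval_cases n <;> simp only [tableSum] <;> omega

theorem sum_sizes (l : List ℕ) (k : ℕ) :
    ∑ i ∈ Finset.Icc 1 k, sizes l i = (l.take k).sum := by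
  induction k with
  | zero => simp
  | succ k ih =>
    rw [Finset.sum_Icc_succ_top (by omega), ih, sizes, Nat.add_sub_cancel]
    rcases lt_or_ge k l.length with hk | hk
    · rw [List.take_succ_eq_append_getElem hk, List.sum_append, List.getD_eq_getElem _ _ hk]
      simp
    · rw [List.take_of_length_le hk, List.take_of_length_le (by omega),
        List.getD_eq_default _ _ hk, add_zero]

theorem improvedStep_of_length {m : ℕ} {l : List ℕ} (h : 50 < l.length) (r : ℕ) :
    (improvedStep m)^[r] l = l :=
  Function.iterate_fixed (by rw [improvedStep, if_pos h]) r

/-- At the end of each round, the sizes in a run have the same sum as in the recursion on sizes, and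
their partial sums are at least as large. -/
theorem ImprovedRounds.exists_iterate {S : Set (EuclideanSpace ℝ (Fin 24))}
    {T : ℕ → Set (EuclideanSpace ℝ (Fin 24))} (hS : IsAdmissible S) (hpos : S.ncard ≠ 0)
    (heven : Even S.ncard) {k : ℕ} (hr : ImprovedRounds S T k) :
    IsDisjointParts S T k → ∃ r l, (improvedStep S.ncard)^[r]
      [S.ncard, listBasicBound S.ncard [S.ncard]] = l ∧ r + 2 ≤ k ∧ k ≤ 52 ∧ l.length = k ∧
      l.sum = totalSize T k ∧ ∀ i ≤ k, (l.take i).sum ≤ totalSize T i := by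
  induction hr with
  | start h1 h2 =>
    intro _
    have ht0 : totalSize T 0 = 0 := by simp [totalSize]
    have ht1 : totalSize T 1 = S.ncard := by
      rw [totalSize_succ, ht0, h1, zero_add]
    have ht2 : totalSize T 2 = S.ncard + listBasicBound S.ncard [S.ncard] := by
      have hb : listBasicBound S.ncard [S.ncard] = (T 2).ncard := by
        rw [listBasicBound, ceilEven_bound heven]
        rw [basicBound_eq, ceilEven_bound heven, ht1] at h2
        rw [List.sum_singleton, ← h2, Int.toNat_natCast]
      rw [totalSize_succ, ht1, hb]
    refine ⟨0, _, rfl, le_rfl, by norm_num, rfl, by rw [ht2]; simp, fun i hi => ?_⟩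
    interval_cases i
    · simp
    · rw [ht1]; simp
    · rw [ht2]; simp
  | even k hk hk50 he hE hsum hsum' ih =>
    intro h
    have hk' := h.mono (show k ≤ k + 2 by omega)
    obtain ⟨r, l, hl, hr, -, hlen, hls, htake⟩ := ih hk'
    have hEk := hk'.expectedOverlap_eq hS
    have hsums : ∑ j ∈ Finset.Icc 1 k, ((T j).ncard : ℝ) = (totalSize T k : ℝ) := by
      rw [totalSize]
      push_cast
      rfl
    have ht1 := totalSize_succ T k
    have ht2 : totalSize T (k + 2) = totalSize T (k + 1) + (T (k + 2)).ncard :=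
      totalSize_succ T (k + 1)
    have hfe : floorEven (listOverlap S.ncard l) = floorEven (expectedOverlap S T k) := by
      rw [hEk, floorEven_overlap, listOverlap, floorEven_overlap, hls]
    have hcond : Even ⌊listOverlap S.ncard l⌋ := by
      rw [hEk, floor_overlap] at he
      rwa [listOverlap, floor_overlap, hls]
    generalize hd : (S.ncard : ℤ) - floorEven (expectedOverlap S T k) = d at *
    -- The condition on E_{k+2} fixes the total size of the two new sets, since |S| ≠ 0. In
    -- particular d is not negative, so nothing is lost in `d.toNat`.
    have htot : ((T (k + 1)).ncard : ℤ) + ((T (k + 2)).ncard : ℤ) = 2 * d := by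
      have hd' : (S.ncard : ℝ) - (floorEven (expectedOverlap S T k) : ℝ) = (d : ℝ) := by
        rw [← hd]
        push_cast
        rfl
      rw [h.expectedOverlap_eq hS, hsums, ncard_minimalVectors, hd', ht2, ht1] at hE
      have hpos' : (S.ncard : ℝ) ≠ 0 := by exact_mod_cast hpos
      push_cast at hE
      rw [div_left_inj' (by norm_num), mul_right_inj' hpos'] at hE
      have : ((T (k + 1)).ncard : ℝ) + ((T (k + 2)).ncard : ℝ) = 2 * (d : ℝ) := by
        linarith
      exact_mod_cast this
    have hstep : (improvedStep S.ncard)^[r + 1] [S.ncard, listBasicBound S.ncard [S.ncard]] =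
        l ++ [d.toNat, d.toNat] := by
      rw [Function.iterate_succ_apply', hl, improvedStep, if_neg (by omega), if_pos hcond, hfe, hd]
    have hfull : (l ++ [d.toNat, d.toNat]).sum = totalSize T (k + 2) := by
      rw [ht2, ht1, List.sum_append, hls]
      simp only [List.sum_cons, List.sum_nil]
      omega
    refine ⟨r + 1, _, hstep, by omega, by omega, by simp [hlen], hfull, fun i hi => ?_⟩
    rcases Nat.lt_or_ge k i with hki | hki
    · obtain rfl | rfl : i = k + 1 ∨ i = k + 2 := by omega
      -- From 2a + b ≥ 3d and a + b = 2d follows a ≥ d: also in the middle of the round the partial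
      -- sum is not smaller than in the list.
      · rw [← hlen, List.take_length_add_append, List.sum_append, hls, hlen, ht1]
        simp only [List.take_succ_cons, List.take_zero, List.sum_cons, List.sum_nil]
        omega
      · rw [List.take_of_length_le (by simp [hlen]), hfull]
    · rw [List.take_append_of_le_length (by omega)]
      exact htake i hki
  | odd k hk hk50 ho hcard ih =>
    intro h
    have hk' := h.mono (show k ≤ k + 1 by omega)
    obtain ⟨r, l, hl, hr, -, hlen, hls, htake⟩ := ih hk'
    have hcond : ¬ Even ⌊listOverlap S.ncard l⌋ := by
      rw [hk'.expectedOverlap_eq hS, floor_overlap] at ho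
      rw [listOverlap, floor_overlap, hls]
      exact Int.not_even_iff_odd.2 ho
    have hb : listBasicBound S.ncard l = (T (k + 1)).ncard := by
      rw [basicBound_eq, ceilEven_bound heven] at hcard
      rw [listBasicBound, ceilEven_bound heven, hls, ← hcard, Int.toNat_natCast]
    have hstep : (improvedStep S.ncard)^[r + 1] [S.ncard, listBasicBound S.ncard [S.ncard]] =
        l ++ [(T (k + 1)).ncard] := by
      rw [Function.iterate_succ_apply', hl, improvedStep, if_neg (by omega), if_neg hcond, hb]
    have hfull : (l ++ [(T (k + 1)).ncard]).sum = totalSize T (k + 1) := by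
      rw [totalSize_succ, List.sum_append, hls, List.sum_singleton]
    refine ⟨r + 1, _, hstep, by omega, by omega, by simp [hlen], hfull, fun i hi => ?_⟩
    rcases Nat.lt_or_ge k i with hki | hki
    · obtain rfl : i = k + 1 := by omega
      rw [List.take_of_length_le (by simp [hlen]), hfull]
    · rw [List.take_append_of_le_length (by omega)]
      exact htake i hki

theorem IsImprovedRun.tableSum_le {S : Set (EuclideanSpace ℝ (Fin 24))}
    {T : ℕ → Set (EuclideanSpace ℝ (Fin 24))} {K : ℕ} (h : IsImprovedRun S T K)
    (hS : IsAdmissible S) (hS' : IsAntipodal S) (hpos : S.ncard ≠ 0) {n : ℕ}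
    (hn : n ∈ Finset.Icc 25 31) :
    tableSum n (sizes (improvedList S.ncard)) ≤ tableSum n (fun j => (T j).ncard) := by
  have hparts : IsDisjointParts S T K :=
    ⟨fun j hj => ⟨h.antipodal j hj, h.translate j hj⟩, h.disjoint⟩
  have hK := h.length_gt
  obtain ⟨r, l, hl, hr, hK', hlen, -, htake⟩ :=
    h.rounds.exists_iterate hS hpos (hS'.even_ncard hS.1) hparts
  -- The run took r ≤ K - 2 ≤ 50 rounds. The remaining iterations leave a list of length above 50
  -- unchanged.
  have hlist : improvedList S.ncard = l := by
    rw [improvedList, show 50 = (50 - r) + r by omega, Function.iterate_add_apply, hl,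
      improvedStep_of_length (by omega)]
  refine tableSum_mono (fun k hk => ?_) hn
  rw [sum_sizes, hlist]
  exact htake k (by omega)

theorem IsImprovedRun.le_kissingNumber {S : Set (EuclideanSpace ℝ (Fin 24))}
    {T : ℕ → Set (EuclideanSpace ℝ (Fin 24))} {K : ℕ} (h : IsImprovedRun S T K) {n : ℕ}
    (hn : n ∈ Finset.Icc 25 31) :
    (tableSum n (fun j => (T j).ncard) : ℕ∞) ≤ kissingNumber n := by
  have hsub : Finset.Icc 1 51 ⊆ Finset.Icc 1 K := Finset.Icc_subset_Icc_right h.length_gt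
  exact tableSum_le_kissingNumber (fun j hj => h.admissible j (hsub hj))
    (fun i hi j hj => h.disjoint i (hsub hi) j (hsub hj)) hn

theorem improvedRun_bounds {S : Set (EuclideanSpace ℝ (Fin 24))} {m : ℕ}
    (hm : m ∈ ({480, 488} : Finset ℕ)) (hS : IsAdmissible S) (hS' : IsAntipodal S)
    (hcard : S.ncard = m) :
    (∃ T K, IsImprovedRun S T K) ∧
      ∀ T K, IsImprovedRun S T K → ∀ n ∈ Finset.Icc 25 31,
        tableSum n (sizes (improvedList m)) ≤ tableSum n (fun j => (T j).ncard) ∧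
        (tableSum n (fun j => (T j).ncard) : ℕ∞) ≤ kissingNumber n := by
  subst hcard
  have hm' : S.ncard = 480 ∨ S.ncard = 488 := by simpa using hm
  exact ⟨exists_isImprovedRun hS hS' (by omega) (by omega), fun T K h n hn =>
    ⟨h.tableSum_le hS hS' (by omega) hn, h.le_kissingNumber hn⟩⟩

theorem exists_start {m : ℕ} (hm : m ∈ ({480, 488} : Finset ℕ)) :
    ∃ S, IsAdmissible S ∧ IsAntipodal S ∧ S.ncard = m := by
  have hm' : m = 480 ∨ m = 488 := by simpa using hm
  obtain ⟨S, h1, h2, h3⟩ := exists_antipodal_admissible (k := m / 2) (by omega)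
  exact ⟨S, h1, h2, by omega⟩

/-! ### Values of the recursions on sizes -/

theorem tableSum_improvedList_480 :
    tableSum 28 (sizes (improvedList 480)) = 204188 ∧
      tableSum 29 (sizes (improvedList 480)) = 207930 ∧
      tableSum 30 (sizes (improvedList 480)) = 219012 ∧
      tableSum 31 (sizes (improvedList 480)) = 230880 := by
  decide +kernel

theorem tableSum_improvedList_488 :
    tableSum 28 (sizes (improvedList 488)) = 204316 ∧
      tableSum 29 (sizes (improvedList 488)) = 208120 ∧
      tableSum 30 (sizes (improvedList 488)) = 219380 ∧
      tableSum 31 (sizes (improvedList 488)) = 231428 := by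
  decide +kernel

theorem tableSum_basicList_480 :
    tableSum 28 (sizes (basicList 480)) = 204188 ∧
      tableSum 29 (sizes (basicList 480)) = 207930 ∧
      tableSum 30 (sizes (basicList 480)) = 219008 ∧
      tableSum 31 (sizes (basicList 480)) = 230872 := by
  decide +kernel

theorem tableSum_basicList_488 :
    tableSum 28 (sizes (basicList 488)) = 204312 ∧
      tableSum 29 (sizes (basicList 488)) = 208114 ∧
      tableSum 30 (sizes (basicList 488)) = 219368 ∧
      tableSum 31 (sizes (basicList 488)) = 231412 := by
  decide +kernel

end Kissing

end

/-! ### The theorem -/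

open Kissing in
theorem theorem4p14 :
    -- there are starting sets of both sizes
    (∀ m ∈ ({480, 488} : Finset ℕ), ∃ S : Set (EuclideanSpace ℝ (Fin 24)),
      IsAdmissible S ∧ IsAntipodal S ∧ S.ncard = m) ∧
    -- for every starting set of size 480 or 488, the recursion on sets can be carried out, and
    -- every run gives kissing configurations at least as large as the recursion on sizes predicts
    (∀ m ∈ ({480, 488} : Finset ℕ), ∀ S : Set (EuclideanSpace ℝ (Fin 24)),
      IsAdmissible S → IsAntipodal S → S.ncard = m →
        (∃ T K, IsImprovedRun S T K) ∧
        ∀ T K, IsImprovedRun S T K → ∀ n ∈ Finset.Icc 25 31,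
          tableSum n (sizes (improvedList m)) ≤ tableSum n (fun j => (T j).ncard) ∧
          (tableSum n (fun j => (T j).ncard) : ℕ∞) ≤ kissingNumber n) ∧
    -- the numbers that the recursion on sizes produces are lower bounds for the kissing numbers
    (∀ m ∈ ({480, 488} : Finset ℕ), ∀ n ∈ Finset.Icc 25 31,
      (tableSum n (sizes (improvedList m)) : ℕ∞) ≤ kissingNumber n) ∧
    -- their values
    (tableSum 28 (sizes (improvedList 480)) = 204188 ∧
      tableSum 29 (sizes (improvedList 480)) = 207930 ∧
      tableSum 30 (sizes (improvedList 480)) = 219012 ∧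
      tableSum 31 (sizes (improvedList 480)) = 230880) ∧
    (tableSum 28 (sizes (improvedList 488)) = 204316 ∧
      tableSum 29 (sizes (improvedList 488)) = 208120 ∧
      tableSum 30 (sizes (improvedList 488)) = 219380 ∧
      tableSum 31 (sizes (improvedList 488)) = 231428) ∧
    -- the values from the basic recursion
    (tableSum 28 (sizes (basicList 480)) = 204188 ∧
      tableSum 29 (sizes (basicList 480)) = 207930 ∧
      tableSum 30 (sizes (basicList 480)) = 219008 ∧
      tableSum 31 (sizes (basicList 480)) = 230872) ∧
    (tableSum 28 (sizes (basicList 488)) = 204312 ∧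
      tableSum 29 (sizes (basicList 488)) = 208114 ∧
      tableSum 30 (sizes (basicList 488)) = 219368 ∧
      tableSum 31 (sizes (basicList 488)) = 231412) ∧
    -- the comparison
    (∀ n ∈ Finset.Icc 30 31,
      tableSum n (sizes (basicList 480)) < tableSum n (sizes (improvedList 480))) ∧
    (∀ n ∈ Finset.Icc 28 31,
      tableSum n (sizes (basicList 488)) < tableSum n (sizes (improvedList 488))) := by
  refine ⟨fun m hm => exists_start hm, fun m hm S hS hS' hcard => improvedRun_bounds hm hS hS' hcard,
    fun m hm n hn => ?_, tableSum_improvedList_480, tableSum_improvedList_488,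
    tableSum_basicList_480, tableSum_basicList_488, fun n hn => ?_, fun n hn => ?_⟩
  · obtain ⟨S, hS, hS', hcard⟩ := exists_start hm
    obtain ⟨⟨T, K, hrun⟩, hbound⟩ := improvedRun_bounds hm hS hS' hcard
    obtain ⟨hle, hkiss⟩ := hbound T K hrun n hn
    exact (Nat.cast_le.2 hle).trans hkiss
  · obtain ⟨h1, h2, h3, h4⟩ := tableSum_improvedList_480
    obtain ⟨h1', h2', h3', h4'⟩ := tableSum_basicList_480
    obtain ⟨hn1, hn2⟩ := Finset.mem_Icc.1 hn
    interval_cases n <;> omega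
  · obtain ⟨h1, h2, h3, h4⟩ := tableSum_improvedList_488
    obtain ⟨h1', h2', h3', h4'⟩ := tableSum_basicList_488
    obtain ⟨hn1, hn2⟩ := Finset.mem_Icc.1 hn
    interval_cases n <;> omega
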